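/- Let $n>2$, $r+s=n$ and $n/2<p\le\infty$. Manifolds are $n$-dimensional, smooth, Hausdorff, second countable, without boundary and not necessarily connected; a closed manifold is a compact one. For a manifold $M$ let $D_{\mathrm{EH}}(M)$ be the set of metrics of signature $(r,s)$ (with $r$ minus signs and $s$ plus signs) on $M$ of class $W^{2,p}_{\mathrm{loc}}$; since $p>n/2$ these are continuous. Let $\mathfrak D_{\mathrm{EH}}$ be the set of variational configurations $(M,g;\Omega)$, where $g\in D_{\mathrm{EH}}(M)$ and $\Omega\subset M$ is open and precompact. The Einstein–Hilbert action is $$S_{\mathrm{EH}}[M,g;\Omega]=\int_\Omega \mathcal L[g],\qquad \mathcal L[g]=R[g]\,|\det g_{\mu\nu}|^{1/2}\,dx,$$ where $R[g]$ is the scalar curvature, computed with weak derivatives. For a configuration $(M,g;\Omega)$, let $\mathcal U(M,g;\Omega)$ be the set of $h\in W^{2,p}_c(\operatorname{Sym}\Omega)$ (symmetric $(0,2)$-tensor fields of class $W^{2,p}$ with compact support in $\Omega$, with the topology of the $W^{2,p}$ norm) such that $g+h$ is a metric of signature $(r,s)$. For a closed manifold $M'$ and $g'\in D_{\mathrm{EH}}(M')$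 define the deformation map $\Phi_{(M,g;\Omega,M',g')}:\mathcal U(M,g;\Omega)\times[0,\infty)\to\mathfrak D_{\mathrm{EH}}$ by $$\Phi(h,0)=(M,g+h;\Omega),\qquad \Phi(h,\epsilon)=(M\sqcup M',(g+h)\oplus\epsilon g';\Omega\sqcup M')\quad(\epsilon>0).$$ Let $\tau_1$ be the final topology on $\mathfrak D_{\mathrm{EH}}$ with respect to all deformation maps. The disconnected topological functional derivative of $F:\mathfrak D_{\mathrm{EH}}\to\mathbb R$ at $(M,g;\Omega)$ along $(M',g')$ is the one-sided derivative $$\delta_{(M,g;\Omega)}F[M',g']=\frac{d}{d\epsilon}\Big|_{\epsilon=0^+}F\big(\Phi_{(M,g;\Omega,M',g')}(0,\epsilon)\big),$$ if it exists. If $F$ is $\tau_1$-continuous and this derivative exists for all $(M,g;\Omega)$ and all $(M',g')$, then $F$ is called differentiable with respect to disconnected topological variations. **Theorem (Disconnected topological stability of the Einstein–Hilbert action).** The action $S_{\mathrm{EH}}:(\mathfrak D_{\mathrm{EH}},\tau_1)\to\mathbb R$ is continuous, and: 1. If $n<4$, then $S_{\mathrm{EH}}$ is not differentiable with respect to disconnected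 topological variations. More precisely, the derivative at any $(M,g;\Omega)$ along $(M',g')$ does not exist whenever $g'$ has non-zero mean scalar curvature, and for every $(M,g;\Omega)$ there is $(M',g')$ for which the derivative does not exist. 2. If $n=4$, then $S_{\mathrm{EH}}$ is differentiable with respect to disconnected topological variations, with $$\delta_{(M,g;\Omega)}S_{\mathrm{EH}}[M',g']=\int_{M'}\mathcal L[g'].$$ For every $(M,g;\Omega)$ this functional of $(M',g')$ is not identically zero, and its value at $(M',g')$ is zero if and only if $g'$ has zero mean scalar curvature. 3. If $n>4$, then $S_{\mathrm{EH}}$ is differentiable with respect to disconnected topological variations, and its derivative is identically zero. -/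

import Mathlib

open scoped Manifold ContDiff ENNReal NNReal
open MeasureTheory Set Topology

noncomputable section

namespace EH

/-! ## Manifolds -/

/-- An `n`-dimensional differentiable manifold: smooth, Hausdorff, second countable, without
boundary, not necessarily connected. -/
structure Mfld (n : ℕ) where
  carrier : Type
  [top : TopologicalSpace carrier]
  [t2 : T2Space carrier]
  [secondCountable : SecondCountableTopology carrier]
  [charted : ChartedSpace (EuclideanSpace ℝ (Fin n)) carrier]
  [smooth : IsManifold (𝓡 n) ∞ carrier]

instance (n : ℕ) : CoeSort (Mfld n) Type := ⟨Mfld.carrier⟩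

attribute [instance] Mfld.top Mfld.t2 Mfld.secondCountable Mfld.charted Mfld.smooth

/-- Manifolds carry their Borel sigma-algebra. -/
instance {n : ℕ} (M : Mfld n) : MeasurableSpace M := borel M

instance {n : ℕ} (M : Mfld n) : BorelSpace M := ⟨rfl⟩

/-- The disjoint union of two manifolds. -/
def Mfld.sum {n : ℕ} (M M' : Mfld n) : Mfld n where
  carrier := M ⊕ M'

/-- The charts of the given atlas of `M`. -/
abbrev Mfld.Chart {n : ℕ} (M : Mfld n) := OpenPartialHomeomorph M (EuclideanSpace ℝ (Fin n))

/-- The atlas of `M`. -/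
abbrev Mfld.charts {n : ℕ} (M : Mfld n) : Set M.Chart := atlas (EuclideanSpace ℝ (Fin n)) M

/-- Fields of bilinear forms on the tangent spaces, i.e. (0,2)-tensor fields. -/
abbrev Tensor2 {n : ℕ} (M : Mfld n) : Type :=
  ∀ x : M, LinearMap.BilinForm ℝ (TangentSpace (𝓡 n) x)

/-- The coordinate vector `∂_i` at the point with coordinates `y` in the chart `e`. -/
def coordVec {n : ℕ} {M : Mfld n} (e : M.Chart) (i : Fin n) (y : EuclideanSpace ℝ (Fin n)) :
    TangentSpace (𝓡 n) (e.symm y) :=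
  mfderiv (𝓡 n) (𝓡 n) e.symm y (EuclideanSpace.single i (1 : ℝ) : EuclideanSpace ℝ (Fin n))

/-- The component `T_{ij}` of a (0,2)-tensor field in the chart `e`, as a function on
`e.target`. -/
def component {n : ℕ} {M : Mfld n} (T : Tensor2 M) (e : M.Chart) (i j : Fin n)
    (y : EuclideanSpace ℝ (Fin n)) : ℝ :=
  T (e.symm y) (coordVec e i y) (coordVec e j y)

/-- The bilinear form `B` can be brought to the form `diag(-1, …, -1, 1, …, 1)` with `r` entries
`-1` and `s` entries `1`. -/
def HasSignature (r s : ℕ) {V : Type*} [AddCommGroup V] [Module ℝ V]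
    (B : LinearMap.BilinForm ℝ V) : Prop :=
  ∃ b : Module.Basis (Fin r ⊕ Fin s) ℝ V, ∀ i j,
    B (b i) (b j) = if i = j then Sum.elim (fun _ => (-1 : ℝ)) (fun _ => 1) i else 0

/-! ## Weak derivatives and Sobolev regularity -/

/-- `f` is in `L^p_loc(U)`. -/
def LocMemLp {n : ℕ} (p : ℝ≥0∞) (U : Set (EuclideanSpace ℝ (Fin n)))
    (f : EuclideanSpace ℝ (Fin n) → ℝ) : Prop :=
  ∀ K ⊆ U, IsCompact K → MemLp f p (volume.restrict K)

/-- `f'` is the weak partial derivative `∂_i f` on the open set `U`. -/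
def HasWeakPartial {n : ℕ} (U : Set (EuclideanSpace ℝ (Fin n))) (i : Fin n)
    (f f' : EuclideanSpace ℝ (Fin n) → ℝ) : Prop :=
  LocallyIntegrableOn f U ∧ LocallyIntegrableOn f' U ∧
    ∀ φ : EuclideanSpace ℝ (Fin n) → ℝ, ContDiff ℝ ∞ φ → HasCompactSupport φ → tsupport φ ⊆ U →
      ∫ y, f y * fderiv ℝ φ y (EuclideanSpace.single i (1 : ℝ)) = - ∫ y, f' y * φ y

open Classical in
/-- The weak partial derivative `∂_i f` on `U` (unique up to null sets; `0` if there is none). -/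
def weakPartial {n : ℕ} (U : Set (EuclideanSpace ℝ (Fin n))) (i : Fin n)
    (f : EuclideanSpace ℝ (Fin n) → ℝ) : EuclideanSpace ℝ (Fin n) → ℝ :=
  if h : ∃ f', HasWeakPartial U i f f' then h.choose else 0

/-- `f` is in `W^{2,p}_loc(U)`. -/
def MemW2Loc {n : ℕ} (p : ℝ≥0∞) (U : Set (EuclideanSpace ℝ (Fin n)))
    (f : EuclideanSpace ℝ (Fin n) → ℝ) : Prop :=
  LocMemLp p U f ∧ ∀ i, ∃ f₁, HasWeakPartial U i f f₁ ∧ LocMemLp p U f₁ ∧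
    ∀ j, ∃ f₂, HasWeakPartial U j f₁ f₂ ∧ LocMemLp p U f₂

/-- `T` is (the continuous representative of) a tensor field of class `W^{2,p}_loc`. For `p > n/2`
every class in `W^{2,p}_loc` has exactly one continuous representative. -/
def IsW2Loc {n : ℕ} {M : Mfld n} (p : ℝ≥0∞) (T : Tensor2 M) : Prop :=
  ∀ e ∈ M.charts, ∀ i j, ContinuousOn (component T e i j) e.target ∧ MemW2Loc p e.target (component T e i j)

/-- The `W^{2,p}` norm of (the components of) `T` on a compact subset `K` of a chart. -/
def sobolevNorm {n : ℕ} {M : Mfld n} (p : ℝ≥0∞) (e : M.Chart) (K : Set (EuclideanSpace ℝ (Fin n)))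
    (T : Tensor2 M) : ℝ≥0∞ :=
  ∑ i, ∑ j, (eLpNorm (component T e i j) p (volume.restrict K)
    + ∑ k, eLpNorm (weakPartial e.target k (component T e i j)) p (volume.restrict K)
    + ∑ k, ∑ l, eLpNorm (weakPartial e.target l (weakPartial e.target k (component T e i j))) p
        (volume.restrict K))

/-- An element of `D_EH(M)`: a metric of signature `(r, s)` and class `W^{2,p}_loc`. -/
structure EHMetric {n : ℕ} (M : Mfld n) (r s : ℕ) (p : ℝ≥0∞) where
  toTensor : Tensor2 M
  isW2Loc : IsW2Loc p toTensor
  hasSignature : ∀ x, HasSignature r s (toTensor x)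

/-- An element of `W^{2,p}_c(Sym Ω)`: a symmetric (0,2)-tensor field of class `W^{2,p}` with compact
support in `Ω`. -/
structure SymVar {n : ℕ} (M : Mfld n) (p : ℝ≥0∞) (Ω : Set M) where
  toTensor : Tensor2 M
  isW2Loc : IsW2Loc p toTensor
  symm : ∀ x u v, toTensor x u v = toTensor x v u
  isCompact_support : IsCompact (closure {x | toTensor x ≠ 0})
  support_subset : closure {x | toTensor x ≠ 0} ⊆ Ω

/-- The zero section. -/
instance {n : ℕ} (M : Mfld n) (p : ℝ≥0∞) (Ω : Set M) : Zero (SymVar M p Ω) where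
  zero :=
    { toTensor := 0
      isW2Loc := by
        intro e _ i j
        have h0 : component (0 : Tensor2 M) e i j = 0 := by ext y; simp [component]
        have hw : ∀ k, HasWeakPartial e.target k (0 : EuclideanSpace ℝ (Fin n) → ℝ) 0 := fun k =>
          ⟨locallyIntegrableOn_zero, locallyIntegrableOn_zero, fun φ _ _ _ => by simp⟩
        have hl : LocMemLp p e.target (0 : EuclideanSpace ℝ (Fin n) → ℝ) :=
          fun K _ _ => MemLp.zero
        rw [h0]
        exact ⟨continuousOn_const, hl, fun k => ⟨0, hw k, hl, fun l => ⟨0, hw l, hl⟩⟩⟩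
      symm := by simp
      isCompact_support := by simp
      support_subset := by simp }

/-- The topology of `W^{2,p}_c(Sym Ω)` given by the `W^{2,p}` norms. As `Ω` is precompact, the norms
over compact subsets of charts generate the same topology as the norm of `W^{2,p}(Ω)` built
from any auxiliary Riemannian metric. -/
instance {n : ℕ} (M : Mfld n) (p : ℝ≥0∞) (Ω : Set M) : TopologicalSpace (SymVar M p Ω) :=
  TopologicalSpace.generateFrom
    {B | ∃ h₀ : SymVar M p Ω, ∃ e ∈ M.charts, ∃ K ⊆ e.target, IsCompact K ∧ ∃ δ : ℝ≥0∞, 0 < δ ∧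
      B = {h : SymVar M p Ω | sobolevNorm p e K (h.toTensor - h₀.toTensor) < δ}}

/-! ## Scalar curvature, volume and action -/

section jets

variable {n : ℕ} (G : Matrix (Fin n) (Fin n) ℝ) (dG : Fin n → Fin n → Fin n → ℝ)
  (ddG : Fin n → Fin n → Fin n → Fin n → ℝ)

/-- The Christoffel symbol `Γ^σ_{μν}` in terms of `G i j = g_{ij}` and `dG k i j = ∂_k g_{ij}`. -/
def christoffel (σ μ ν : Fin n) : ℝ :=
  1 / 2 * ∑ l, G⁻¹ σ l * (dG μ l ν + dG ν l μ - dG l μ ν)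

/-- `∂_ρ g^{σλ} = - g^{σα} (∂_ρ g_{αβ}) g^{βλ}`. -/
def dInv (ρ σ l : Fin n) : ℝ :=
  - ∑ a, ∑ b, G⁻¹ σ a * dG ρ a b * G⁻¹ b l

/-- `∂_ρ Γ^σ_{μν}`, expanded by the Leibniz rule, with `ddG k l i j = ∂_k ∂_l g_{ij}`. -/
def dChristoffel (ρ σ μ ν : Fin n) : ℝ :=
  1 / 2 * ∑ l, (dInv G dG ρ σ l * (dG μ l ν + dG ν l μ - dG l μ ν)
    + G⁻¹ σ l * (ddG ρ μ l ν + ddG ρ ν l μ - ddG ρ l μ ν))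

/-- The Ricci tensor `R_{μν} = R^ρ_{μρν}`. -/
def ricci (μ ν : Fin n) : ℝ :=
  ∑ ρ, (dChristoffel G dG ddG ρ ρ μ ν - dChristoffel G dG ddG ν ρ μ ρ)
    + ∑ ρ, ∑ l, (christoffel G dG ρ ρ l * christoffel G dG l μ ν
      - christoffel G dG ρ ν l * christoffel G dG l μ ρ)

/-- The scalar curvature `R = g^{μν} R_{μν}`. -/
def scalarOfJet : ℝ := ∑ μ, ∑ ν, G⁻¹ μ ν * ricci G dG ddG μ ν

end jets

/-- The matrix `g_{ij}` in the chart `e`. -/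
def gramMatrix {n : ℕ} {M : Mfld n} (g : Tensor2 M) (e : M.Chart) (y : EuclideanSpace ℝ (Fin n)) :
    Matrix (Fin n) (Fin n) ℝ :=
  Matrix.of fun i j => component g e i j y

/-- The scalar curvature of `g` in the chart `e`, with weak derivatives. -/
def chartScalar {n : ℕ} {M : Mfld n} (g : Tensor2 M) (e : M.Chart)
    (y : EuclideanSpace ℝ (Fin n)) : ℝ :=
  scalarOfJet (gramMatrix g e y) (fun k i j => weakPartial e.target k (component g e i j) y)
    (fun k l i j => weakPartial e.target k (weakPartial e.target l (component g e i j)) y)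

/-- `R` is the scalar curvature of `g`: in every chart it is almost everywhere given by the
coordinate expression. -/
def IsScalarCurvature {n : ℕ} {M : Mfld n} (g : Tensor2 M) (R : M → ℝ) : Prop :=
  ∀ e ∈ M.charts, ∀ᵐ y ∂(volume.restrict e.target), R (e.symm y) = chartScalar g e y

/-- `μ` is the volume measure of `g`: in every chart it is `|det g_{ij}|^{1/2} dx`. -/
def IsVolumeMeasure {n : ℕ} {M : Mfld n} (g : Tensor2 M) (μ : Measure M) : Prop :=
  ∀ e ∈ M.charts, ∀ A ⊆ e.source, MeasurableSet A →
    μ A = ∫⁻ y in e.target ∩ e.symm ⁻¹' A, ENNReal.ofReal (√|(gramMatrix g e y).det|)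

open Classical in
/-- The scalar curvature `R[g]`, a function on `M` that is determined up to null sets. -/
def scalarCurvature {n : ℕ} {M : Mfld n} (g : Tensor2 M) : M → ℝ :=
  if h : ∃ R, IsScalarCurvature g R then h.choose else 0

open Classical in
/-- The volume measure of `g`. -/
def volumeMeasure {n : ℕ} {M : Mfld n} (g : Tensor2 M) : Measure M :=
  if h : ∃ μ, IsVolumeMeasure g μ then h.choose else 0

/-- The integral `∫_Ω R[g] |det g|^{1/2} dx` of the Lagrangian density. -/
def lagrangianIntegral {n : ℕ} {M : Mfld n} (g : Tensor2 M) (Ω : Set M) : ℝ :=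
  ∫ x in Ω, scalarCurvature g x ∂(volumeMeasure g)

/-- The mean scalar curvature of `(M, g)`. -/
def meanScalarCurvature {n : ℕ} {M : Mfld n} (g : Tensor2 M) : ℝ :=
  ⨍ x, scalarCurvature g x ∂(volumeMeasure g)

/-- A variational configuration `(M, g; Ω)`, where `Ω` is a precompact open subset of `M`. -/
structure Config (n r s : ℕ) (p : ℝ≥0∞) where
  M : Mfld n
  g : EHMetric M r s p
  Ω : Set M
  isOpen : IsOpen Ω
  isCompact_closure : IsCompact (closure Ω)

/-- The Einstein-Hilbert action `S_EH[M, g; Ω]`. -/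
def action {n r s : ℕ} {p : ℝ≥0∞} (c : Config n r s p) : ℝ :=
  lagrangianIntegral c.g.toTensor c.Ω

/-! ## Operations on metrics -/

section operations

variable {n : ℕ}

lemma LocMemLp.add {p : ℝ≥0∞} {U : Set (EuclideanSpace ℝ (Fin n))}
    {f g : EuclideanSpace ℝ (Fin n) → ℝ} (hf : LocMemLp p U f) (hg : LocMemLp p U g) :
    LocMemLp p U (f + g) := fun K hK hc => (hf K hK hc).add (hg K hK hc)

lemma LocMemLp.const_smul {p : ℝ≥0∞} {U : Set (EuclideanSpace ℝ (Fin n))}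
    {f : EuclideanSpace ℝ (Fin n) → ℝ} (hf : LocMemLp p U f) (c : ℝ) :
    LocMemLp p U (c • f) := fun K hK hc => (hf K hK hc).const_smul c

/-- A locally integrable function times a continuous function with compact support in `U` is
integrable. -/
lemma integrable_mul_test {U : Set (EuclideanSpace ℝ (Fin n))}
    {f φ : EuclideanSpace ℝ (Fin n) → ℝ} (hf : LocallyIntegrableOn f U) (hφ : Continuous φ)
    (hc : HasCompactSupport φ) (hs : tsupport φ ⊆ U) : Integrable (fun y => f y * φ y) := by
  have h1 : IntegrableOn f (tsupport φ) := hf.integrableOn_compact_subset hs hc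
  have h2 : IntegrableOn (fun y => f y * φ y) (tsupport φ) :=
    h1.mul_continuousOn hφ.continuousOn hc
  refine (integrableOn_iff_integrable_of_support_subset ?_).1 h2
  intro y hy
  apply subset_tsupport
  intro h
  apply hy
  simp [h]

lemma HasWeakPartial.add {U : Set (EuclideanSpace ℝ (Fin n))} {i : Fin n}
    {f f' g g' : EuclideanSpace ℝ (Fin n) → ℝ} (hf : HasWeakPartial U i f f')
    (hg : HasWeakPartial U i g g') : HasWeakPartial U i (f + g) (f' + g') := by
  refine ⟨hf.1.add hg.1, hf.2.1.add hg.2.1, fun φ h1 h2 h3 => ?_⟩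
  have hd : Continuous fun y => fderiv ℝ φ y (EuclideanSpace.single i (1 : ℝ)) :=
    (h1.continuous_fderiv (by simp)).clm_apply continuous_const
  have hdc : HasCompactSupport fun y => fderiv ℝ φ y (EuclideanSpace.single i (1 : ℝ)) :=
    h2.fderiv_apply (𝕜 := ℝ) _
  have hds : tsupport (fun y => fderiv ℝ φ y (EuclideanSpace.single i (1 : ℝ))) ⊆ U :=
    (tsupport_fderiv_apply_subset ℝ _).trans h3
  simp only [Pi.add_apply, add_mul]
  rw [integral_add (integrable_mul_test hf.1 hd hdc hds) (integrable_mul_test hg.1 hd hdc hds),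
    integral_add (integrable_mul_test hf.2.1 h1.continuous h2 h3)
      (integrable_mul_test hg.2.1 h1.continuous h2 h3), hf.2.2 φ h1 h2 h3, hg.2.2 φ h1 h2 h3]
  ring

lemma HasWeakPartial.const_smul {U : Set (EuclideanSpace ℝ (Fin n))} {i : Fin n}
    {f f' : EuclideanSpace ℝ (Fin n) → ℝ} (hf : HasWeakPartial U i f f') (c : ℝ) :
    HasWeakPartial U i (c • f) (c • f') := by
  refine ⟨hf.1.smul c, hf.2.1.smul c, fun φ h1 h2 h3 => ?_⟩
  simp only [Pi.smul_apply, smul_eq_mul, mul_assoc, integral_const_mul]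
  rw [hf.2.2 φ h1 h2 h3]
  ring

lemma MemW2Loc.add {p : ℝ≥0∞} {U : Set (EuclideanSpace ℝ (Fin n))}
    {f g : EuclideanSpace ℝ (Fin n) → ℝ} (hf : MemW2Loc p U f) (hg : MemW2Loc p U g) :
    MemW2Loc p U (f + g) := by
  refine ⟨hf.1.add hg.1, fun i => ?_⟩
  obtain ⟨f₁, a1, a2, a3⟩ := hf.2 i
  obtain ⟨g₁, b1, b2, b3⟩ := hg.2 i
  refine ⟨f₁ + g₁, a1.add b1, a2.add b2, fun j => ?_⟩
  obtain ⟨f₂, a4, a5⟩ := a3 j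
  obtain ⟨g₂, b4, b5⟩ := b3 j
  exact ⟨f₂ + g₂, a4.add b4, a5.add b5⟩

lemma MemW2Loc.const_smul {p : ℝ≥0∞} {U : Set (EuclideanSpace ℝ (Fin n))}
    {f : EuclideanSpace ℝ (Fin n) → ℝ} (hf : MemW2Loc p U f) (c : ℝ) :
    MemW2Loc p U (c • f) := by
  refine ⟨hf.1.const_smul c, fun i => ?_⟩
  obtain ⟨f₁, a1, a2, a3⟩ := hf.2 i
  refine ⟨c • f₁, a1.const_smul c, a2.const_smul c, fun j => ?_⟩
  obtain ⟨f₂, a4, a5⟩ := a3 j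
  exact ⟨c • f₂, a4.const_smul c, a5.const_smul c⟩

lemma IsW2Loc.add {M : Mfld n} {p : ℝ≥0∞} {S T : Tensor2 M} (hS : IsW2Loc p S)
    (hT : IsW2Loc p T) : IsW2Loc p (S + T) := by
  intro e he i j
  have h : component (S + T) e i j = component S e i j + component T e i j := by ext y; simp [component]
  rw [h]
  exact ⟨(hS e he i j).1.add (hT e he i j).1, (hS e he i j).2.add (hT e he i j).2⟩

lemma IsW2Loc.const_smul {M : Mfld n} {p : ℝ≥0∞} {T : Tensor2 M} (hT : IsW2Loc p T) (c : ℝ) :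
    IsW2Loc p (c • T) := by
  intro e he i j
  have h : component (c • T) e i j = c • component T e i j := by ext y; simp [component]
  rw [h]
  exact ⟨(hT e he i j).1.const_smul c, (hT e he i j).2.const_smul c⟩

lemma HasSignature.const_smul {r s : ℕ} {V : Type*} [AddCommGroup V] [Module ℝ V]
    {B : LinearMap.BilinForm ℝ V} (h : HasSignature r s B) {c : ℝ} (hc : 0 < c) :
    HasSignature r s (c • B) := by
  obtain ⟨b, hb⟩ := h
  have hu : IsUnit (√c)⁻¹ := (inv_pos.2 (Real.sqrt_pos.2 hc)).ne'.isUnit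
  refine ⟨b.isUnitSMul (fun _ => hu), fun i j => ?_⟩
  have h2 : c * ((√c)⁻¹ * (√c)⁻¹) = 1 := by
    rw [← mul_inv, Real.mul_self_sqrt hc.le, mul_inv_cancel₀ hc.ne']
  have key : c * ((√c)⁻¹ * ((√c)⁻¹ * B (b i) (b j))) = B (b i) (b j) := by
    linear_combination B (b i) (b j) * h2
  have h3 : (c • B) (b.isUnitSMul (fun _ => hu) i) (b.isUnitSMul (fun _ => hu) j)
      = c * ((√c)⁻¹ * ((√c)⁻¹ * B (b i) (b j))) := by
    simp only [Module.Basis.isUnitSMul_apply, LinearMap.smul_apply, map_smul, smul_eq_mul]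
    ring
  rw [h3, key, hb]

/-- The tensor field `g ⊕ g'` on the disjoint union. The tangent space of `M ⊔ M'` at a point
of `M` is that of `M`, the derivative of the inclusion being the identity; see `sumTensor_inl` and
`sumTensor_inr`. -/
def sumTensor {M M' : Mfld n} (g : Tensor2 M) (g' : Tensor2 M') : Tensor2 (M.sum M') :=
  fun x => match x with
    | Sum.inl x => g x
    | Sum.inr x => g' x

/-- The pullback of `g ⊕ g'` along the inclusion of `M` is `g`. -/
lemma sumTensor_inl {M M' : Mfld n} (g : Tensor2 M) (g' : Tensor2 M') (x : M)
    (u v : TangentSpace (𝓡 n) x) :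
    sumTensor g g' (Sum.inl x : M.carrier ⊕ M'.carrier)
      (mfderiv (𝓡 n) (𝓡 n) (Sum.inl : M → M.carrier ⊕ M'.carrier) x u)
      (mfderiv (𝓡 n) (𝓡 n) (Sum.inl : M → M.carrier ⊕ M'.carrier) x v) = g x u v := by
  have h : HasMFDerivAt (𝓡 n) (𝓡 n) (Sum.inl : M → M.carrier ⊕ M'.carrier) x
      (ContinuousLinearMap.id ℝ (TangentSpace (𝓡 n) (Sum.inl x : M.carrier ⊕ M'.carrier))) :=
    hasMFDerivAt_inl
  rw [h.mfderiv]
  rfl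

/-- The pullback of `g ⊕ g'` along the inclusion of `M'` is `g'`. -/
lemma sumTensor_inr {M M' : Mfld n} (g : Tensor2 M) (g' : Tensor2 M') (x : M')
    (u v : TangentSpace (𝓡 n) x) :
    sumTensor g g' (Sum.inr x : M.carrier ⊕ M'.carrier)
      (mfderiv (𝓡 n) (𝓡 n) (Sum.inr : M' → M.carrier ⊕ M'.carrier) x u)
      (mfderiv (𝓡 n) (𝓡 n) (Sum.inr : M' → M.carrier ⊕ M'.carrier) x v) = g' x u v := by
  have h : HasMFDerivAt (𝓡 n) (𝓡 n) (Sum.inr : M' → M.carrier ⊕ M'.carrier) x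
      (ContinuousLinearMap.id ℝ (TangentSpace (𝓡 n) (Sum.inr x : M.carrier ⊕ M'.carrier))) :=
    hasMFDerivAt_inr
  rw [h.mfderiv]
  rfl

lemma LocMemLp.congr {p : ℝ≥0∞} {U : Set (EuclideanSpace ℝ (Fin n))}
    {f g : EuclideanSpace ℝ (Fin n) → ℝ} (hf : LocMemLp p U f) (h : EqOn f g U) :
    LocMemLp p U g := fun K hK hc =>
  (memLp_congr_ae ((ae_restrict_iff' hc.measurableSet).2
    (Filter.Eventually.of_forall fun _ hy => h (hK hy)))).1 (hf K hK hc)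

lemma MemW2Loc.congr {p : ℝ≥0∞} {U : Set (EuclideanSpace ℝ (Fin n))} (hU : IsOpen U)
    {f g : EuclideanSpace ℝ (Fin n) → ℝ} (hf : MemW2Loc p U f) (h : EqOn f g U) :
    MemW2Loc p U g := by
  refine ⟨hf.1.congr h, fun i => ?_⟩
  obtain ⟨f₁, a1, a2⟩ := hf.2 i
  refine ⟨f₁, ⟨?_, a1.2.1, fun φ h1 h2 h3 => ?_⟩, a2⟩
  · exact a1.1.congr ((ae_restrict_iff' hU.measurableSet).2
      (Filter.Eventually.of_forall fun _ hy => h hy))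
  · rw [← a1.2.2 φ h1 h2 h3]
    refine integral_congr_ae (Filter.Eventually.of_forall fun y => ?_)
    by_cases hy : y ∈ U
    · simp [h hy]
    · have : fderiv ℝ φ y = 0 := by
        by_contra hne
        exact hy (h3 (support_fderiv_subset ℝ hne))
      simp [this]

/-- In the chart of `M ⊔ M'` that is given by a chart `e` of `M`, `g ⊕ g'` has the components of
`g`. -/
lemma component_sum_inl {M M' : Mfld n} (g : Tensor2 M) (g' : Tensor2 M') {e : M.Chart}
    (he : e ∈ M.charts) (i j : Fin n) :
    EqOn (component g e i j) (component (M := M.sum M') (sumTensor g g')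
      (e.lift_openEmbedding (IsOpenEmbedding.inl : IsOpenEmbedding
        (Sum.inl : M.carrier → M.carrier ⊕ M'.carrier))) i j) e.target := by
  intro y hy
  have hd : HasMFDerivAt (𝓡 n) (𝓡 n) e.symm y (mfderiv (𝓡 n) (𝓡 n) e.symm y) :=
    (mdifferentiableAt_atlas_symm he hy).hasMFDerivAt
  have hi : HasMFDerivAt (𝓡 n) (𝓡 n) (Sum.inl : M → M.carrier ⊕ M'.carrier) (e.symm y)
      (mfderiv (𝓡 n) (𝓡 n) (Sum.inl : M → M.carrier ⊕ M'.carrier) (e.symm y)) :=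
    (hasMFDerivAt_inl
      (p := (Sum.inl (e.symm y) : M.carrier ⊕ M'.carrier))).mdifferentiableAt.hasMFDerivAt
  have hc := (hi.comp y hd).mfderiv
  have h1 := sumTensor_inl g g' (e.symm y) (coordVec e i y) (coordVec e j y)
  refine h1.symm.trans ?_
  have h2 : ∀ k : Fin n, (coordVec (M := M.sum M') (e.lift_openEmbedding
      (IsOpenEmbedding.inl : IsOpenEmbedding (Sum.inl : M.carrier → M.carrier ⊕ M'.carrier))) k y) =
      (mfderiv (𝓡 n) (𝓡 n) (Sum.inl : M → M.carrier ⊕ M'.carrier) (e.symm y)) (coordVec e k y) :=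
    fun k => DFunLike.congr_fun hc (EuclideanSpace.single k (1 : ℝ) : EuclideanSpace ℝ (Fin n))
  change _ = sumTensor g g' (Sum.inl (e.symm y)) (coordVec (M := M.sum M') _ i y)
    (coordVec (M := M.sum M') _ j y)
  rw [h2 i, h2 j]

/-- In the chart of `M ⊔ M'` that is given by a chart `e` of `M'`, `g ⊕ g'` has the components of
`g'`. -/
lemma component_sum_inr {M M' : Mfld n} (g : Tensor2 M) (g' : Tensor2 M') {e : M'.Chart}
    (he : e ∈ M'.charts) (i j : Fin n) :
    EqOn (component g' e i j) (component (M := M.sum M') (sumTensor g g')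
      (e.lift_openEmbedding (IsOpenEmbedding.inr : IsOpenEmbedding
        (Sum.inr : M'.carrier → M.carrier ⊕ M'.carrier))) i j) e.target := by
  intro y hy
  have hd : HasMFDerivAt (𝓡 n) (𝓡 n) e.symm y (mfderiv (𝓡 n) (𝓡 n) e.symm y) :=
    (mdifferentiableAt_atlas_symm he hy).hasMFDerivAt
  have hi : HasMFDerivAt (𝓡 n) (𝓡 n) (Sum.inr : M' → M.carrier ⊕ M'.carrier) (e.symm y)
      (mfderiv (𝓡 n) (𝓡 n) (Sum.inr : M' → M.carrier ⊕ M'.carrier) (e.symm y)) :=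
    (hasMFDerivAt_inr
      (p := (Sum.inr (e.symm y) : M.carrier ⊕ M'.carrier))).mdifferentiableAt.hasMFDerivAt
  have hc := (hi.comp y hd).mfderiv
  have h1 := sumTensor_inr g g' (e.symm y) (coordVec e i y) (coordVec e j y)
  refine h1.symm.trans ?_
  have h2 : ∀ k : Fin n, (coordVec (M := M.sum M') (e.lift_openEmbedding
      (IsOpenEmbedding.inr : IsOpenEmbedding (Sum.inr : M'.carrier → M.carrier ⊕ M'.carrier))) k y) =
      (mfderiv (𝓡 n) (𝓡 n) (Sum.inr : M' → M.carrier ⊕ M'.carrier) (e.symm y)) (coordVec e k y) :=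
    fun k => DFunLike.congr_fun hc (EuclideanSpace.single k (1 : ℝ) : EuclideanSpace ℝ (Fin n))
  change _ = sumTensor g g' (Sum.inr (e.symm y)) (coordVec (M := M.sum M') _ i y)
    (coordVec (M := M.sum M') _ j y)
  rw [h2 i, h2 j]

lemma IsW2Loc.sum {M M' : Mfld n} {p : ℝ≥0∞} {g : Tensor2 M} {g' : Tensor2 M'}
    (hg : IsW2Loc p g) (hg' : IsW2Loc p g') : IsW2Loc p (sumTensor g g') := by
  intro e he i j
  obtain ⟨f, hf, rfl⟩ | ⟨f, hf, rfl⟩ :=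
    ChartedSpace.mem_atlas_sum (M := M.carrier) (M' := M'.carrier) he
  · have h := component_sum_inl g g' hf i j
    exact ⟨(hg f hf i j).1.congr h.symm, (hg f hf i j).2.congr f.open_target h⟩
  · have h := component_sum_inr g g' hf i j
    exact ⟨(hg' f hf i j).1.congr h.symm, (hg' f hf i j).2.congr f.open_target h⟩

/-- The metric `g ⊕ g'` on `M ⊔ M'`. -/
def EHMetric.sum {M M' : Mfld n} {r s : ℕ} {p : ℝ≥0∞} (g : EHMetric M r s p)
    (g' : EHMetric M' r s p) : EHMetric (M.sum M') r s p where
  toTensor := sumTensor g.toTensor g'.toTensor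
  isW2Loc := g.isW2Loc.sum g'.isW2Loc
  hasSignature := fun x => match x with
    | Sum.inl x => g.hasSignature x
    | Sum.inr x => g'.hasSignature x

/-- The metric `ε g` for `ε > 0`. -/
def EHMetric.scale {M : Mfld n} {r s : ℕ} {p : ℝ≥0∞} (g : EHMetric M r s p) (ε : ℝ)
    (hε : 0 < ε) : EHMetric M r s p where
  toTensor := ε • g.toTensor
  isW2Loc := g.isW2Loc.const_smul ε
  hasSignature := fun x => (g.hasSignature x).const_smul hε

end operations

/-! ## Deformation maps and the topology `τ₁` -/

section deformations

variable {n r s : ℕ} {p : ℝ≥0∞}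

/-- The admissible variations `h` of a configuration: those in `W^{2,p}_c(Sym Ω)` for which `g + h`
is again a metric of signature `(r, s)`. They form a neighbourhood of the zero section. -/
def Config.Variation (c : Config n r s p) : Type :=
  {h : SymVar c.M p c.Ω // ∀ x, HasSignature r s (c.g.toTensor x + h.toTensor x)}

instance (c : Config n r s p) : TopologicalSpace c.Variation :=
  inferInstanceAs (TopologicalSpace {h : SymVar c.M p c.Ω //
    ∀ x, HasSignature r s (c.g.toTensor x + h.toTensor x)})

/-- The zero variation. -/
instance (c : Config n r s p) : Zero c.Variation where
  zero := ⟨0, fun x => by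
    have h : c.g.toTensor x + (0 : SymVar c.M p c.Ω).toTensor x = c.g.toTensor x :=
      add_zero (c.g.toTensor x)
    rw [h]
    exact c.g.hasSignature x⟩

/-- The metric `g + h`. -/
def Config.varied (c : Config n r s p) (h : c.Variation) : EHMetric c.M r s p where
  toTensor := c.g.toTensor + h.1.toTensor
  isW2Loc := c.g.isW2Loc.add h.1.isW2Loc
  hasSignature := h.2

/-- The deformation map `Φ_{(M,g;Ω,M',g')}` with `M'` closed: `Φ(h, 0) = (M, g + h; Ω)` and
`Φ(h, ε) = (M ⊔ M', (g + h) ⊕ ε g'; Ω ⊔ M')` for `ε > 0`. -/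
def deformation (c : Config n r s p) (M' : Mfld n) [CompactSpace M'] (g' : EHMetric M' r s p)
    (x : c.Variation × ℝ≥0) : Config n r s p :=
  if hε : x.2 = 0 then
    { M := c.M
      g := c.varied x.1
      Ω := c.Ω
      isOpen := c.isOpen
      isCompact_closure := c.isCompact_closure }
  else
    { M := c.M.sum M'
      g := (c.varied x.1).sum (g'.scale x.2 (NNReal.coe_pos.2 (pos_iff_ne_zero.2 hε)))
      Ω := (Sum.inl '' c.Ω ∪ range Sum.inr : Set (c.M.carrier ⊕ M'.carrier))
      isOpen := (isOpenMap_inl _ c.isOpen).union isOpen_range_inr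
      isCompact_closure :=
        ((c.isCompact_closure.image continuous_inl).union (isCompact_range continuous_inr))
          |>.closure_of_subset (union_subset_union_left _ (image_mono subset_closure)) }

/-- The topology `τ₁` on the set of configurations: the final topology with respect to all
deformation maps. -/
abbrev tau1 : TopologicalSpace (Config n r s p) :=
  ⨆ (c : Config n r s p) (M' : Mfld n) (_ : CompactSpace M') (g' : EHMetric M' r s p),
    TopologicalSpace.coinduced (deformation c M' g') inferInstance

/-- `L` is the disconnected topological functional derivative of `F` at `c = (M, g; Ω)` along
`(M', g')`: the one-sided derivative at `ε = 0` of `F (Φ(0, ε))`. -/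
def HasTopologicalDeriv (F : Config n r s p → ℝ) (c : Config n r s p) (M' : Mfld n)
    [CompactSpace M'] (g' : EHMetric M' r s p) (L : ℝ) : Prop :=
  HasDerivWithinAt (fun ε : ℝ => F (deformation c M' g' (0, ε.toNNReal))) L (Ici 0) 0

/-- Existence of the disconnected topological functional derivative at all `(M, g; Ω)` along all
`(M', g')` with `M'` closed. -/
def TopologicallyDifferentiable (F : Config n r s p → ℝ) : Prop :=
  ∀ (c : Config n r s p) (M' : Mfld n) (_ : CompactSpace M') (g' : EHMetric M' r s p),
    ∃ L, HasTopologicalDeriv F c M' g' L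

end deformations

end EH

end

/-! The theorem rests on one formula. The action is additive under disjoint unions. When `g'` is
replaced by `ε g'`, the Christoffel symbols and the Ricci tensor stay the same, the inverse metric
gains a factor `ε⁻¹` and the volume a factor `√(ε ^ n)`. Hence along a deformation map the action
equals `S[M, g + h; Ω] + √(ε ^ (n - 2)) S[M', g']` (`action_deformation`); this includes `ε = 0`
because `n > 2`. The function `ε ^ ((n - 2) / 2)` has infinite slope at `0` for `n = 3`, slope `1`
for `n = 4` and slope `0` for `n > 4`, which gives the three cases. On a closed manifold the mean
scalar curvature vanishes exactly when the total one does.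

For the final topology continuity may be tested on each deformation map, so the point is that `h ↦
S[M, g + h; Ω]` is continuous for the `W^{2,p}` topology. The Lagrangian is linear in second
derivatives and quadratic in first derivatives of the metric, with coefficients continuous in the
metric. It therefore suffices to control the metric in `L^∞`, its first derivatives in `L²` and its
second derivatives in `L¹`. For `p > n / 2` the first bound is a Sobolev inequality, proved by
averaging Taylor's formula over a cone of segments (`exists_enorm_le_mul_eLpNorm_second`). The
second follows from it by the Gagliardo-Nirenberg inequality (`lintegral_sq_weakPartial_le`), and
the third by Hölder. Convergence of the products is Hölder again (`convLp_scalarOfJet`), and a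
compactness argument patches the charts together.

Curvature and volume are chosen from existence statements, so they must be shown to exist and to be
unique up to null sets. This needs a weak chain rule for transition maps
(`DiffeoOn.hasWeakPartial_comp`) and the pointwise algebraic fact that the scalar curvature of a
2-jet is invariant under changes of coordinates (`scalarOfJet_pullback`).

Finally some closed `(M', g')` of signature `(r, s)` must have non-zero total curvature. On the
torus this is achieved by `e^ψ η`, with `η` flat and `ψ` a non-constant periodic function of one
coordinate: after an integration by parts the total curvature is a non-zero multiple of the integral
of `e^((n - 2) ψ / 2) ψ'²` (`lagrangianIntegral_torus_ne_zero`). -/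

noncomputable section

namespace EH

/-! ## Calculus of weak partial derivatives -/

section weak

variable {n : ℕ}

/-- The classical partial derivative `∂_i f`. -/
abbrev pd (i : Fin n) (f : EuclideanSpace ℝ (Fin n) → ℝ) (y : EuclideanSpace ℝ (Fin n)) : ℝ :=
  fderiv ℝ f y (EuclideanSpace.single i (1 : ℝ))

variable {U V : Set (EuclideanSpace ℝ (Fin n))} {i : Fin n}
  {f g f' g' : EuclideanSpace ℝ (Fin n) → ℝ}

/-- Off `U` the product vanishes in a neighbourhood, so regularity of `a` on `U` is enough. With `m
= ∞` this makes `a φ` a test function; with `m = 0` it gives continuity of a cut-off function. -/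
lemma contDiff_mul_of_contDiffOn {m : ℕ∞} (hU : IsOpen U) {a φ : EuclideanSpace ℝ (Fin n) → ℝ}
    (ha : ContDiffOn ℝ m a U) (hφ : ContDiff ℝ m φ) (hs : tsupport φ ⊆ U) :
    ContDiff ℝ m fun y => a y * φ y := by
  rw [contDiff_iff_contDiffAt]
  intro y
  by_cases hy : y ∈ U
  · exact (ha.contDiffAt (hU.mem_nhds hy)).mul hφ.contDiffAt
  · have h0 : (fun y => a y * φ y) =ᶠ[𝓝 y] fun _ => 0 := by
      filter_upwards [(isClosed_tsupport φ).isOpen_compl.mem_nhds fun h => hy (hs h)] with z hz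
      rw [image_eq_zero_of_notMem_tsupport hz, mul_zero]
    exact contDiffAt_const.congr_of_eventuallyEq h0

lemma tsupport_mul_subset_of_right {a φ : EuclideanSpace ℝ (Fin n) → ℝ} (hs : tsupport φ ⊆ U) :
    tsupport (fun y => a y * φ y) ⊆ U :=
  (tsupport_mul_subset_right (f := a) (g := φ)).trans hs

lemma tsupport_pd_subset (φ : EuclideanSpace ℝ (Fin n) → ℝ) : tsupport (pd i φ) ⊆ tsupport φ :=
  tsupport_fderiv_apply_subset ℝ _

lemma contDiff_pd {φ : EuclideanSpace ℝ (Fin n) → ℝ} (h : ContDiff ℝ ∞ φ) :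
    ContDiff ℝ ∞ (pd i φ) :=
  (h.fderiv_right (m := ∞) (by simp)).clm_apply contDiff_const

lemma contDiffOn_pd {φ : EuclideanSpace ℝ (Fin n) → ℝ} (hU : IsOpen U) (h : ContDiffOn ℝ ∞ φ U) :
    ContDiffOn ℝ ∞ (pd i φ) U :=
  (h.fderiv_of_isOpen (m := ∞) hU (by simp)).clm_apply contDiffOn_const

/-- The fundamental lemma of the calculus of variations, applied to the difference. -/
lemma HasWeakPartial.ae_unique (hU : IsOpen U) (h1 : HasWeakPartial U i f f')
    (h2 : HasWeakPartial U i f g') : f' =ᵐ[volume.restrict U] g' := by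
  have h := hU.ae_eq_zero_of_integral_contDiff_smul_eq_zero (μ := volume) (h1.2.1.sub h2.2.1)
    (fun φ a b c => by
      have e1 := h1.2.2 φ a b c
      have e2 := h2.2.2 φ a b c
      have i1 := integrable_mul_test h1.2.1 a.continuous b c
      have i2 := integrable_mul_test h2.2.1 a.continuous b c
      have : ∀ x, φ x • (f' - g') x = f' x * φ x - g' x * φ x := fun x => by
        simp only [Pi.sub_apply, smul_eq_mul]; ring
      simp_rw [this]
      rw [integral_sub i1 i2]
      linarith)
  refine (ae_restrict_iff' hU.measurableSet).2 (h.mono fun x hx hxU => ?_)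
  have := hx hxU
  simpa [sub_eq_zero] using this

lemma integral_mul_congr_of_ae (hU : IsOpen U) {φ : EuclideanSpace ℝ (Fin n) → ℝ}
    (h : f =ᵐ[volume.restrict U] g) (hs : tsupport φ ⊆ U) :
    ∫ y, f y * φ y = ∫ y, g y * φ y := by
  refine integral_congr_ae ?_
  filter_upwards [(ae_restrict_iff' hU.measurableSet).1 h] with y hy
  by_cases hyU : y ∈ U
  · simp only [hy hyU]
  · rw [image_eq_zero_of_notMem_tsupport fun h => hyU (hs h), mul_zero, mul_zero]

lemma HasWeakPartial.congr_ae (hU : IsOpen U) (h : HasWeakPartial U i f f')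
    (hf : f =ᵐ[volume.restrict U] g) (hf' : f' =ᵐ[volume.restrict U] g') :
    HasWeakPartial U i g g' := by
  refine ⟨h.1.congr hf, h.2.1.congr hf', fun φ a b c => ?_⟩
  rw [← integral_mul_congr_of_ae hU hf' c,
    ← integral_mul_congr_of_ae (φ := pd i φ) hU hf ((tsupport_pd_subset φ).trans c)]
  exact h.2.2 φ a b c

lemma HasWeakPartial.mono (h : HasWeakPartial U i f f') (hV : V ⊆ U) : HasWeakPartial V i f f' :=
  ⟨h.1.mono_set hV, h.2.1.mono_set hV, fun φ a b c => h.2.2 φ a b (c.trans hV)⟩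

lemma HasWeakPartial.weakPartial (h : HasWeakPartial U i f f') :
    HasWeakPartial U i f (weakPartial U i f) := by
  have h' : ∃ f', HasWeakPartial U i f f' := ⟨f', h⟩
  rw [EH.weakPartial, dif_pos h']
  exact h'.choose_spec

lemma HasWeakPartial.weakPartial_ae_eq (hU : IsOpen U) (h : HasWeakPartial U i f f') :
    EH.weakPartial U i f =ᵐ[volume.restrict U] f' :=
  h.weakPartial.ae_unique hU h

/-- The equality holds everywhere and not just almost everywhere: `weakPartial` is chosen from the
predicate `HasWeakPartial U i f`, which depends only on the class of `f` modulo null sets of `U`. -/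
lemma weakPartial_congr (hU : IsOpen U) (h : f =ᵐ[volume.restrict U] g) :
    weakPartial U i f = weakPartial U i g := by
  have : HasWeakPartial U i f = HasWeakPartial U i g := by
    ext f'
    exact ⟨fun hf => hf.congr_ae hU h (by rfl), fun hg => hg.congr_ae hU h.symm (by rfl)⟩
  unfold weakPartial
  rw [this]

lemma hasWeakPartial_of_contDiffOn (hU : IsOpen U) (hf : ContDiffOn ℝ ∞ f U) :
    HasWeakPartial U i f (pd i f) := by
  have c1 : LocallyIntegrableOn f U := hf.continuousOn.locallyIntegrableOn hU.measurableSet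
  have c2 : LocallyIntegrableOn (pd i f) U :=
    (contDiffOn_pd hU hf).continuousOn.locallyIntegrableOn hU.measurableSet
  refine ⟨c1, c2, fun φ a b c => ?_⟩
  refine integral_mul_fderiv_eq_neg_fderiv_mul_of_integrable
    (integrable_mul_test c2 a.continuous b c)
    (integrable_mul_test c1 (contDiff_pd a).continuous (b.fderiv_apply (𝕜 := ℝ) _)
      ((tsupport_pd_subset φ).trans c))
    (integrable_mul_test c1 a.continuous b c) (fun x hx => ?_)
    (fun x _ => a.differentiable (by simp) x)
  exact (hf.contDiffAt (hU.mem_nhds (c hx))).differentiableAt (by simp)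

lemma hasWeakPartial_const (hU : IsOpen U) (c : ℝ) : HasWeakPartial U i (fun _ => c) 0 := by
  have := hasWeakPartial_of_contDiffOn (i := i) hU (contDiffOn_const (c := c))
  have h0 : pd i (fun _ : EuclideanSpace ℝ (Fin n) => c) = 0 := by
    ext y; simp [pd]
  rwa [h0] at this

lemma HasWeakPartial.sum (hU : IsOpen U) {ι : Type*} (s : Finset ι)
    {F F' : ι → EuclideanSpace ℝ (Fin n) → ℝ} (h : ∀ a ∈ s, HasWeakPartial U i (F a) (F' a)) :
    HasWeakPartial U i (fun y => ∑ a ∈ s, F a y) (fun y => ∑ a ∈ s, F' a y) := by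
  classical
  induction s using Finset.induction_on with
  | empty => simpa using! hasWeakPartial_const hU 0
  | insert a s ha ih =>
    simp only [Finset.sum_insert ha]
    exact (h a (by simp)).add (ih fun b hb => h b (by simp [hb]))

lemma pd_mul {a b : EuclideanSpace ℝ (Fin n) → ℝ} {y : EuclideanSpace ℝ (Fin n)}
    (ha : DifferentiableAt ℝ a y) (hb : DifferentiableAt ℝ b y) :
    pd i (fun y => a y * b y) y = pd i a y * b y + a y * pd i b y := by
  have := (ha.hasFDerivAt.mul hb.hasFDerivAt).fderiv
  simp only [pd]
  erw [this]
  simp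
  ring

/-- The product rule for a smooth function and a weakly differentiable one. -/
lemma HasWeakPartial.smooth_mul (hU : IsOpen U) {a : EuclideanSpace ℝ (Fin n) → ℝ}
    (ha : ContDiffOn ℝ ∞ a U) (hf : HasWeakPartial U i f f') :
    HasWeakPartial U i (fun y => a y * f y) (fun y => pd i a y * f y + a y * f' y) := by
  have hl := hU.isLocallyClosed
  have ca := ha.continuousOn
  have cda := (contDiffOn_pd (i := i) hU ha).continuousOn
  have l1 := hf.1.continuousOn_mul cda hl
  have l2 := hf.2.1.continuousOn_mul ca hl
  refine ⟨hf.1.continuousOn_mul ca hl, l1.add l2, fun φ h1 h2 h3 => ?_⟩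
  have t1 := contDiff_mul_of_contDiffOn hU ha h1 h3
  have t3 : tsupport (fun y => a y * φ y) ⊆ U := tsupport_mul_subset_of_right h3
  have t2 : HasCompactSupport fun y => a y * φ y := h2.mul_left (f := a)
  -- Testing the weak derivative of `f` with `a φ` produces, by the classical product rule, the
  -- extra term with `∂a`.
  have key := hf.2.2 _ t1 t2 t3
  have hpt : ∀ y, f y * pd i (fun y => a y * φ y) y
      = pd i a y * f y * φ y + a y * f y * pd i φ y := by
    intro y
    by_cases hy : y ∈ U
    · rw [pd_mul ((ha.contDiffAt (hU.mem_nhds hy)).differentiableAt (by simp))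
        (h1.differentiable (by simp) y)]
      ring
    · have e1 : φ y = 0 := image_eq_zero_of_notMem_tsupport fun h => hy (h3 h)
      have e2 : pd i φ y = 0 :=
        image_eq_zero_of_notMem_tsupport fun h => hy (h3 (tsupport_pd_subset φ h))
      have e3 : pd i (fun y => a y * φ y) y = 0 :=
        image_eq_zero_of_notMem_tsupport fun h => hy (t3 (tsupport_pd_subset _ h))
      rw [e1, e2, e3]; ring
  have i1 := integrable_mul_test l1 h1.continuous h2 h3
  have i2 : Integrable fun y => a y * f y * pd i φ y :=
    integrable_mul_test (hf.1.continuousOn_mul ca hl) (contDiff_pd h1).continuous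
      (h2.fderiv_apply (𝕜 := ℝ) _) ((tsupport_pd_subset φ).trans h3)
  have i3 := integrable_mul_test l2 h1.continuous h2 h3
  have e : ∫ y, f y * pd i (fun y => a y * φ y) y
      = (∫ y, pd i a y * f y * φ y) + ∫ y, a y * f y * pd i φ y := by
    rw [← integral_add i1 i2]
    exact integral_congr_ae (Filter.Eventually.of_forall hpt)
  have e' : ∫ y, (pd i a y * f y + a y * f' y) * φ y
      = (∫ y, pd i a y * f y * φ y) + ∫ y, a y * f' y * φ y := by
    rw [← integral_add i1 i3]
    exact integral_congr_ae (Filter.Eventually.of_forall fun y => by simp only [add_mul])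
  have e'' : ∫ y, f' y * (a y * φ y) = ∫ y, a y * f' y * φ y :=
    integral_congr_ae (Filter.Eventually.of_forall fun y => by simp only; ring)
  change ∫ y, a y * f y * pd i φ y = _
  rw [e']
  rw [e''] at key
  change ∫ y, f y * pd i (fun y => a y * φ y) y = _ at key
  rw [e] at key
  linarith

/-- Multiplication with a cutoff function extends a weak derivative to the whole space. -/
lemma HasWeakPartial.cutoff_mul (hU : IsOpen U) {χ : EuclideanSpace ℝ (Fin n) → ℝ}
    (hχ : ContDiff ℝ ∞ χ) (hc : HasCompactSupport χ) (hs : tsupport χ ⊆ U)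
    (hf : HasWeakPartial U i f f') :
    HasWeakPartial univ i (fun y => χ y * f y) (fun y => pd i χ y * f y + χ y * f' y) := by
  have h := hf.smooth_mul hU hχ.contDiffOn
  have hdc : HasCompactSupport (pd i χ) := hc.fderiv_apply (𝕜 := ℝ) _
  have hds := (tsupport_pd_subset (i := i) χ).trans hs
  have i1 : Integrable fun y => χ y * f y := by
    simpa only [mul_comm] using integrable_mul_test hf.1 hχ.continuous hc hs
  have i2 : Integrable fun y => χ y * f' y := by
    simpa only [mul_comm] using integrable_mul_test hf.2.1 hχ.continuous hc hs
  have i3 : Integrable fun y => pd i χ y * f y := by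
    simpa only [mul_comm] using integrable_mul_test hf.1 (contDiff_pd hχ).continuous hdc hds
  refine ⟨i1.locallyIntegrable.locallyIntegrableOn _,
    (i3.add i2).locallyIntegrable.locallyIntegrableOn _, fun φ h1 h2 _ => ?_⟩
  -- replace `φ` by `η φ` for a cutoff function `η` that is `1` near the support of `χ`
  obtain ⟨η, e1, e2, e3⟩ : ∃ η : EuclideanSpace ℝ (Fin n) → ℝ, ContDiff ℝ ∞ η ∧
      (∀ y ∈ tsupport χ, η =ᶠ[𝓝 y] 1) ∧ tsupport η ⊆ U := by
    obtain ⟨W, hW, hKW, hWU⟩ := exists_compact_between hc hU hs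
    obtain ⟨η, a1, a2, -⟩ := exists_contMDiffMap_one_nhds_of_subset_interior (n := ⊤)
      (𝓘(ℝ, EuclideanSpace ℝ (Fin n))) (isClosed_tsupport χ) hKW
    refine ⟨η, η.contMDiff.contDiff, fun y hy => ?_, ?_⟩
    · exact (Filter.eventually_iff_exists_mem.2 ⟨_, a1, fun _ h => h⟩ : ∀ᶠ x in 𝓝ˢ (tsupport χ),
        η x = 1).filter_mono (nhds_le_nhdsSet hy)
    · refine (closure_minimal ?_ hW.isClosed).trans hWU
      intro x hx
      by_contra hxW
      exact hx (a2 x hxW)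
  have t1 : ContDiff ℝ ∞ fun y => η y * φ y := e1.mul h1
  have t2 : HasCompactSupport fun y => η y * φ y := h2.mul_left (f := η)
  have t3 : tsupport (fun y => η y * φ y) ⊆ U := (tsupport_mul_subset_left).trans e3
  have key := h.2.2 _ t1 t2 t3
  refine Eq.trans (integral_congr_ae (Filter.Eventually.of_forall fun y => ?_)) (key.trans
    (congrArg Neg.neg (integral_congr_ae (Filter.Eventually.of_forall fun y => ?_))))
  · by_cases hy : y ∈ tsupport χ
    · have : (fun y => η y * φ y) =ᶠ[𝓝 y] φ := by
        filter_upwards [e2 y hy] with z hz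
        rw [hz, Pi.one_apply, one_mul]
      simp only [this.fderiv_eq]
    · simp only [image_eq_zero_of_notMem_tsupport hy, zero_mul]
  · by_cases hy : y ∈ tsupport χ
    · simp only [(e2 y hy).self_of_nhds, Pi.one_apply, one_mul]
    · have : pd i χ y = 0 :=
        image_eq_zero_of_notMem_tsupport fun h => hy (tsupport_pd_subset _ h)
      simp only [image_eq_zero_of_notMem_tsupport hy, zero_mul, this, add_zero]

end weak

/-! ## Weak partial derivatives and diffeomorphisms -/

section diffeo

variable {n : ℕ}

/-- `ψ : U → U'` and `ψ' : U' → U` are mutually inverse smooth maps between open sets. -/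
structure DiffeoOn (U U' : Set (EuclideanSpace ℝ (Fin n)))
    (ψ ψ' : EuclideanSpace ℝ (Fin n) → EuclideanSpace ℝ (Fin n)) : Prop where
  isOpen : IsOpen U
  isOpen' : IsOpen U'
  smooth : ContDiffOn ℝ ∞ ψ U
  smooth' : ContDiffOn ℝ ∞ ψ' U'
  mapsTo : MapsTo ψ U U'
  mapsTo' : MapsTo ψ' U' U
  left_inv : ∀ y ∈ U, ψ' (ψ y) = y
  right_inv : ∀ z ∈ U', ψ (ψ' z) = z

/-- The component `∂_i ψ^a` of the Jacobian matrix. -/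
abbrev jac (ψ : EuclideanSpace ℝ (Fin n) → EuclideanSpace ℝ (Fin n)) (a i : Fin n)
    (y : EuclideanSpace ℝ (Fin n)) : ℝ :=
  pd i (fun y => ψ y a) y

namespace DiffeoOn

variable {U U' : Set (EuclideanSpace ℝ (Fin n))}
  {ψ ψ' : EuclideanSpace ℝ (Fin n) → EuclideanSpace ℝ (Fin n)}

protected lemma symm (h : DiffeoOn U U' ψ ψ') : DiffeoOn U' U ψ' ψ :=
  ⟨h.isOpen', h.isOpen, h.smooth', h.smooth, h.mapsTo', h.mapsTo, h.right_inv, h.left_inv⟩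

variable (h : DiffeoOn U U' ψ ψ')
include h

lemma hasFDerivAt {y} (hy : y ∈ U) : HasFDerivAt ψ (fderiv ℝ ψ y) y :=
  ((h.smooth.contDiffAt (h.isOpen.mem_nhds hy)).differentiableAt (by simp)).hasFDerivAt

lemma comp_fderiv {y} (hy : y ∈ U) :
    (fderiv ℝ ψ' (ψ y)).comp (fderiv ℝ ψ y) = ContinuousLinearMap.id ℝ _ := by
  have h1 := (h.symm.hasFDerivAt (h.mapsTo hy)).comp y (h.hasFDerivAt hy)
  have h2 : (ψ' ∘ ψ) =ᶠ[𝓝 y] id := by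
    filter_upwards [h.isOpen.mem_nhds hy] with z hz using h.left_inv z hz
  exact h1.unique ((hasFDerivAt_id y).congr_of_eventuallyEq h2)

lemma det_ne_zero {y} (hy : y ∈ U) : (fderiv ℝ ψ y).det ≠ 0 := by
  intro h0
  have := congrArg ContinuousLinearMap.det (h.comp_fderiv hy)
  have e : ((fderiv ℝ ψ' (ψ y)).comp (fderiv ℝ ψ y)).det
      = (fderiv ℝ ψ' (ψ y)).det * (fderiv ℝ ψ y).det := LinearMap.det_comp _ _
  rw [e, h0, mul_zero] at this
  have e1 : (ContinuousLinearMap.id ℝ (EuclideanSpace ℝ (Fin n))).det = 1 := LinearMap.det_id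
  rw [e1] at this
  exact zero_ne_one this

lemma image_eq : ψ '' U = U' := by
  refine subset_antisymm (image_subset_iff.2 h.mapsTo) fun z hz => ⟨ψ' z, h.mapsTo' hz, h.right_inv z hz⟩

lemma injOn : InjOn ψ U := fun x hx y hy hxy => by
  rw [← h.left_inv x hx, ← h.left_inv y hy, hxy]

/-- The determinant is a polynomial in the entries of the Jacobian, and `det_ne_zero` keeps it away
from the point where the absolute value is not smooth. -/
lemma smooth_det : ContDiffOn ℝ ∞ (fun y => |(fderiv ℝ ψ y).det|) U := by
  intro y hy
  refine ContDiffAt.contDiffWithinAt ?_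
  have h1 : ContDiffAt ℝ ∞ (fderiv ℝ ψ) y :=
    (h.smooth.contDiffAt (h.isOpen.mem_nhds hy)).fderiv_right (by simp)
  have h2 : ContDiffAt ℝ ∞ (fun y => (fderiv ℝ ψ y).det) y := by
    have e : (fun y => (fderiv ℝ ψ y).det) = fun y => (Matrix.of fun a i =>
        (fderiv ℝ ψ y (EuclideanSpace.single i (1 : ℝ))) a).det := by
      ext y
      rw [ContinuousLinearMap.det, ← LinearMap.det_toMatrix (EuclideanSpace.basisFun (Fin n) ℝ).toBasis]
      congr 1
    rw [e]
    simp only [Matrix.det_apply]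
    refine ContDiffAt.sum fun σ _ => ContDiffAt.const_smul _ (contDiffAt_prod fun i _ => ?_)
    have h3 : ContDiffAt ℝ ∞ (fun y => fderiv ℝ ψ y (EuclideanSpace.single i (1 : ℝ))) y :=
      h1.clm_apply contDiffAt_const
    exact (EuclideanSpace.proj (𝕜 := ℝ) (σ i)).contDiff.contDiffAt.comp y h3
  exact h2.abs (h.det_ne_zero hy)

lemma smooth_jac (a i : Fin n) : ContDiffOn ℝ ∞ (jac ψ a i) U :=
  contDiffOn_pd h.isOpen ((EuclideanSpace.proj (𝕜 := ℝ) a).contDiff.comp_contDiffOn h.smooth)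

lemma jac_eq {y} (hy : y ∈ U) (a i : Fin n) :
    jac ψ a i y = fderiv ℝ ψ y (EuclideanSpace.single i (1 : ℝ)) a := by
  have := ((EuclideanSpace.proj (𝕜 := ℝ) a).hasFDerivAt.comp y (h.hasFDerivAt hy)).fderiv
  exact DFunLike.congr_fun this _

lemma fderiv_single {y} (hy : y ∈ U) (i : Fin n) :
    fderiv ℝ ψ y (EuclideanSpace.single i (1 : ℝ))
      = ∑ a, jac ψ a i y • EuclideanSpace.single a (1 : ℝ) := by
  ext b
  simp [h.jac_eq hy, Finset.sum_apply, Pi.single_apply]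

/-- The classical chain rule. -/
lemma pd_comp {F : EuclideanSpace ℝ (Fin n) → ℝ} {y} (hy : y ∈ U)
    (hF : DifferentiableAt ℝ F (ψ y)) (i : Fin n) :
    pd i (fun y => F (ψ y)) y = ∑ a, pd a F (ψ y) * jac ψ a i y := by
  have := (hF.hasFDerivAt.comp y (h.hasFDerivAt hy)).fderiv
  have e : pd i (fun y => F (ψ y)) y = fderiv ℝ F (ψ y) (fderiv ℝ ψ y (EuclideanSpace.single i (1 : ℝ))) :=
    DFunLike.congr_fun this _
  rw [e, h.fderiv_single hy, map_sum]
  simp [pd, mul_comm]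

lemma isCompact_image {K : Set (EuclideanSpace ℝ (Fin n))} (hK : IsCompact K) (hs : K ⊆ U) :
    IsCompact (ψ '' K) := hK.image_of_continuousOn (h.smooth.continuousOn.mono hs)

/-- Change of variables controls `|det Dψ| f ∘ ψ` on compact sets; the continuous non-vanishing
determinant is then divided out. -/
lemma locallyIntegrableOn_comp {f : EuclideanSpace ℝ (Fin n) → ℝ}
    (hf : LocallyIntegrableOn f U') : LocallyIntegrableOn (fun y => f (ψ y)) U := by
  have h1 : LocallyIntegrableOn (fun y => |(fderiv ℝ ψ y).det| • f (ψ y)) U := by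
    rw [locallyIntegrableOn_iff h.isOpen.isLocallyClosed]
    intro K hK hc
    rw [← integrableOn_image_iff_integrableOn_abs_det_fderiv_smul volume hc.measurableSet
      (fun y hy => (h.hasFDerivAt (hK hy)).hasFDerivWithinAt) (h.injOn.mono hK)]
    exact hf.integrableOn_compact_subset (image_subset_iff.2 (h.mapsTo.mono_left hK))
      (h.isCompact_image hc hK)
  have h2 := h1.continuousOn_mul (g := fun y => |(fderiv ℝ ψ y).det|⁻¹)
    (h.smooth_det.continuousOn.inv₀ fun y hy => abs_ne_zero.2 (h.det_ne_zero hy))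
    h.isOpen.isLocallyClosed
  refine h2.congr ((ae_restrict_iff' h.isOpen.measurableSet).2 (Filter.Eventually.of_forall ?_))
  intro y hy
  have := abs_ne_zero.2 (h.det_ne_zero hy)
  simp only [smul_eq_mul]
  rw [inv_mul_cancel_left₀ this]

omit h in
/-- The transport of a test function on `U` to the density `χ(ψ' z) |det Dψ'(z)|` on `U'`. -/
def push (U' : Set (EuclideanSpace ℝ (Fin n)))
    (ψ' : EuclideanSpace ℝ (Fin n) → EuclideanSpace ℝ (Fin n))
    (χ : EuclideanSpace ℝ (Fin n) → ℝ) : EuclideanSpace ℝ (Fin n) → ℝ :=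
  U'.indicator fun z => |(fderiv ℝ ψ' z).det| * χ (ψ' z)

lemma support_push {χ : EuclideanSpace ℝ (Fin n) → ℝ} :
    Function.support (push U' ψ' χ) ⊆ ψ '' (tsupport χ) := by
  intro z hz
  have hz' : z ∈ U' := by
    by_contra h0
    exact hz (indicator_of_notMem h0 _)
  rw [Function.mem_support, push, indicator_of_mem hz'] at hz
  exact ⟨ψ' z, subset_tsupport _ (right_ne_zero_of_mul hz), h.right_inv z hz'⟩

lemma tsupport_push {χ : EuclideanSpace ℝ (Fin n) → ℝ} (hc : HasCompactSupport χ)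
    (hs : tsupport χ ⊆ U) : tsupport (push U' ψ' χ) ⊆ ψ '' (tsupport χ) :=
  closure_minimal h.support_push (h.isCompact_image hc hs).isClosed

lemma tsupport_push' {χ : EuclideanSpace ℝ (Fin n) → ℝ} (hc : HasCompactSupport χ)
    (hs : tsupport χ ⊆ U) : tsupport (push U' ψ' χ) ⊆ U' :=
  (h.tsupport_push hc hs).trans (image_subset_iff.2 (h.mapsTo.mono_left hs))

lemma hasCompactSupport_push {χ : EuclideanSpace ℝ (Fin n) → ℝ} (hc : HasCompactSupport χ)
    (hs : tsupport χ ⊆ U) : HasCompactSupport (push U' ψ' χ) :=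
  (h.isCompact_image hc hs).of_isClosed_subset (isClosed_tsupport _) (h.tsupport_push hc hs)

lemma contDiff_push {χ : EuclideanSpace ℝ (Fin n) → ℝ} (hχ : ContDiff ℝ ∞ χ)
    (hc : HasCompactSupport χ) (hs : tsupport χ ⊆ U) : ContDiff ℝ ∞ (push U' ψ' χ) := by
  rw [contDiff_iff_contDiffAt]
  intro z
  by_cases hz : z ∈ U'
  · have h1 : ContDiffOn ℝ ∞ (fun z => |(fderiv ℝ ψ' z).det| * χ (ψ' z)) U' :=
      h.symm.smooth_det.mul (hχ.comp_contDiffOn h.smooth')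
    refine (h1.contDiffAt (h.isOpen'.mem_nhds hz)).congr_of_eventuallyEq ?_
    filter_upwards [h.isOpen'.mem_nhds hz] with x hx using indicator_of_mem hx _
  · refine (contDiffAt_const (c := (0 : ℝ))).congr_of_eventuallyEq ?_
    filter_upwards [(isClosed_tsupport (push U' ψ' χ)).isOpen_compl.mem_nhds
      fun h' => hz (h.tsupport_push' hc hs h')] with x hx
    exact image_eq_zero_of_notMem_tsupport hx

/-- By the change of variables `z = ψ y`, `push` is the adjoint of composition with `ψ`. No
regularity of `F` is involved. -/
lemma integral_push {χ : EuclideanSpace ℝ (Fin n) → ℝ} (hs : tsupport χ ⊆ U)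
    (F : EuclideanSpace ℝ (Fin n) → ℝ) :
    ∫ y, F (ψ y) * χ y = ∫ z, F z * push U' ψ' χ z := by
  have h1 : ∫ y, F (ψ y) * χ y = ∫ y in U, F (ψ y) * χ y :=
    (setIntegral_eq_integral_of_forall_compl_eq_zero fun y hy => by
      rw [image_eq_zero_of_notMem_tsupport fun h => hy (hs h), mul_zero]).symm
  have h2 : ∫ z, F z * push U' ψ' χ z = ∫ z in U', F z * push U' ψ' χ z :=
    (setIntegral_eq_integral_of_forall_compl_eq_zero fun y hy => by
      rw [push, indicator_of_notMem hy, mul_zero]).symm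
  rw [h1, h2, ← h.symm.image_eq, integral_image_eq_integral_abs_det_fderiv_smul volume
    h.isOpen'.measurableSet (fun z hz => (h.symm.hasFDerivAt hz).hasFDerivWithinAt) h.symm.injOn]
  refine setIntegral_congr_fun h.isOpen'.measurableSet fun z hz => ?_
  simp only [push]
  rw [indicator_of_mem hz, h.right_inv z hz, smul_eq_mul]
  ring

/-- The Piola identity. -/
lemma push_pd_ae_eq {φ : EuclideanSpace ℝ (Fin n) → ℝ} (hφ : ContDiff ℝ ∞ φ)
    (hc : HasCompactSupport φ) (hs : tsupport φ ⊆ U) (i : Fin n) :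
    push U' ψ' (pd i φ) =ᵐ[volume]
      fun z => ∑ a, pd a (push U' ψ' fun y => jac ψ a i y * φ y) z := by
  have tj1 : ∀ a, ContDiff ℝ ∞ fun y => jac ψ a i y * φ y := fun a =>
    contDiff_mul_of_contDiffOn h.isOpen (h.smooth_jac a i) hφ hs
  have tj2 : ∀ a, HasCompactSupport fun y => jac ψ a i y * φ y := fun a => hc.mul_left
  have tj3 : ∀ a, tsupport (fun y => jac ψ a i y * φ y) ⊆ U := fun a =>
    tsupport_mul_subset_of_right hs
  have td1 := contDiff_pd (i := i) hφ
  have td2 : HasCompactSupport (pd i φ) := hc.fderiv_apply (𝕜 := ℝ) _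
  have td3 := (tsupport_pd_subset (i := i) φ).trans hs
  have c1 := (h.contDiff_push td1 td2 td3).continuous
  have c2 : ∀ a, ContDiff ℝ ∞ (push U' ψ' fun y => jac ψ a i y * φ y) := fun a =>
    h.contDiff_push (tj1 a) (tj2 a) (tj3 a)
  have c3 : ∀ a, Continuous (pd a (push U' ψ' fun y => jac ψ a i y * φ y)) := fun a =>
    (contDiff_pd (c2 a)).continuous
  have c4 : Continuous fun z => ∑ a, pd a (push U' ψ' fun y => jac ψ a i y * φ y) z :=
    continuous_finsetSum _ fun a _ => c3 a
  -- The identity is proved by duality, which avoids differentiating a determinant. Paired with a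
  -- test function `F`, the left side is `-∫ ∂_i(F ∘ ψ) φ`; the chain rule splits this into terms
  -- with `∂_a F`, and each `∂_a` is moved back to the other factor.
  have key := ae_eq_zero_of_integral_contDiff_smul_eq_zero (μ := volume)
    ((c1.sub c4).locallyIntegrable) (fun F hF hFc => ?_)
  · filter_upwards [key] with z hz using sub_eq_zero.1 hz
  have hFψ : ContDiffOn ℝ ∞ (fun y => F (ψ y)) U := hF.comp_contDiffOn h.smooth
  have e1 : ∫ z, F z * push U' ψ' (pd i φ) z = - ∫ y, pd i (fun y => F (ψ y)) y * φ y := by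
    rw [← h.integral_push td3]
    exact (hasWeakPartial_of_contDiffOn (i := i) h.isOpen hFψ).2.2 φ hφ hc hs
  have e2 : ∫ y, pd i (fun y => F (ψ y)) y * φ y
      = ∑ a, ∫ z, pd a F z * push U' ψ' (fun y => jac ψ a i y * φ y) z := by
    have : ∀ y, pd i (fun y => F (ψ y)) y * φ y = ∑ a, pd a F (ψ y) * (jac ψ a i y * φ y) := by
      intro y
      by_cases hy : y ∈ U
      · rw [h.pd_comp hy (hF.differentiable (by simp) _), Finset.sum_mul]
        exact Finset.sum_congr rfl fun a _ => by ring
      · simp [image_eq_zero_of_notMem_tsupport fun h => hy (hs h)]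
    simp_rw [this]
    rw [integral_finsetSum]
    · exact Finset.sum_congr rfl fun a _ => h.integral_push (tj3 a) _
    · intro a _
      refine integrable_mul_test (U := U) ?_ (tj1 a).continuous (tj2 a) (tj3 a)
      exact (((contDiff_pd hF).continuous.comp_continuousOn h.smooth.continuousOn)).locallyIntegrableOn
        h.isOpen.measurableSet
  have e3 : ∀ a, ∫ z, pd a F z * push U' ψ' (fun y => jac ψ a i y * φ y) z
      = - ∫ z, F z * pd a (push U' ψ' fun y => jac ψ a i y * φ y) z := fun a => by
    rw [(hasWeakPartial_of_contDiffOn (i := a) isOpen_univ hF.contDiffOn).2.2 _ (c2 a)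
      (h.hasCompactSupport_push (tj2 a) (tj3 a)) (subset_univ _), neg_neg]
  have i1 : Integrable fun z => F z * push U' ψ' (pd i φ) z :=
    (hF.continuous.mul c1).integrable_of_hasCompactSupport hFc.mul_right
  have i2 : ∀ a, Integrable fun z => F z * pd a (push U' ψ' fun y => jac ψ a i y * φ y) z :=
    fun a => (hF.continuous.mul (c3 a)).integrable_of_hasCompactSupport hFc.mul_right
  have e4 : ∫ z, F z • ((push U' ψ' (pd i φ) - fun z => ∑ a,
      pd a (push U' ψ' fun y => jac ψ a i y * φ y) z) z) = ∫ z, (F z * push U' ψ' (pd i φ) z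
      - ∑ a, F z * pd a (push U' ψ' fun y => jac ψ a i y * φ y) z) := by
    refine integral_congr_ae (Filter.Eventually.of_forall fun z => ?_)
    simp only [Pi.sub_apply, smul_eq_mul, mul_sub, Finset.mul_sum]
  refine e4.trans ?_
  rw [integral_sub i1 (integrable_finsetSum _ fun a _ => i2 a), integral_finsetSum _ fun a _ => i2 a,
    e1, e2, Finset.sum_congr rfl fun a _ => e3 a, Finset.sum_neg_distrib]
  ring

/-- The chain rule for the composition of a weakly differentiable function with a
diffeomorphism. -/
lemma hasWeakPartial_comp {f : EuclideanSpace ℝ (Fin n) → ℝ}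
    {f₁ : Fin n → EuclideanSpace ℝ (Fin n) → ℝ} (hf : ∀ a, HasWeakPartial U' a f (f₁ a))
    (hf0 : LocallyIntegrableOn f U') (i : Fin n) :
    HasWeakPartial U i (fun y => f (ψ y)) (fun y => ∑ a, jac ψ a i y * f₁ a (ψ y)) := by
  have l1 : ∀ a, LocallyIntegrableOn (fun y => jac ψ a i y * f₁ a (ψ y)) U := fun a =>
    (h.locallyIntegrableOn_comp (hf a).2.1).continuousOn_mul (h.smooth_jac a i).continuousOn
      h.isOpen.isLocallyClosed
  have l2 : LocallyIntegrableOn (fun y => ∑ a, jac ψ a i y * f₁ a (ψ y)) U := by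
    rw [locallyIntegrableOn_iff h.isOpen.isLocallyClosed]
    exact fun K hK hc => integrable_finsetSum _ fun a _ => (l1 a).integrableOn_compact_subset hK hc
  refine ⟨h.locallyIntegrableOn_comp hf0, l2, fun φ hφ hc hs => ?_⟩
  have tj1 : ∀ a, ContDiff ℝ ∞ fun y => jac ψ a i y * φ y := fun a =>
    contDiff_mul_of_contDiffOn h.isOpen (h.smooth_jac a i) hφ hs
  have tj2 : ∀ a, HasCompactSupport fun y => jac ψ a i y * φ y := fun a => hc.mul_left
  have tj3 : ∀ a, tsupport (fun y => jac ψ a i y * φ y) ⊆ U := fun a =>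
    tsupport_mul_subset_of_right hs
  have c2 := fun a => h.contDiff_push (tj1 a) (tj2 a) (tj3 a)
  have c3 := fun a => h.hasCompactSupport_push (tj2 a) (tj3 a)
  have c4 := fun a => h.tsupport_push' (tj2 a) (tj3 a)
  -- Carried over to `U'`, the function `∂_i φ` becomes by the Piola identity a sum of derivatives
  -- `∂_a` of test functions on `U'`, to which the weak derivatives of `f` apply.
  have e1 : ∫ y, f (ψ y) * pd i φ y
      = ∫ z, ∑ a, f z * pd a (push U' ψ' fun y => jac ψ a i y * φ y) z := by
    rw [h.integral_push ((tsupport_pd_subset (i := i) φ).trans hs)]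
    refine integral_congr_ae ?_
    filter_upwards [h.push_pd_ae_eq hφ hc hs i] with z hz
    rw [hz, Finset.mul_sum]
  refine e1.trans ?_
  rw [integral_finsetSum _ fun a _ => integrable_mul_test hf0 (contDiff_pd (c2 a)).continuous
    ((c3 a).fderiv_apply (𝕜 := ℝ) _) ((tsupport_pd_subset _).trans (c4 a))]
  have e2 : ∀ a, ∫ z, f z * pd a (push U' ψ' fun y => jac ψ a i y * φ y) z
      = - ∫ y, (jac ψ a i y * f₁ a (ψ y)) * φ y := fun a => by
    refine ((hf a).2.2 _ (c2 a) (c3 a) (c4 a)).trans ?_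
    rw [← h.integral_push (tj3 a)]
    congr 2
    ext y
    ring
  rw [Finset.sum_congr rfl fun a _ => e2 a, Finset.sum_neg_distrib, ← integral_finsetSum _ fun a _ =>
    integrable_mul_test (l1 a) hφ.continuous hc hs]
  simp only [Finset.sum_mul]

end DiffeoOn

end diffeo

/-! ## Mollification and Sobolev estimates -/

section mollify

variable {n : ℕ} {f f' φ : EuclideanSpace ℝ (Fin n) → ℝ} {i : Fin n}

/-- The convolution `φ ⋆ f`. -/
abbrev moll (φ f : EuclideanSpace ℝ (Fin n) → ℝ) : EuclideanSpace ℝ (Fin n) → ℝ :=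
  convolution φ f (ContinuousLinearMap.lsmul ℝ ℝ) volume

lemma moll_apply (φ f : EuclideanSpace ℝ (Fin n) → ℝ) (x) :
    moll φ f x = ∫ t, φ t * f (x - t) := rfl

lemma contDiff_moll (hφ : ContDiff ℝ ∞ φ) (hc : HasCompactSupport φ) (hf : LocallyIntegrable f) :
    ContDiff ℝ ∞ (moll φ f) :=
  hc.contDiff_convolution_left _ hφ hf

/-- Mollification commutes with weak differentiation. -/
lemma HasWeakPartial.pd_moll (h : HasWeakPartial univ i f f') (hφ : ContDiff ℝ ∞ φ)
    (hc : HasCompactSupport φ) (x : EuclideanSpace ℝ (Fin n)) :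
    pd i (moll φ f) x = moll φ f' x := by
  have hf : LocallyIntegrable f := locallyIntegrableOn_univ.1 h.1
  have h1 := (hc.hasFDerivAt_convolution_left (ContinuousLinearMap.lsmul ℝ ℝ)
    (hφ.of_le (by simp)) hf x).fderiv
  have h2 : pd i (moll φ f) x = ∫ t, pd i φ (x - t) * f t := by
    change fderiv ℝ (moll φ f) x _ = _
    rw [h1, convolution_eq_swap, ContinuousLinearMap.integral_apply]
    · rfl
    · have := (hc.fderiv (𝕜 := ℝ)).convolutionExists_left
        (ContinuousLinearMap.precompL (EuclideanSpace ℝ (Fin n)) (ContinuousLinearMap.lsmul ℝ ℝ))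
        ((hφ.continuous_fderiv (by simp))) hf x
      exact this.integrable_swap
  have e : ∀ t, pd i (fun t => φ (x - t)) t = - pd i φ (x - t) := fun t => by
    have hd : HasFDerivAt (fun t => φ (x - t)) ((fderiv ℝ φ (x - t)).comp
        (-ContinuousLinearMap.id ℝ _)) t :=
      ((hφ.differentiable (by simp) (x - t)).hasFDerivAt).comp t ((hasFDerivAt_id t).const_sub x)
    simp only [pd]
    rw [hd.fderiv]
    simp
  -- The reflected translate of `φ` is the test function; the minus sign of its derivative cancels
  -- the one in the definition of a weak derivative.
  have key := h.2.2 (fun t => φ (x - t)) (hφ.comp (contDiff_const.sub contDiff_id))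
    (hc.comp_homeomorph (Homeomorph.subLeft x)) (subset_univ _)
  change ∫ t, f t * pd i (fun t => φ (x - t)) t = _ at key
  simp only [e, mul_neg, integral_neg, neg_inj] at key
  rw [h2]
  change _ = convolution φ f' _ _ x
  rw [convolution_eq_swap]
  simp only [mul_comm (f _), mul_comm (f' _)] at key
  exact key

/-- Young's inequality for the `L¹` norm with respect to a family of translated measures. -/
lemma lintegral_enorm_moll_le (ν : Measure (EuclideanSpace ℝ (Fin n))) [SFinite ν]
    (hφ : Measurable φ) (hf : Measurable f) (h1 : ∫⁻ s, ‖φ s‖ₑ = 1) {C : ℝ≥0∞}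
    (hC : ∀ s, ∫⁻ x, ‖f (x - s)‖ₑ ∂ν ≤ C) : ∫⁻ x, ‖moll φ f x‖ₑ ∂ν ≤ C := by
  -- Fubini. The measure `ν` is general because the estimate is needed for Lebesgue measure, for a
  -- Dirac measure and for the image of a ball under a dilation.
  calc ∫⁻ x, ‖moll φ f x‖ₑ ∂ν ≤ ∫⁻ x, (∫⁻ s, ‖φ s‖ₑ * ‖f (x - s)‖ₑ) ∂ν :=
        lintegral_mono fun x => by
          rw [moll_apply]
          refine (enorm_integral_le_lintegral_enorm _).trans (lintegral_mono fun s => ?_)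
          simp [enorm_mul]
    _ = ∫⁻ s, (∫⁻ x, ‖φ s‖ₑ * ‖f (x - s)‖ₑ ∂ν) := by
        refine lintegral_lintegral_swap (Measurable.aemeasurable ?_)
        exact (hφ.comp measurable_snd).enorm.mul
          (hf.comp (measurable_fst.sub measurable_snd)).enorm
    _ ≤ ∫⁻ s, ‖φ s‖ₑ * C := lintegral_mono fun s => by
        rw [lintegral_const_mul _ (show Measurable fun x => f (x - s) from
          hf.comp (measurable_id.sub_const s)).enorm]
        gcongr
        exact hC s
    _ = C := by rw [lintegral_mul_const _ hφ.enorm, h1, one_mul]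

/-- A mollifier with support in the ball of radius `1 / (k + 1)`. -/
def mollBump (n k : ℕ) : ContDiffBump (0 : EuclideanSpace ℝ (Fin n)) where
  rIn := 1 / (2 * (k + 1))
  rOut := 1 / (k + 1)
  rIn_pos := by positivity
  rIn_lt_rOut := by
    apply one_div_lt_one_div_of_lt
    · positivity
    · have : (0 : ℝ) < k + 1 := by positivity
      linarith

/-- The normalized mollifier. -/
abbrev mollFun (n k : ℕ) : EuclideanSpace ℝ (Fin n) → ℝ := (mollBump n k).normed volume

lemma mollBump_rOut_tendsto (n : ℕ) :
    Filter.Tendsto (fun k => (mollBump n k).rOut) Filter.atTop (𝓝 0) :=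
  tendsto_one_div_add_atTop_nhds_zero_nat

lemma contDiff_mollFun (n k : ℕ) : ContDiff ℝ ∞ (mollFun n k) := (mollBump n k).contDiff_normed

lemma hasCompactSupport_mollFun (n k : ℕ) : HasCompactSupport (mollFun n k) :=
  (mollBump n k).hasCompactSupport_normed

lemma lintegral_mollFun (n k : ℕ) : ∫⁻ s, ‖mollFun n k s‖ₑ = 1 := by
  have h := (mollBump n k).integral_normed (μ := volume)
  have h2 := ofReal_integral_eq_lintegral_ofReal ((mollBump n k).integrable_normed (μ := volume))
    (Filter.Eventually.of_forall fun x => (mollBump n k).nonneg_normed x)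
  rw [h, ENNReal.ofReal_one] at h2
  rw [h2]
  refine lintegral_congr fun s => ?_
  rw [Real.enorm_eq_ofReal ((mollBump n k).nonneg_normed s)]

lemma moll_tendsto_of_continuous (hf : Continuous f) (x) :
    Filter.Tendsto (fun k => moll (mollFun n k) f x) Filter.atTop (𝓝 (f x)) :=
  ContDiffBump.convolution_tendsto_right_of_continuous (mollBump_rOut_tendsto n) hf x

lemma moll_tendsto_ae (hf : LocallyIntegrable f) :
    ∀ᵐ x, Filter.Tendsto (fun k => moll (mollFun n k) f x) Filter.atTop (𝓝 (f x)) := by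
  -- The constant `2` is the ratio of the outer to the inner radius of `mollBump`.
  refine ContDiffBump.ae_convolution_tendsto_right_of_locallyIntegrable (K := 2)
    (mollBump_rOut_tendsto n) (Filter.Eventually.of_forall fun k => le_of_eq ?_) hf
  have : (0 : ℝ) < k + 1 := by positivity
  simp only [mollBump]
  field_simp

/-- The mollifier lives in the ball of radius `1 / (k + 1) ≤ 1`, so supports grow by at most `1`,
uniformly in `k`. -/
lemma moll_eq_zero {k : ℕ} {x₀ x : EuclideanSpace ℝ (Fin n)} {ρ : ℝ}
    (hs : ∀ y, ρ < dist y x₀ → f y = 0) (hx : ρ + 1 < dist x x₀) :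
    moll (mollFun n k) f x = 0 := by
  rw [moll_apply]
  refine integral_eq_zero_of_ae (Filter.Eventually.of_forall fun t => ?_)
  by_cases ht : t ∈ Metric.closedBall (0 : EuclideanSpace ℝ (Fin n)) (mollBump n k).rOut
  · have h1 : dist t 0 ≤ 1 := (Metric.mem_closedBall.1 ht).trans (by
      simp only [mollBump]
      rw [div_le_one (by positivity)]
      have : (0 : ℝ) ≤ k := by positivity
      linarith)
    have h2 : f (x - t) = 0 := hs _ (by
      have h3 : dist x x₀ ≤ dist x (x - t) + dist (x - t) x₀ := dist_triangle _ _ _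
      have h4 : dist x (x - t) = dist t 0 := by
        rw [dist_eq_norm, dist_eq_norm]; simp
      linarith)
    simp [h2]
  · have : mollFun n k t = 0 := by
      rw [← (mollBump n k).tsupport_normed_eq (μ := volume)] at ht
      exact image_eq_zero_of_notMem_tsupport ht
    simp [this]

end mollify

/-! ### The supremum bound by second derivatives, and an interpolation inequality for the gradient.
-/

section sobolev

variable {n : ℕ}

/-- Taylor's formula at `T`, where `q` and `q'` vanish, reads `q 0 = ∫ t q'' t` over `(0, T)`: one
integration by parts. -/
lemma enorm_le_lintegral_second_deriv {q q' q'' : ℝ → ℝ} (h1 : ∀ t, HasDerivAt q (q' t) t)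
    (h2 : ∀ t, HasDerivAt q' (q'' t) t) (hc : Continuous q'') {T : ℝ} (hT : 0 ≤ T)
    (hq : q T = 0) (hq' : q' T = 0) :
    ‖q 0‖ₑ ≤ ∫⁻ t in Ioc 0 T, ENNReal.ofReal t * ‖q'' t‖ₑ := by
  have hc' : Continuous q' := continuous_iff_continuousAt.2 fun t => (h2 t).continuousAt
  have e1 := intervalIntegral.integral_mul_deriv_eq_deriv_mul (a := 0) (b := T) (u := fun t => t)
    (u' := fun _ => 1) (fun t _ => hasDerivAt_id t) (fun t _ => h2 t)
    (continuous_const.intervalIntegrable _ _) (hc.intervalIntegrable _ _)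
  have e2 := intervalIntegral.integral_eq_sub_of_hasDerivAt (a := 0) (b := T) (fun t _ => h1 t)
    (hc'.intervalIntegrable _ _)
  simp only [one_mul, e2, hq', hq] at e1
  have e3 : q 0 = ∫ t in Ioc 0 T, t * q'' t := by
    rw [← intervalIntegral.integral_of_le hT, e1]; ring
  rw [e3]
  refine (enorm_integral_le_lintegral_enorm _).trans (le_of_eq ?_)
  refine setLIntegral_congr_fun measurableSet_Ioc fun t ht => ?_
  simp only [enorm_mul]
  rw [Real.enorm_eq_ofReal ht.1.le]

lemma fderiv_eq_sum_pd (w : EuclideanSpace ℝ (Fin n) → ℝ) (y ξ : EuclideanSpace ℝ (Fin n)) :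
    fderiv ℝ w y ξ = ∑ i, ξ i * pd i w y := by
  have : ξ = ∑ i, ξ i • EuclideanSpace.single i (1 : ℝ) := by
    ext j; simp [Finset.sum_apply, Pi.single_apply]
  conv_lhs => rw [this]
  simp [pd]

lemma pd_pd_eq_of_contDiff {w : EuclideanSpace ℝ (Fin n) → ℝ} (hw : ContDiff ℝ ∞ w)
    (x ξ : EuclideanSpace ℝ (Fin n)) (t : ℝ) :
    HasDerivAt (fun t : ℝ => w (x + t • ξ)) (∑ i, ξ i * pd i w (x + t • ξ)) t := by
  have h1 : HasDerivAt (fun t : ℝ => x + t • ξ) ξ t := by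
    simpa using ((hasDerivAt_id t).smul_const ξ).const_add x
  have h2 := ((hw.differentiable (by simp) (x + t • ξ)).hasFDerivAt).comp_hasDerivAt t h1
  rwa [fderiv_eq_sum_pd] at h2

/-- Taylor's formula along the segments `t ↦ x + t ξ`, integrated over the directions `ξ ∈ B`, with
Fubini to put the `t`-integral outside. The factor `9` bounds `|ξ_i ξ_j|` for `‖ξ‖ ≤ 3`. -/
lemma volume_mul_enorm_le {w : EuclideanSpace ℝ (Fin n) → ℝ} (hw : ContDiff ℝ ∞ w)
    {x : EuclideanSpace ℝ (Fin n)} {T : ℝ} (hT : 0 ≤ T) {B : Set (EuclideanSpace ℝ (Fin n))}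
    (hB : MeasurableSet B) (hB3 : ∀ ξ ∈ B, ‖ξ‖ ≤ 3)
    (hBT : ∀ ξ ∈ B, w (x + T • ξ) = 0 ∧ ∀ i, pd i w (x + T • ξ) = 0) :
    volume B * ‖w x‖ₑ ≤ 9 * ∑ i, ∑ j, ∫⁻ t in Ioc 0 T,
      ENNReal.ofReal t * ∫⁻ ξ in B, ‖pd j (pd i w) (x + t • ξ)‖ₑ := by
  have hc : ∀ i j, Continuous (pd j (pd i w)) := fun i j => (contDiff_pd (contDiff_pd hw)).continuous
  have hcc : ∀ i j, Continuous fun z : EuclideanSpace ℝ (Fin n) × ℝ =>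
      pd j (pd i w) (x + z.2 • z.1) := fun i j => (hc i j).comp
    (continuous_const.add (continuous_snd.smul continuous_fst))
  have hpt : ∀ ξ ∈ B, ‖w x‖ₑ ≤ ∑ i, ∑ j, ∫⁻ t in Ioc 0 T,
      9 * (ENNReal.ofReal t * ‖pd j (pd i w) (x + t • ξ)‖ₑ) := by
    intro ξ hξ
    have hξ1 : ∀ i, ‖ξ i‖ₑ ≤ 3 := fun i => by
      have : ‖ξ i‖ ≤ 3 := (PiLp.norm_apply_le ξ i).trans (hB3 ξ hξ)
      rw [← ofReal_norm]
      exact (ENNReal.ofReal_le_ofReal this).trans (by simp)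
    have d2 : ∀ t, HasDerivAt (fun t : ℝ => ∑ i, ξ i * pd i w (x + t • ξ))
        (∑ i, ξ i * ∑ j, ξ j * pd j (pd i w) (x + t • ξ)) t := fun t =>
      HasDerivAt.fun_sum fun i _ => (pd_pd_eq_of_contDiff (contDiff_pd hw) x ξ t).const_mul _
    have hline : Continuous fun t : ℝ => x + t • ξ := by fun_prop
    have hcont : Continuous fun t : ℝ => ∑ i, ξ i * ∑ j, ξ j * pd j (pd i w) (x + t • ξ) := by
      refine continuous_finsetSum _ fun i _ => continuous_const.mul
        (continuous_finsetSum _ fun j _ => continuous_const.mul ((hc i j).comp hline))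
    have h := enorm_le_lintegral_second_deriv (fun t => pd_pd_eq_of_contDiff hw x ξ t) d2 hcont hT
      (hBT ξ hξ).1 (by simp [(hBT ξ hξ).2])
    simp only [zero_smul, add_zero] at h
    refine h.trans ?_
    have hm : ∀ i j, Measurable fun t : ℝ =>
        9 * (ENNReal.ofReal t * ‖pd j (pd i w) (x + t • ξ)‖ₑ) := fun i j =>
      (ENNReal.measurable_ofReal.mul ((hc i j).comp hline).measurable.enorm).const_mul _
    simp_rw [← lintegral_finsetSum Finset.univ fun j _ => hm _ j]
    rw [← lintegral_finsetSum Finset.univ fun i _ => Finset.measurable_fun_sum _ fun j _ => hm i j]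
    refine lintegral_mono fun t => ?_
    calc ENNReal.ofReal t * ‖∑ i, ξ i * ∑ j, ξ j * pd j (pd i w) (x + t • ξ)‖ₑ
        ≤ ENNReal.ofReal t * ∑ i, ∑ j, 9 * ‖pd j (pd i w) (x + t • ξ)‖ₑ := by
          gcongr
          refine (enorm_sum_le _ _).trans (Finset.sum_le_sum fun i _ => ?_)
          rw [enorm_mul]
          refine (mul_le_mul' (hξ1 i) (enorm_sum_le _ _)).trans ?_
          rw [Finset.mul_sum]
          refine Finset.sum_le_sum fun j _ => ?_
          rw [enorm_mul]
          refine (mul_le_mul' le_rfl (mul_le_mul' (hξ1 j) le_rfl)).trans (le_of_eq ?_)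
          rw [← mul_assoc]
          norm_num
      _ = _ := by
          simp only [Finset.mul_sum]
          refine Finset.sum_congr rfl fun i _ => Finset.sum_congr rfl fun j _ => ?_
          ring
  calc volume B * ‖w x‖ₑ = ∫⁻ _ in B, ‖w x‖ₑ := by rw [setLIntegral_const, mul_comm]
    _ ≤ ∫⁻ ξ in B, ∑ i, ∑ j, ∫⁻ t in Ioc 0 T,
      9 * (ENNReal.ofReal t * ‖pd j (pd i w) (x + t • ξ)‖ₑ) := setLIntegral_mono' hB hpt
    _ = 9 * ∑ i, ∑ j, ∫⁻ t in Ioc 0 T,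
      ENNReal.ofReal t * ∫⁻ ξ in B, ‖pd j (pd i w) (x + t • ξ)‖ₑ := by
        have hm : ∀ i j, Measurable fun z : EuclideanSpace ℝ (Fin n) × ℝ =>
            9 * (ENNReal.ofReal z.2 * ‖pd j (pd i w) (x + z.2 • z.1)‖ₑ) := fun i j =>
          ((ENNReal.measurable_ofReal.comp measurable_snd).mul
            (hcc i j).measurable.enorm).const_mul _
        rw [lintegral_finsetSum _ fun i _ => Finset.measurable_fun_sum _ fun j _ =>
          (hm i j).lintegral_prod_right', Finset.mul_sum]
        refine Finset.sum_congr rfl fun i _ => ?_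
        rw [lintegral_finsetSum _ fun j _ => (hm i j).lintegral_prod_right', Finset.mul_sum]
        refine Finset.sum_congr rfl fun j _ => ?_
        rw [lintegral_lintegral_swap (hm i j).aemeasurable, ← lintegral_const_mul']
        · refine lintegral_congr fun t => ?_
          rw [← lintegral_const_mul', ← lintegral_const_mul']
          · norm_num
          · exact ENNReal.ofReal_ne_top
        · norm_num

/-- Hölder's inequality on a rescaled set. -/
lemma lintegral_enorm_comp_affine_le {f : EuclideanSpace ℝ (Fin n) → ℝ} (hf : Measurable f)
    {q : ℝ} (hq : 1 ≤ q) (B : Set (EuclideanSpace ℝ (Fin n))) (z : EuclideanSpace ℝ (Fin n))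
    {t : ℝ} (ht : 0 < t) :
    ∫⁻ ξ in B, ‖f (z + t • ξ)‖ₑ ≤ ENNReal.ofReal (t ^ (-(n / q) : ℝ)) *
      (volume B ^ (1 - 1 / q) * eLpNorm f (ENNReal.ofReal q) volume) := by
  have hq0 : 0 < q := by linarith
  have hemb : MeasurableEmbedding fun ξ : EuclideanSpace ℝ (Fin n) => z + t • ξ :=
    ((Homeomorph.smulOfNeZero t ht.ne').trans (Homeomorph.addLeft z)).measurableEmbedding
  -- The dilation has Jacobian `t ^ n`; in the `L^q` norm its inverse enters with the power `1 / q`,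
  -- hence the factor `t ^ (-n / q)`.
  have hmap : Measure.map (fun ξ : EuclideanSpace ℝ (Fin n) => z + t • ξ) volume
      = ENNReal.ofReal |(t ^ n)⁻¹| • volume := by
    have e : (fun ξ : EuclideanSpace ℝ (Fin n) => z + t • ξ)
        = (fun ξ => z + ξ) ∘ fun ξ => t • ξ := rfl
    rw [e, ← Measure.map_map (measurable_const_add z) (measurable_const_smul t),
      Measure.map_addHaar_smul _ ht.ne', Measure.map_smul, map_add_left_eq_self]
    simp
  have hm : Measurable fun ξ => f (z + t • ξ) := hf.comp hemb.measurable
  have h1 : (1 : ℝ≥0∞) ≤ ENNReal.ofReal q := by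
    rw [← ENNReal.ofReal_one]; exact ENNReal.ofReal_le_ofReal hq
  have h2 := eLpNorm_le_eLpNorm_mul_rpow_measure_univ (μ := volume.restrict B) h1
    hm.aestronglyMeasurable
  rw [eLpNorm_one_eq_lintegral_enorm, Measure.restrict_apply_univ,
    ENNReal.toReal_ofReal hq0.le] at h2
  simp only [ENNReal.toReal_one, div_one] at h2
  refine h2.trans ?_
  have h3 : eLpNorm (fun ξ => f (z + t • ξ)) (ENNReal.ofReal q) (volume.restrict B)
      ≤ ENNReal.ofReal (t ^ (-(n / q) : ℝ)) * eLpNorm f (ENNReal.ofReal q) volume := by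
    refine (eLpNorm_restrict_le _ _ _ _).trans (le_of_eq ?_)
    have e1 := hemb.eLpNorm_map_measure (p := ENNReal.ofReal q) (μ := volume) (g := f)
    have e2 : (f ∘ fun ξ : EuclideanSpace ℝ (Fin n) => z + t • ξ) = fun ξ => f (z + t • ξ) := rfl
    rw [← e2, ← e1, hmap, eLpNorm_smul_measure_of_ne_top ENNReal.ofReal_ne_top, smul_eq_mul]
    congr 1
    rw [ENNReal.toReal_div, ENNReal.toReal_ofReal hq0.le, ENNReal.toReal_one,
      abs_of_pos (by positivity), ENNReal.ofReal_rpow_of_pos (by positivity), ← Real.rpow_natCast,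
      ← Real.rpow_neg ht.le, ← Real.rpow_mul ht.le]
    congr 2
    ring
  calc _ ≤ _ := mul_le_mul' h3 le_rfl
    _ = _ := by ring

lemma lintegral_rpow_lt_top {a T : ℝ} (ha : -1 < a) (hT : 0 ≤ T) :
    ∫⁻ t in Ioc 0 T, ENNReal.ofReal (t ^ a) < ⊤ := by
  have h := (intervalIntegrable_iff_integrableOn_Ioc_of_le hT).1
    (intervalIntegral.intervalIntegrable_rpow' (a := 0) (b := T) ha)
  exact h.lintegral_lt_top

/-- The Sobolev inequality `‖v‖_∞ ≤ C ‖D²v‖_q` for `q > n / 2` and functions supported in a ball of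
fixed radius. -/
theorem exists_enorm_le_mul_eLpNorm_second (hn : 0 < n) {q : ℝ} (hq1 : 1 ≤ q) (hq : (n : ℝ) / 2 < q)
    (ρ : ℝ) (hρ : 0 ≤ ρ) : ∃ C : ℝ≥0, ∀ (x₀ : EuclideanSpace ℝ (Fin n))
      (v : EuclideanSpace ℝ (Fin n) → ℝ) (v₁ : Fin n → EuclideanSpace ℝ (Fin n) → ℝ)
      (v₂ : Fin n → Fin n → EuclideanSpace ℝ (Fin n) → ℝ), Continuous v →
      (∀ y, ρ < dist y x₀ → v y = 0) → (∀ i, HasWeakPartial univ i v (v₁ i)) →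
      (∀ i j, HasWeakPartial univ j (v₁ i) (v₂ i j)) →
      ∀ x, ‖v x‖ₑ ≤ C * ∑ i, ∑ j, eLpNorm (v₂ i j) (ENNReal.ofReal q) volume := by
  -- The unit ball about a vector of length `2`: its points have norm between `1` and `3`, so the
  -- directions in `B` are bounded and bounded away from `0`.
  set B : Set (EuclideanSpace ℝ (Fin n)) :=
    Metric.closedBall (EuclideanSpace.single (⟨0, hn⟩ : Fin n) (2 : ℝ)) 1 with hBdef
  have hB : MeasurableSet B := measurableSet_closedBall
  have hB0 : volume B ≠ 0 := (Metric.measure_closedBall_pos _ _ one_pos).ne'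
  have hBt : volume B ≠ ⊤ := measure_closedBall_lt_top.ne
  have hnorm : ‖(EuclideanSpace.single (⟨0, hn⟩ : Fin n) (2 : ℝ))‖ = 2 := by simp
  have hB3 : ∀ ξ ∈ B, ‖ξ‖ ≤ 3 := fun ξ hξ => by
    have h1 := norm_le_norm_add_norm_sub' ξ (EuclideanSpace.single (⟨0, hn⟩ : Fin n) (2 : ℝ))
    have h2 : ‖ξ - EuclideanSpace.single (⟨0, hn⟩ : Fin n) (2 : ℝ)‖ ≤ 1 := by
      simpa [dist_eq_norm] using Metric.mem_closedBall.1 hξ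
    linarith
  have hB1 : ∀ ξ ∈ B, 1 ≤ ‖ξ‖ := fun ξ hξ => by
    have h1 := norm_le_norm_add_norm_sub' (EuclideanSpace.single (⟨0, hn⟩ : Fin n) (2 : ℝ)) ξ
    have h2 : ‖EuclideanSpace.single (⟨0, hn⟩ : Fin n) (2 : ℝ) - ξ‖ ≤ 1 := by
      rw [norm_sub_rev]
      simpa [dist_eq_norm] using Metric.mem_closedBall.1 hξ
    linarith
  -- For `x` within `ρ` of `x₀` and `‖ξ‖ ≥ 1`, the point `x + T ξ` is at distance at least `T - ρ =
  -- ρ + 2` from `x₀`. This lies beyond the support, of radius at most `ρ + 1`, of every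
  -- mollification of `v`.
  set T : ℝ := 2 * ρ + 2 with hTdef
  have hT : 0 ≤ T := by positivity
  have hq0 : 0 < q := by linarith
  -- The only place where `q > n / 2` matters: the weight `t ^ (1 - n / q)` is integrable at `0`.
  have ha : -1 < 1 - n / q := by
    have : (n : ℝ) / q < 2 := by
      rw [div_lt_iff₀ hq0]; linarith
    linarith
  set I : ℝ≥0∞ := ∫⁻ t in Ioc 0 T, ENNReal.ofReal (t ^ (1 - n / q : ℝ)) with hI
  have hIt : I ≠ ⊤ := (lintegral_rpow_lt_top ha hT).ne
  set C : ℝ≥0∞ := (volume B)⁻¹ * (9 * (I * volume B ^ (1 - 1 / q))) with hC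
  have hCt : C ≠ ⊤ := by
    refine ENNReal.mul_ne_top (ENNReal.inv_ne_top.2 hB0) (ENNReal.mul_ne_top (by norm_num)
      (ENNReal.mul_ne_top hIt (ENNReal.rpow_ne_top_of_nonneg ?_ hBt)))
    rw [sub_nonneg, div_le_one hq0]
    exact hq1
  refine ⟨C.toNNReal, fun x₀ v v₁ v₂ hv hs h1 h2 x => ?_⟩
  rw [ENNReal.coe_toNNReal hCt]
  -- Both the weak derivative property and the norms ignore null sets, so measurable representatives
  -- may be taken.
  wlog hmeas : ∀ i j, Measurable (v₂ i j) generalizing v₂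
  · have hae : ∀ i j, AEStronglyMeasurable (v₂ i j) volume := fun i j =>
      (locallyIntegrableOn_univ.1 (h2 i j).2.1).aestronglyMeasurable
    have := this (fun i j => (hae i j).mk _)
      (fun i j => (h2 i j).congr_ae isOpen_univ (by rfl) (by simpa using (hae i j).ae_eq_mk))
      (fun i j => (hae i j).stronglyMeasurable_mk.measurable)
    simpa only [fun i j => eLpNorm_congr_ae (p := ENNReal.ofReal q) (hae i j).ae_eq_mk.symm]
      using this
  by_cases hx : ρ < dist x x₀
  · simp [hs x hx]
  rw [not_lt] at hx
  have hli : LocallyIntegrable v := hv.locallyIntegrable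
  -- The mollifications of the continuous `v` converge at every point, so a bound uniform in `k` is
  -- enough.
  refine le_of_tendsto ((moll_tendsto_of_continuous hv x).enorm)
    (Filter.Eventually.of_forall fun k => ?_)
  set w := moll (mollFun n k) v with hw
  have hws : ContDiff ℝ ∞ w := contDiff_moll (contDiff_mollFun n k) (hasCompactSupport_mollFun n k) hli
  have hp1 : ∀ i, pd i w = moll (mollFun n k) (v₁ i) := fun i => funext fun y =>
    (h1 i).pd_moll (contDiff_mollFun n k) (hasCompactSupport_mollFun n k) y
  have hp2 : ∀ i j, pd j (pd i w) = moll (mollFun n k) (v₂ i j) := fun i j => funext fun y => by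
    rw [hp1 i]
    exact (h2 i j).pd_moll (contDiff_mollFun n k) (hasCompactSupport_mollFun n k) y
  have hwz : ∀ y, ρ + 1 < dist y x₀ → w y = 0 := fun y hy => moll_eq_zero hs hy
  have hfar : ∀ ξ ∈ B, ρ + 1 < dist (x + T • ξ) x₀ := fun ξ hξ => by
    have e1 : dist (x + T • ξ) x = T * ‖ξ‖ := by
      rw [dist_eq_norm, add_sub_cancel_left, norm_smul, Real.norm_of_nonneg hT]
    have e2 : T ≤ T * ‖ξ‖ := le_mul_of_one_le_right hT (hB1 ξ hξ)
    have e3 : dist (x + T • ξ) x ≤ dist (x + T • ξ) x₀ + dist x x₀ := dist_triangle_right _ _ _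
    linarith
  have hfarw : ∀ ξ ∈ B, w =ᶠ[𝓝 (x + T • ξ)] fun _ => 0 := fun ξ hξ => by
    filter_upwards [(isOpen_lt continuous_const (continuous_id.dist continuous_const)).mem_nhds
      (hfar ξ hξ)] with y hy using hwz y hy
  have main := volume_mul_enorm_le hws (x := x) hT hB hB3 (fun ξ hξ =>
    ⟨(hfarw ξ hξ).self_of_nhds, fun i => by
      simp only [pd]
      rw [(hfarw ξ hξ).fderiv_eq]
      simp⟩)
  have inner : ∀ i j, ∫⁻ t in Ioc 0 T, ENNReal.ofReal t * ∫⁻ ξ in B, ‖pd j (pd i w) (x + t • ξ)‖ₑ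
      ≤ I * volume B ^ (1 - 1 / q) * eLpNorm (v₂ i j) (ENNReal.ofReal q) volume := by
    intro i j
    rw [hI, mul_assoc, ← lintegral_mul_const _ (by fun_prop)]
    refine setLIntegral_mono' measurableSet_Ioc fun t ht => ?_
    have ht0 := ht.1
    have hmap : Measurable fun ξ : EuclideanSpace ℝ (Fin n) => x + t • ξ := by fun_prop
    -- The Hessian of the mollification is the mollified `v₂`. Young's inequality on the dilated
    -- ball reduces it to translates of `v₂`, and Hölder contributes `t ^ (-n / q)`; together with
    -- the weight `t` of Taylor's formula this is `t ^ (1 - n / q)`.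
    have hY := lintegral_enorm_moll_le (Measure.map (fun ξ => x + t • ξ) (volume.restrict B))
      (contDiff_mollFun n k).continuous.measurable (hmeas i j) (lintegral_mollFun n k)
      (C := ENNReal.ofReal (t ^ (-(n / q) : ℝ)) *
        (volume B ^ (1 - 1 / q) * eLpNorm (v₂ i j) (ENNReal.ofReal q) volume)) (fun s => by
          rw [lintegral_map (show Measurable fun y => ‖v₂ i j (y - s)‖ₑ from
            ((hmeas i j).comp (measurable_id.sub_const s)).enorm) hmap]
          have e : ∀ ξ : EuclideanSpace ℝ (Fin n), x + t • ξ - s = (x - s) + t • ξ := fun ξ => by abel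
          simp only [e]
          exact lintegral_enorm_comp_affine_le (hmeas i j) hq1 B (x - s) ht0)
    rw [← hp2 i j, lintegral_map ((contDiff_pd (contDiff_pd hws)).continuous.measurable.enorm) hmap]
      at hY
    refine (mul_le_mul' le_rfl hY).trans (le_of_eq ?_)
    rw [← mul_assoc]
    congr 1
    rw [← ENNReal.ofReal_mul ht0.le]
    congr 1
    rw [sub_eq_add_neg, Real.rpow_add ht0, Real.rpow_one]
  have h4 : volume B * ‖w x‖ₑ ≤ 9 * (I * volume B ^ (1 - 1 / q)) *
      ∑ i, ∑ j, eLpNorm (v₂ i j) (ENNReal.ofReal q) volume := by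
    refine main.trans ?_
    rw [mul_assoc]
    gcongr
    simp only [Finset.mul_sum]
    exact Finset.sum_le_sum fun i _ => Finset.sum_le_sum fun j _ => inner i j
  calc ‖w x‖ₑ = (volume B)⁻¹ * (volume B * ‖w x‖ₑ) := by
        rw [← mul_assoc, ENNReal.inv_mul_cancel hB0 hBt, one_mul]
    _ ≤ _ := by
        rw [hC, mul_assoc]
        gcongr

/-- The Gagliardo-Nirenberg inequality `‖∂_i v‖₂² ≤ ‖v‖_∞ ‖∂_i ∂_i v‖₁`. -/
theorem lintegral_sq_weakPartial_le {v v₁ v₂ : EuclideanSpace ℝ (Fin n) → ℝ} {i : Fin n}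
    (hv : Continuous v) (hc : HasCompactSupport v) (h1 : HasWeakPartial univ i v v₁)
    (h2 : HasWeakPartial univ i v₁ v₂) {A : ℝ≥0∞} (hA : ∀ x, ‖v x‖ₑ ≤ A) :
    ∫⁻ x, ‖v₁ x‖ₑ ^ 2 ≤ A * ∫⁻ x, ‖v₂ x‖ₑ := by
  wlog hmeas : Measurable v₂ generalizing v₂
  · have hae : AEStronglyMeasurable v₂ volume :=
      (locallyIntegrableOn_univ.1 h2.2.1).aestronglyMeasurable
    have := this (h2.congr_ae isOpen_univ (by rfl) (by simpa using hae.ae_eq_mk))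
      hae.stronglyMeasurable_mk.measurable
    have e : ∫⁻ x, ‖hae.mk v₂ x‖ₑ = ∫⁻ x, ‖v₂ x‖ₑ :=
      lintegral_congr_ae (hae.ae_eq_mk.symm.mono fun x hx => by simp only [hx])
    rwa [e] at this
  have hli : LocallyIntegrable v := hv.locallyIntegrable
  have hli1 : LocallyIntegrable v₁ := locallyIntegrableOn_univ.1 h1.2.1
  have hp1 : ∀ k, pd i (moll (mollFun n k) v) = moll (mollFun n k) v₁ := fun k => funext fun y =>
    h1.pd_moll (contDiff_mollFun n k) (hasCompactSupport_mollFun n k) y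
  have hp2 : ∀ k, pd i (moll (mollFun n k) v₁) = moll (mollFun n k) v₂ := fun k => funext fun y =>
    h2.pd_moll (contDiff_mollFun n k) (hasCompactSupport_mollFun n k) y
  have hs0 : ∀ k, ContDiff ℝ ∞ (moll (mollFun n k) v) := fun k =>
    contDiff_moll (contDiff_mollFun n k) (hasCompactSupport_mollFun n k) hli
  have hs1 : ∀ k, ContDiff ℝ ∞ (moll (mollFun n k) v₁) := fun k =>
    contDiff_moll (contDiff_mollFun n k) (hasCompactSupport_mollFun n k) hli1
  have hc0 : ∀ k, HasCompactSupport (moll (mollFun n k) v) := fun k =>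
    (hasCompactSupport_mollFun n k).convolution _ hc
  have hc1 : ∀ k, HasCompactSupport (moll (mollFun n k) v₁) := fun k => by
    rw [← hp1 k]; exact (hc0 k).fderiv_apply (𝕜 := ℝ) _
  -- The pointwise bound passes to the mollification; this is Young's inequality for a Dirac
  -- measure.
  have hAk : ∀ k x, ‖moll (mollFun n k) v x‖ₑ ≤ A := fun k x => by
    have := lintegral_enorm_moll_le (Measure.dirac x) (contDiff_mollFun n k).continuous.measurable
      hv.measurable (lintegral_mollFun n k) (C := A) (fun s => by
        rw [lintegral_dirac' _ (show Measurable fun x => ‖v (x - s)‖ₑ from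
          (hv.measurable.comp (measurable_id.sub_const s)).enorm)]
        exact hA _)
    rwa [lintegral_dirac' _ ((hs0 k).continuous.measurable.enorm)] at this
  have hk : ∀ k, ∫⁻ x, ‖moll (mollFun n k) v₁ x‖ₑ ^ 2 ≤ A * ∫⁻ x, ‖v₂ x‖ₑ := by
    intro k
    set w := moll (mollFun n k) v with hw
    set w₁ := moll (mollFun n k) v₁ with hw1
    -- For smooth `w` with `∂_i w = w₁`, integration by parts gives `∫ w₁² = -∫ w ∂_i w₁`, at most
    -- `A` times the `L¹` norm of `∂_i w₁`.
    have ibp := (hasWeakPartial_of_contDiffOn (i := i) isOpen_univ (hs1 k).contDiffOn).2.2 w (hs0 k)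
      (hc0 k) (subset_univ _)
    change ∫ y, w₁ y * pd i w y = _ at ibp
    rw [hp1 k, hp2 k] at ibp
    have e1 : ∫⁻ x, ‖w₁ x‖ₑ ^ 2 = ‖∫ y, w₁ y * w₁ y‖ₑ := by
      rw [Real.enorm_eq_ofReal (integral_nonneg fun y => mul_self_nonneg _),
        ofReal_integral_eq_lintegral_ofReal
          (show Integrable (fun y => w₁ y * w₁ y) volume from
            ((hs1 k).continuous.mul (hs1 k).continuous).integrable_of_hasCompactSupport
            (hc1 k).mul_right) (Filter.Eventually.of_forall fun y => mul_self_nonneg _)]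
      refine lintegral_congr fun y => ?_
      rw [← Real.enorm_eq_ofReal (mul_self_nonneg _), enorm_mul, sq]
    rw [e1, ibp, enorm_neg]
    refine (enorm_integral_le_lintegral_enorm _).trans ?_
    calc ∫⁻ y, ‖moll (mollFun n k) v₂ y * w y‖ₑ ≤ ∫⁻ y, A * ‖moll (mollFun n k) v₂ y‖ₑ :=
          lintegral_mono fun y => by
            rw [enorm_mul, mul_comm]
            exact mul_le_mul' (hAk k y) le_rfl
      _ = A * ∫⁻ y, ‖moll (mollFun n k) v₂ y‖ₑ := by
          rw [lintegral_const_mul]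
          rw [← hp2 k]
          exact (contDiff_pd (hs1 k)).continuous.measurable.enorm
      _ ≤ A * ∫⁻ x, ‖v₂ x‖ₑ := by
          refine mul_le_mul' le_rfl ?_
          refine lintegral_enorm_moll_le volume (contDiff_mollFun n k).continuous.measurable hmeas
            (lintegral_mollFun n k) fun s => le_of_eq ?_
          exact lintegral_sub_right_eq_self (fun x => ‖v₂ x‖ₑ) s
  -- It is not known beforehand that `v₁` is in `L²`; almost everywhere convergence of the
  -- mollifications and Fatou's lemma suffice.
  calc ∫⁻ x, ‖v₁ x‖ₑ ^ 2
      = ∫⁻ x, Filter.liminf (fun k => ‖moll (mollFun n k) v₁ x‖ₑ ^ 2) Filter.atTop := by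
        refine lintegral_congr_ae ?_
        filter_upwards [moll_tendsto_ae hli1] with x hx
        exact (((ENNReal.continuous_pow 2).tendsto _).comp hx.enorm).liminf_eq.symm
    _ ≤ Filter.liminf (fun k => ∫⁻ x, ‖moll (mollFun n k) v₁ x‖ₑ ^ 2) Filter.atTop :=
        lintegral_liminf_le fun k => (hs1 k).continuous.measurable.enorm.pow_const 2
    _ ≤ A * ∫⁻ x, ‖v₂ x‖ₑ := by
        refine Filter.liminf_le_of_le (by isBoundedDefault) fun b hb => ?_
        obtain ⟨k, hk'⟩ := hb.exists
        exact hk'.trans (hk k)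

end sobolev

/-! ### Local estimates for functions of class `W^{2,p}`. -/

section local_sobolev

variable {n : ℕ} {p : ℝ≥0∞} {U : Set (EuclideanSpace ℝ (Fin n))}
  {u : EuclideanSpace ℝ (Fin n) → ℝ}

lemma MemW2Loc.hasWeakPartial (h : MemW2Loc p U u) (i : Fin n) :
    HasWeakPartial U i u (weakPartial U i u) := by
  obtain ⟨f₁, h1, -⟩ := h.2 i
  exact h1.weakPartial

/-- The first derivative `weakPartial U i u` is a chosen one; it agrees almost everywhere with the
`f₁` for which second derivatives are given. -/
lemma MemW2Loc.hasWeakPartial₂ (hU : IsOpen U) (h : MemW2Loc p U u) (i j : Fin n) :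
    HasWeakPartial U j (weakPartial U i u) (weakPartial U j (weakPartial U i u)) := by
  obtain ⟨f₁, h1, -, h2⟩ := h.2 i
  obtain ⟨f₂, h3, -⟩ := h2 j
  exact (h3.congr_ae hU (h1.weakPartial_ae_eq hU).symm (by rfl)).weakPartial

/-- The `W^{2,p}` norm of a function on `K ⊆ U`. -/
def scalarSobolevNorm (p : ℝ≥0∞) (U K : Set (EuclideanSpace ℝ (Fin n)))
    (u : EuclideanSpace ℝ (Fin n) → ℝ) : ℝ≥0∞ :=
  eLpNorm u p (volume.restrict K) + ∑ k, eLpNorm (weakPartial U k u) p (volume.restrict K)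
    + ∑ k, ∑ l, eLpNorm (weakPartial U l (weakPartial U k u)) p (volume.restrict K)

lemma eLpNorm_le_scalarSobolevNorm (K) :
    eLpNorm u p (volume.restrict K) ≤ scalarSobolevNorm p U K u := by
  unfold scalarSobolevNorm
  rw [add_assoc]
  exact le_self_add

lemma eLpNorm_weakPartial_le_scalarSobolevNorm (K) (i : Fin n) :
    eLpNorm (weakPartial U i u) p (volume.restrict K) ≤ scalarSobolevNorm p U K u := by
  have : eLpNorm (weakPartial U i u) p (volume.restrict K)
    ≤ ∑ k, eLpNorm (weakPartial U k u) p (volume.restrict K) :=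
    Finset.single_le_sum (f := fun k => eLpNorm (weakPartial U k u) p (volume.restrict K))
      (fun _ _ => zero_le) (Finset.mem_univ i)
  unfold scalarSobolevNorm
  exact (this.trans le_add_self).trans le_self_add

lemma eLpNorm_weakPartial₂_le_scalarSobolevNorm (K) (i j : Fin n) :
    eLpNorm (weakPartial U j (weakPartial U i u)) p (volume.restrict K)
      ≤ scalarSobolevNorm p U K u := by
  have h1 : eLpNorm (weakPartial U j (weakPartial U i u)) p (volume.restrict K)
    ≤ ∑ l, eLpNorm (weakPartial U l (weakPartial U i u)) p (volume.restrict K) :=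
    Finset.single_le_sum (f := fun l => eLpNorm (weakPartial U l (weakPartial U i u)) p
      (volume.restrict K)) (fun _ _ => zero_le) (Finset.mem_univ j)
  have h2 : ∑ l, eLpNorm (weakPartial U l (weakPartial U i u)) p (volume.restrict K)
    ≤ ∑ k, ∑ l, eLpNorm (weakPartial U l (weakPartial U k u)) p (volume.restrict K) :=
    Finset.single_le_sum (f := fun k => ∑ l, eLpNorm (weakPartial U l (weakPartial U k u)) p
      (volume.restrict K)) (fun _ _ => zero_le) (Finset.mem_univ i)
  unfold scalarSobolevNorm
  exact (h1.trans h2).trans le_add_self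

/-- As `a` vanishes off `K`, Hölder on a set of finite volume lowers the exponent from `p` to `q`.
For `p = ⊤` the convention `1 / 0 = 0` gives the right power of the volume. -/
lemma eLpNorm_mul_le_of_bound {a f : EuclideanSpace ℝ (Fin n) → ℝ}
    {K : Set (EuclideanSpace ℝ (Fin n))} {M : ℝ≥0} {q : ℝ≥0∞} (hq : q ≤ p)
    (hK : ∀ y ∉ K, a y = 0) (ha : ∀ y, ‖a y‖ ≤ M)
    (hf : AEStronglyMeasurable f (volume.restrict K)) :
    eLpNorm (fun y => a y * f y) q volume ≤
      M * (eLpNorm f p (volume.restrict K) * volume K ^ (1 / q.toReal - 1 / p.toReal)) := by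
  have hs : Function.support (fun y => a y * f y) ⊆ K := fun y hy => by
    by_contra h
    exact hy (by simp [hK y h])
  rw [← eLpNorm_restrict_eq_of_support_subset hs]
  have h1 := eLpNorm_le_nnreal_smul_eLpNorm_of_ae_le_mul (μ := volume.restrict K)
    (f := fun y => a y * f y) (g := f) (c := M) (Filter.Eventually.of_forall fun y => by
      rw [nnnorm_mul]
      exact mul_le_mul' (ha y) le_rfl) q
  refine h1.trans ?_
  have h2 := eLpNorm_le_eLpNorm_mul_rpow_measure_univ hq hf
  rw [Measure.restrict_apply_univ] at h2
  rw [ENNReal.smul_def, smul_eq_mul]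
  gcongr

/-- The Sobolev inequality is proved for finite exponents. For `p = ⊤` any `q > n / 2` would do, and
`n` is one; `q ≥ 1` comes from `n > 2`. -/
lemma exists_real_exponent (hn : 2 < n) (hp : (n : ℝ≥0∞) / 2 < p) :
    ∃ q : ℝ, 1 ≤ q ∧ (n : ℝ) / 2 < q ∧ ENNReal.ofReal q ≤ p := by
  have hn' : (2 : ℝ) < n := by exact_mod_cast hn
  by_cases h : p = ⊤
  · exact ⟨n, by linarith, by linarith, by simp [h]⟩
  · have h2 : (n : ℝ) / 2 < p.toReal := by
      have := (ENNReal.toReal_lt_toReal (ENNReal.div_ne_top (by simp) (by simp)) h).2 hp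
      simpa using this
    exact ⟨p.toReal, by linarith, h2, by rw [ENNReal.ofReal_toReal h]⟩

/-- Local control of the uniform norm, of the `L²` norm of the gradient and of the `L¹` norm of the
Hessian by the `W^{2,p}` norm. -/
theorem exists_local_sobolev (hn : 2 < n) (hp : (n : ℝ≥0∞) / 2 < p) (hU : IsOpen U)
    {y₀ : EuclideanSpace ℝ (Fin n)} (hy₀ : y₀ ∈ U) :
    ∃ K ∈ 𝓝 y₀, IsCompact K ∧ K ⊆ U ∧ ∃ K' ⊆ U, IsCompact K' ∧ ∃ C : ℝ≥0,
      ∀ u : EuclideanSpace ℝ (Fin n) → ℝ, ContinuousOn u U → MemW2Loc p U u →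
        (∀ x ∈ K, ‖u x‖ₑ ≤ C * scalarSobolevNorm p U K' u) ∧
        (∀ i, eLpNorm (weakPartial U i u) 2 (volume.restrict K) ≤ C * scalarSobolevNorm p U K' u) ∧
        (∀ i j, eLpNorm (weakPartial U j (weakPartial U i u)) 1 (volume.restrict K)
          ≤ C * scalarSobolevNorm p U K' u) := by
  obtain ⟨q, hq1, hq2, hqp⟩ := exists_real_exponent hn hp
  have hq0 : 0 < q := by linarith
  have h1q : (1 : ℝ≥0∞) ≤ ENNReal.ofReal q := by
    rw [← ENNReal.ofReal_one]; exact ENNReal.ofReal_le_ofReal hq1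
  have h1p : (1 : ℝ≥0∞) ≤ p := h1q.trans hqp
  obtain ⟨R, hR, hRU⟩ := Metric.nhds_basis_closedBall.mem_iff.1 (hU.mem_nhds hy₀)
  -- The cutoff is `1` on the ball of radius `R / 2`. The estimates are claimed on the ball of
  -- radius `R / 4`, near whose points `u` and `χ u` coincide together with their derivatives.
  let χ : ContDiffBump y₀ := ⟨R / 2, R, by positivity, by linarith⟩
  set K' := Metric.closedBall y₀ R with hK'
  have hK'c : IsCompact K' := isCompact_closedBall _ _
  have hts : tsupport χ = K' := χ.tsupport_eq
  have hχ : ContDiff ℝ ∞ (χ : EuclideanSpace ℝ (Fin n) → ℝ) := χ.contDiff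
  have hχc : HasCompactSupport (χ : EuclideanSpace ℝ (Fin n) → ℝ) := χ.hasCompactSupport
  have hχs : tsupport (χ : EuclideanSpace ℝ (Fin n) → ℝ) ⊆ U := by rw [hts]; exact hRU
  have hd1 : ∀ i, ContDiff ℝ ∞ (pd i χ) := fun i => contDiff_pd hχ
  have hd2 : ∀ i j, ContDiff ℝ ∞ (pd j (pd i χ)) := fun i j => contDiff_pd (hd1 i)
  have hc1 : ∀ i, HasCompactSupport (pd i χ) := fun i => hχc.fderiv_apply (𝕜 := ℝ) _
  have hc2 : ∀ i j, HasCompactSupport (pd j (pd i χ)) := fun i j => (hc1 i).fderiv_apply (𝕜 := ℝ) _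
  have hs1 : ∀ i, tsupport (pd i χ) ⊆ K' := fun i => (tsupport_pd_subset _).trans hts.subset
  have hs2 : ∀ i j, tsupport (pd j (pd i χ)) ⊆ K' := fun i j => (tsupport_pd_subset _).trans (hs1 i)
  have hz0 : ∀ y ∉ K', χ y = 0 := fun y hy => image_eq_zero_of_notMem_tsupport (by rwa [hts])
  have hz1 : ∀ i, ∀ y ∉ K', pd i χ y = 0 := fun i y hy =>
    image_eq_zero_of_notMem_tsupport fun h => hy (hs1 i h)
  have hz2 : ∀ i j, ∀ y ∉ K', pd j (pd i χ) y = 0 := fun i j y hy =>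
    image_eq_zero_of_notMem_tsupport fun h => hy (hs2 i j h)
  obtain ⟨M, hM0, hM1, hM2⟩ : ∃ M : ℝ≥0, (∀ y, ‖χ y‖ ≤ M) ∧ (∀ i y, ‖pd i χ y‖ ≤ M) ∧
      ∀ i j y, ‖pd j (pd i χ) y‖ ≤ M := by
    obtain ⟨m0, h0⟩ := hχc.exists_bound_of_continuous hχ.continuous
    choose m1 h1 using fun i => (hc1 i).exists_bound_of_continuous (hd1 i).continuous
    choose m2 h2 using fun i j => (hc2 i j).exists_bound_of_continuous (hd2 i j).continuous
    have n0 : 0 ≤ m0 := (norm_nonneg _).trans (h0 y₀)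
    have n1 : ∀ i, 0 ≤ m1 i := fun i => (norm_nonneg _).trans (h1 i y₀)
    have n2 : ∀ i j, 0 ≤ m2 i j := fun i j => (norm_nonneg _).trans (h2 i j y₀)
    have s1 : 0 ≤ ∑ i, m1 i := Finset.sum_nonneg fun i _ => n1 i
    have s2 : 0 ≤ ∑ i, ∑ j, m2 i j := Finset.sum_nonneg fun i _ => Finset.sum_nonneg fun j _ => n2 i j
    refine ⟨⟨m0 + ∑ i, m1 i + ∑ i, ∑ j, m2 i j, by positivity⟩, fun y => ?_, fun i y => ?_,
      fun i j y => ?_⟩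
    · refine (h0 y).trans ?_
      change _ ≤ m0 + ∑ i, m1 i + ∑ i, ∑ j, m2 i j; linarith
    · have := Finset.single_le_sum (fun i _ => n1 i) (Finset.mem_univ i)
      refine (h1 i y).trans ?_
      change _ ≤ m0 + ∑ i, m1 i + ∑ i, ∑ j, m2 i j; linarith
    · have a1 := Finset.single_le_sum (fun j _ => n2 i j) (Finset.mem_univ j)
      have a2 := Finset.single_le_sum (f := fun i => ∑ j, m2 i j)
        (fun i _ => Finset.sum_nonneg fun j _ => n2 i j) (Finset.mem_univ i)
      refine (h2 i j y).trans ?_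
      change _ ≤ m0 + ∑ i, m1 i + ∑ i, ∑ j, m2 i j; linarith
  obtain ⟨S, hS⟩ := exists_enorm_le_mul_eLpNorm_second (n := n) (by omega) hq1 hq2 R hR.le
  have hvol : volume K' ≠ ⊤ := hK'c.measure_lt_top.ne
  set D : ℝ≥0∞ → ℝ≥0∞ := fun a => volume K' ^ (1 / a.toReal - 1 / p.toReal) with hD
  have hDt : ∀ a, 1 ≤ a → a ≤ p → a ≠ ⊤ → D a ≠ ⊤ := fun a h1 h2 h3 => by
    refine ENNReal.rpow_ne_top_of_nonneg (sub_nonneg.2 ?_) hvol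
    have ha : 0 < a.toReal := ENNReal.toReal_pos (by positivity) h3
    by_cases hpt : p = ⊤
    · simp [hpt]
    · exact one_div_le_one_div_of_le ha (ENNReal.toReal_mono hpt h2)
  -- `C0` is for the `L¹` norm of the second derivatives of `χ u` and `C1` for its supremum norm.
  -- The `4` counts the terms of the Leibniz rule, `M` bounds `χ` and its derivatives, and `D a` is
  -- the price of lowering the exponent from `p` to `a`.
  set C0 : ℝ≥0∞ := 4 * (M * D 1) with hC0
  set C1 : ℝ≥0∞ := S * ∑ _i : Fin n, ∑ _j : Fin n, 4 * (M * D (ENNReal.ofReal q)) with hC1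
  have hC0t : C0 ≠ ⊤ := ENNReal.mul_ne_top (by simp) (ENNReal.mul_ne_top (by simp)
    (hDt 1 le_rfl h1p (by simp)))
  have hC1t : C1 ≠ ⊤ := by
    refine ENNReal.mul_ne_top (by simp) ?_
    simp only [Finset.sum_const, Finset.card_univ, Fintype.card_fin, nsmul_eq_mul]
    exact ENNReal.mul_ne_top (by simp) (ENNReal.mul_ne_top (by simp) (ENNReal.mul_ne_top (by simp)
      (ENNReal.mul_ne_top (by simp) (hDt _ h1q hqp (by simp)))))
  refine ⟨Metric.closedBall y₀ (R / 4), Metric.closedBall_mem_nhds _ (by positivity),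
    isCompact_closedBall _ _, (Metric.closedBall_subset_closedBall (by linarith)).trans hRU,
    K', hRU, hK'c, (C0 + C1).toNNReal, fun u hu hW => ?_⟩
  rw [ENNReal.coe_toNNReal (ENNReal.add_ne_top.2 ⟨hC0t, hC1t⟩)]
  set N := scalarSobolevNorm p U K' u with hN
  set u1 : Fin n → EuclideanSpace ℝ (Fin n) → ℝ := fun i => weakPartial U i u with hu1
  set u2 : Fin n → Fin n → EuclideanSpace ℝ (Fin n) → ℝ :=
    fun i j => weakPartial U j (weakPartial U i u) with hu2
  have w1 : ∀ i, HasWeakPartial U i u (u1 i) := fun i => hW.hasWeakPartial i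
  have w2 : ∀ i j, HasWeakPartial U j (u1 i) (u2 i j) := fun i j => hW.hasWeakPartial₂ hU i j
  set v : EuclideanSpace ℝ (Fin n) → ℝ := fun y => χ y * u y with hv
  set v1 : Fin n → EuclideanSpace ℝ (Fin n) → ℝ := fun i y => pd i χ y * u y + χ y * u1 i y with hv1
  set v2 : Fin n → Fin n → EuclideanSpace ℝ (Fin n) → ℝ := fun i j y =>
    (pd j (pd i χ) y * u y + pd i χ y * u1 j y) + (pd j χ y * u1 i y + χ y * u2 i j y) with hv2
  have x1 : ∀ i, HasWeakPartial univ i v (v1 i) := fun i => (w1 i).cutoff_mul hU hχ hχc hχs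
  have x2 : ∀ i j, HasWeakPartial univ j (v1 i) (v2 i j) := fun i j =>
    ((w1 j).cutoff_mul hU (hd1 i) (hc1 i) ((hs1 i).trans hRU)).add
      ((w2 i j).cutoff_mul hU hχ hχc hχs)
  have hvc : Continuous v := by
    have := contDiff_mul_of_contDiffOn (m := 0) hU (contDiffOn_zero.2 hu)
      (contDiff_zero.2 hχ.continuous) hχs
    simpa only [hv, mul_comm] using contDiff_zero.1 this
  have hvs : HasCompactSupport v := hχc.mul_right
  have hvz : ∀ y, R < dist y y₀ → v y = 0 := fun y hy => by
    simp only [hv]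
    rw [hz0 y (fun h => not_lt.2 (Metric.mem_closedBall.1 h) hy), zero_mul]
  have mK : ∀ {f : EuclideanSpace ℝ (Fin n) → ℝ}, LocallyIntegrableOn f U →
      AEStronglyMeasurable f (volume.restrict K') := fun h =>
    (h.integrableOn_compact_subset hRU hK'c).aestronglyMeasurable
  have mG : ∀ {a f : EuclideanSpace ℝ (Fin n) → ℝ}, LocallyIntegrableOn f U → Continuous a →
      HasCompactSupport a → tsupport a ⊆ U → AEStronglyMeasurable (fun y => a y * f y) volume :=
    fun h1 h2 h3 h4 => by
      simpa only [mul_comm] using (integrable_mul_test h1 h2 h3 h4).aestronglyMeasurable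
  -- Needed for `a = q`, which feeds the Sobolev inequality, and for `a = 1`.
  have hv2b : ∀ a, 1 ≤ a → a ≤ p → ∀ i j, eLpNorm (v2 i j) a volume ≤ 4 * (M * D a) * N := by
    intro a ha1 hap i j
    have b1 := eLpNorm_mul_le_of_bound hap (hz2 i j) (hM2 i j) (mK (w1 i).1)
    have b2 := eLpNorm_mul_le_of_bound hap (hz1 i) (hM1 i) (mK (w1 j).2.1)
    have b3 := eLpNorm_mul_le_of_bound hap (hz1 j) (hM1 j) (mK (w1 i).2.1)
    have b4 := eLpNorm_mul_le_of_bound hap hz0 hM0 (mK (w2 i j).2.1)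
    have n1 : eLpNorm u p (volume.restrict K') ≤ N := eLpNorm_le_scalarSobolevNorm K'
    have n2 : ∀ j, eLpNorm (u1 j) p (volume.restrict K') ≤ N := fun j =>
      eLpNorm_weakPartial_le_scalarSobolevNorm K' j
    have n4 : eLpNorm (u2 i j) p (volume.restrict K') ≤ N :=
      eLpNorm_weakPartial₂_le_scalarSobolevNorm K' i j
    have m1 := mG (w1 i).1 (hd2 i j).continuous (hc2 i j) ((hs2 i j).trans hRU)
    have m2 := mG (w1 j).2.1 (hd1 i).continuous (hc1 i) ((hs1 i).trans hRU)
    have m3 := mG (w1 i).2.1 (hd1 j).continuous (hc1 j) ((hs1 j).trans hRU)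
    have m4 := mG (w2 i j).2.1 hχ.continuous hχc hχs
    calc eLpNorm (v2 i j) a volume
        ≤ (M * (N * D a) + M * (N * D a)) + (M * (N * D a) + M * (N * D a)) := by
          refine (eLpNorm_add_le (m1.add m2) (m3.add m4) ha1).trans (add_le_add
            ((eLpNorm_add_le m1 m2 ha1).trans (add_le_add (b1.trans ?_) (b2.trans ?_)))
            ((eLpNorm_add_le m3 m4 ha1).trans (add_le_add (b3.trans ?_) (b4.trans ?_))))
          · gcongr
          · gcongr; exact n2 j
          · gcongr; exact n2 i
          · gcongr
      _ = 4 * (M * D a) * N := by ring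
  have hsup : ∀ x, ‖v x‖ₑ ≤ C1 * N := fun x => by
    refine (hS y₀ v v1 v2 hvc hvz x1 x2 x).trans ?_
    rw [hC1, mul_assoc]
    gcongr
    simp only [Finset.sum_mul]
    exact Finset.sum_le_sum fun i _ => Finset.sum_le_sum fun j _ => hv2b _ h1q hqp i j
  have heq : ∀ x ∈ Metric.closedBall y₀ (R / 4), (χ : EuclideanSpace ℝ (Fin n) → ℝ) =ᶠ[𝓝 x] 1 := by
    intro x hx
    have hx' : x ∈ Metric.ball y₀ (R / 2) :=
      Metric.mem_ball.2 ((Metric.mem_closedBall.1 hx).trans_lt (by linarith))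
    filter_upwards [Metric.isOpen_ball.mem_nhds hx'] with z hz
    exact χ.one_of_mem_closedBall (Metric.ball_subset_closedBall hz)
  have hmeasK : MeasurableSet (Metric.closedBall y₀ (R / 4)) := measurableSet_closedBall
  have hpd0 : ∀ i, ∀ x ∈ Metric.closedBall y₀ (R / 4), pd i χ x = 0 := fun i x hx => by
    simp only [pd]
    rw [(heq x hx).fderiv_eq]
    simp
  refine ⟨fun x hx => ?_, fun i => ?_, fun i j => ?_⟩
  · have : u x = v x := by simp [hv, (heq x hx).self_of_nhds]
    rw [this]
    exact (hsup x).trans (by gcongr; exact le_add_self)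
  · have e1 : eLpNorm (weakPartial U i u) 2 (volume.restrict (Metric.closedBall y₀ (R / 4)))
        = eLpNorm (v1 i) 2 (volume.restrict (Metric.closedBall y₀ (R / 4))) := by
      refine eLpNorm_congr_ae ((ae_restrict_iff' hmeasK).2 (Filter.Eventually.of_forall ?_))
      intro x hx
      simp [hv1, (heq x hx).self_of_nhds, hpd0 i x hx, hu1]
    rw [e1]
    refine (eLpNorm_restrict_le _ _ _ _).trans ?_
    -- Gagliardo-Nirenberg bounds the square of the `L²` norm by `(C1 N) (C0 N)`, hence by `((C0 +
    -- C1) N) ^ 2`.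
    have h2 := lintegral_sq_weakPartial_le hvc hvs (x1 i) (x2 i i) hsup
    have h3 : ∫⁻ x, ‖v2 i i x‖ₑ ≤ C0 * N := by
      rw [← eLpNorm_one_eq_lintegral_enorm]
      exact hv2b 1 le_rfl h1p i i
    have h4 : ∫⁻ x, ‖v1 i x‖ₑ ^ 2 ≤ ((C0 + C1) * N) ^ 2 := by
      refine h2.trans ?_
      rw [sq]
      gcongr
      · exact le_add_self
      · exact h3.trans (by gcongr; exact le_self_add)
    rw [eLpNorm_eq_lintegral_rpow_enorm_toReal (by simp) (by simp)]
    simp only [ENNReal.toReal_ofNat, ENNReal.rpow_ofNat]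
    calc (∫⁻ x, ‖v1 i x‖ₑ ^ 2) ^ (1 / 2 : ℝ) ≤ (((C0 + C1) * N) ^ 2) ^ (1 / 2 : ℝ) := by gcongr
      _ = (C0 + C1) * N := by
        rw [← ENNReal.rpow_natCast, ← ENNReal.rpow_mul]
        norm_num
  · have e1 : eLpNorm (weakPartial U j (weakPartial U i u)) 1
        (volume.restrict (Metric.closedBall y₀ (R / 4)))
        = eLpNorm (v2 i j) 1 (volume.restrict (Metric.closedBall y₀ (R / 4))) := by
      refine eLpNorm_congr_ae ((ae_restrict_iff' hmeasK).2 (Filter.Eventually.of_forall ?_))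
      intro x hx
      have hpd2 : pd j (pd i χ) x = 0 := by
        have : pd i χ =ᶠ[𝓝 x] fun _ => 0 := by
          filter_upwards [(heq x hx).eventually_nhds] with z hz
          simp only [pd]
          rw [Filter.EventuallyEq.fderiv_eq hz]
          simp
        simp only [pd] at this ⊢
        rw [this.fderiv_eq]
        simp
      simp [hv2, (heq x hx).self_of_nhds, hpd0 i x hx, hpd0 j x hx, hpd2, hu2]
    rw [e1]
    exact ((eLpNorm_restrict_le _ _ _ _).trans (hv2b 1 le_rfl h1p i j)).trans
      (by gcongr; exact le_self_add)

end local_sobolev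

/-! ## The transformation behaviour of the scalar curvature of a 2-jet -/

section jet_algebra

/-! ### Invariance of the curvature in terms of multilinear maps. -/

section abstract

variable {V V' : Type*} [AddCommGroup V] [Module ℝ V] [AddCommGroup V'] [Module ℝ V']
  {g : V →ₗ[ℝ] V →ₗ[ℝ] ℝ} {dg : V →ₗ[ℝ] V →ₗ[ℝ] V →ₗ[ℝ] ℝ}
  {ddg : V →ₗ[ℝ] V →ₗ[ℝ] V →ₗ[ℝ] V →ₗ[ℝ] ℝ}
  {Γ : V →ₗ[ℝ] V →ₗ[ℝ] V} {DΓ : V →ₗ[ℝ] V →ₗ[ℝ] V →ₗ[ℝ] V}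
  {g' : V' →ₗ[ℝ] V' →ₗ[ℝ] ℝ} {dg' : V' →ₗ[ℝ] V' →ₗ[ℝ] V' →ₗ[ℝ] ℝ}
  {ddg' : V' →ₗ[ℝ] V' →ₗ[ℝ] V' →ₗ[ℝ] V' →ₗ[ℝ] ℝ}
  {Γ' : V' →ₗ[ℝ] V' →ₗ[ℝ] V'} {DΓ' : V' →ₗ[ℝ] V' →ₗ[ℝ] V' →ₗ[ℝ] V'}

/-- `Γ` and `DΓ` are the Christoffel symbols and their derivatives for the 2-jet `(g, dg, ddg)`
(the Koszul formula and its derivative). -/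
structure IsKoszul (g : V →ₗ[ℝ] V →ₗ[ℝ] ℝ) (dg : V →ₗ[ℝ] V →ₗ[ℝ] V →ₗ[ℝ] ℝ)
    (ddg : V →ₗ[ℝ] V →ₗ[ℝ] V →ₗ[ℝ] V →ₗ[ℝ] ℝ)
    (Γ : V →ₗ[ℝ] V →ₗ[ℝ] V) (DΓ : V →ₗ[ℝ] V →ₗ[ℝ] V →ₗ[ℝ] V) : Prop where
  symm : ∀ u v, g u v = g v u
  dsymm : ∀ w u v, dg w u v = dg w v u
  nondeg : ∀ x, (∀ w, g w x = 0) → x = 0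
  koszul : ∀ u v w, 2 * g w (Γ u v) = dg u w v + dg v w u - dg w u v
  koszul' : ∀ z u v w, 2 * g w (DΓ z u v) =
    ddg z u w v + ddg z v w u - ddg z w u v - 2 * dg z w (Γ u v)

/-- The curvature `R(w, u) v`. -/
def riemann (Γ : V →ₗ[ℝ] V →ₗ[ℝ] V) (DΓ : V →ₗ[ℝ] V →ₗ[ℝ] V →ₗ[ℝ] V) (w u v : V) : V :=
  DΓ w v u - DΓ u v w + Γ w (Γ v u) - Γ u (Γ v w)

lemma IsKoszul.gamma_symm (h : IsKoszul g dg ddg Γ DΓ) (u v : V) : Γ u v = Γ v u := by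
  rw [← sub_eq_zero]
  refine h.nondeg _ fun w => ?_
  rw [map_sub]
  linear_combination (1 / 2) * h.koszul u v w - (1 / 2) * h.koszul v u w - (1 / 2) * h.dsymm w u v

/-- The change of the 2-jet of a bilinear form under a change of coordinates with 3-jet
`(J, K, L)`. -/
structure IsJetPullback (g : V →ₗ[ℝ] V →ₗ[ℝ] ℝ) (dg : V →ₗ[ℝ] V →ₗ[ℝ] V →ₗ[ℝ] ℝ)
    (ddg : V →ₗ[ℝ] V →ₗ[ℝ] V →ₗ[ℝ] V →ₗ[ℝ] ℝ)
    (g' : V' →ₗ[ℝ] V' →ₗ[ℝ] ℝ) (dg' : V' →ₗ[ℝ] V' →ₗ[ℝ] V' →ₗ[ℝ] ℝ)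
    (ddg' : V' →ₗ[ℝ] V' →ₗ[ℝ] V' →ₗ[ℝ] V' →ₗ[ℝ] ℝ)
    (J : V ≃ₗ[ℝ] V') (K : V →ₗ[ℝ] V →ₗ[ℝ] V') (L : V →ₗ[ℝ] V →ₗ[ℝ] V →ₗ[ℝ] V') : Prop where
  symmK : ∀ u v, K u v = K v u
  symmL : ∀ z u v, L z u v = L z v u
  symmL' : ∀ z u v, L z u v = L u z v
  pull : ∀ u v, g u v = g' (J u) (J v)
  dpull : ∀ w u v, dg w u v = dg' (J w) (J u) (J v) + g' (K w u) (J v) + g' (J u) (K w v)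
  ddpull : ∀ z w u v, ddg z w u v =
    ddg' (J z) (J w) (J u) (J v) + dg' (K z w) (J u) (J v) + dg' (J w) (K z u) (J v)
      + dg' (J w) (J u) (K z v) + (dg' (J z) (K w u) (J v) + g' (L z w u) (J v) + g' (K w u) (K z v))
      + (dg' (J z) (J u) (K w v) + g' (K z u) (K w v) + g' (J u) (L z w v))

variable {J : V ≃ₗ[ℝ] V'} {K : V →ₗ[ℝ] V →ₗ[ℝ] V'} {L : V →ₗ[ℝ] V →ₗ[ℝ] V →ₗ[ℝ] V'}

/-- Since `J` is onto and `g'` is nondegenerate, vectors may be compared by pairing with all `J w`;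
the factor `2` fits the Koszul formula. -/
lemma IsKoszul.eq_of_forall (h' : IsKoszul g' dg' ddg' Γ' DΓ') (J : V ≃ₗ[ℝ] V') {x y : V'}
    (hxy : ∀ w, 2 * g' (J w) x = 2 * g' (J w) y) : x = y := by
  rw [← sub_eq_zero]
  refine h'.nondeg _ fun w => ?_
  have := hxy (J.symm w)
  rw [J.apply_symm_apply] at this
  rw [map_sub]
  linarith

/-- The inhomogeneous transformation law of a connection. In the Koszul formula the terms with `K`
cancel in pairs by the symmetry of `K`, except for `g' (J w) (K u v)`, which occurs twice. -/
lemma IsJetPullback.gamma (hP : IsJetPullback g dg ddg g' dg' ddg' J K L)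
    (h : IsKoszul g dg ddg Γ DΓ) (h' : IsKoszul g' dg' ddg' Γ' DΓ') (u v : V) :
    J (Γ u v) = Γ' (J u) (J v) + K u v := by
  refine h'.eq_of_forall J fun w => ?_
  have e1 := h.koszul u v w
  rw [hP.pull, hP.dpull, hP.dpull, hP.dpull, hP.symmK v u, hP.symmK w u, hP.symmK w v] at e1
  have e2 := h'.koszul (J u) (J v) (J w)
  rw [map_add]
  linear_combination e1 - e2 + h'.symm (K v w) (J u)

/-- This is the derivative of the law `gamma` in the direction `z`, where `K` and `L` are the
derivatives of `J` and `K`. It is obtained from the differentiated Koszul formula. -/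
lemma IsJetPullback.dgamma (hP : IsJetPullback g dg ddg g' dg' ddg' J K L)
    (h : IsKoszul g dg ddg Γ DΓ) (h' : IsKoszul g' dg' ddg' Γ' DΓ') (z u v : V) :
    J (DΓ z u v) = DΓ' (J z) (J u) (J v) + Γ' (K z u) (J v) + Γ' (J u) (K z v) + L z u v
      - K z (Γ u v) := by
  refine h'.eq_of_forall J fun w => ?_
  have e1 := h.koszul' z u v w
  rw [hP.pull, hP.ddpull, hP.ddpull, hP.ddpull, hP.dpull, hP.gamma h h',
    hP.symmK v u, hP.symmK w u, hP.symmK w v,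
    hP.symmL z v u, hP.symmL z w u, hP.symmL z w v] at e1
  simp only [map_add] at e1
  have e2 := h'.koszul' (J z) (J u) (J v) (J w)
  have e3 := h'.koszul (K z u) (J v) (J w)
  have e4 := h'.koszul (J u) (K z v) (J w)
  have e5 := h'.koszul (J u) (J v) (K z w)
  simp only [map_add, map_sub]
  linear_combination e1 - e2 - e3 - e4 - e5 + h'.symm (L z v w) (J u)
    + h'.symm (K v w) (K z u) + h'.dsymm (J z) (K v w) (J u)

/-- Antisymmetrization in `w` and `u` removes the symmetric `L`, and the terms with `K` from
`dgamma` cancel against those from the products of Christoffel symbols. -/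
lemma IsJetPullback.riemann (hP : IsJetPullback g dg ddg g' dg' ddg' J K L)
    (h : IsKoszul g dg ddg Γ DΓ) (h' : IsKoszul g' dg' ddg' Γ' DΓ') (w u v : V) :
    J (riemann Γ DΓ w u v) = EH.riemann Γ' DΓ' (J w) (J u) (J v) := by
  simp only [EH.riemann, map_add, map_sub, hP.dgamma h h', hP.gamma h h']
  rw [hP.symmK u w, hP.symmK u v, hP.symmK w v, hP.symmL w v u, hP.symmL u v w, hP.symmL' u w v,
    h'.gamma_symm (J u) (K v w), h'.gamma_symm (J w) (K v u)]
  abel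

end abstract

/-! ### From index expressions to multilinear maps and traces. -/

section concrete

variable {n : ℕ}

/-- The linear map that sends the `i`-th standard basis vector to `X i`. -/
def lin {W : Type*} [AddCommGroup W] [Module ℝ W] (X : Fin n → W) : (Fin n → ℝ) →ₗ[ℝ] W :=
  Fintype.linearCombination ℝ X

@[simp]
lemma lin_single {W : Type*} [AddCommGroup W] [Module ℝ W] (X : Fin n → W) (i : Fin n) :
    lin X (Pi.single i 1) = X i := by
  simp [lin, Fintype.linearCombination_apply_single]

lemma lin_apply {W : Type*} [AddCommGroup W] [Module ℝ W] (X : Fin n → W) (u : Fin n → ℝ) :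
    lin X u = ∑ i, u i • X i := rfl

/-- The bilinear map with values `X i j` on the standard basis. -/
def lin₂ {W : Type*} [AddCommGroup W] [Module ℝ W] (X : Fin n → Fin n → W) :
    (Fin n → ℝ) →ₗ[ℝ] (Fin n → ℝ) →ₗ[ℝ] W := lin fun i => lin (X i)

/-- The trilinear map with values `X i j k` on the standard basis. -/
def lin₃ {W : Type*} [AddCommGroup W] [Module ℝ W] (X : Fin n → Fin n → Fin n → W) :
    (Fin n → ℝ) →ₗ[ℝ] (Fin n → ℝ) →ₗ[ℝ] (Fin n → ℝ) →ₗ[ℝ] W := lin fun i => lin₂ (X i)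

/-- The quadrilinear map with values `X i j k l` on the standard basis. -/
def lin₄ {W : Type*} [AddCommGroup W] [Module ℝ W] (X : Fin n → Fin n → Fin n → Fin n → W) :
    (Fin n → ℝ) →ₗ[ℝ] (Fin n → ℝ) →ₗ[ℝ] (Fin n → ℝ) →ₗ[ℝ] (Fin n → ℝ) →ₗ[ℝ] W :=
  lin fun i => lin₃ (X i)

@[simp]
lemma lin₂_single {W : Type*} [AddCommGroup W] [Module ℝ W] (X : Fin n → Fin n → W) (i j : Fin n) :
    lin₂ X (Pi.single i 1) (Pi.single j 1) = X i j := by simp [lin₂]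

@[simp]
lemma lin₃_single {W : Type*} [AddCommGroup W] [Module ℝ W] (X : Fin n → Fin n → Fin n → W)
    (i j k : Fin n) :
    lin₃ X (Pi.single i 1) (Pi.single j 1) (Pi.single k 1) = X i j k := by simp [lin₃]

@[simp]
lemma lin₄_single {W : Type*} [AddCommGroup W] [Module ℝ W]
    (X : Fin n → Fin n → Fin n → Fin n → W) (i j k l : Fin n) :
    lin₄ X (Pi.single i 1) (Pi.single j 1) (Pi.single k 1) (Pi.single l 1) = X i j k l := by
  simp [lin₄]

lemma lin₂_apply (X : Fin n → Fin n → ℝ) (u v : Fin n → ℝ) :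
    lin₂ X u v = ∑ i, ∑ j, u i * v j * X i j := by
  simp only [lin₂, lin_apply, LinearMap.sum_apply, LinearMap.smul_apply, smul_eq_mul,
    Finset.mul_sum, mul_assoc]

lemma lin₃_apply (X : Fin n → Fin n → Fin n → ℝ) (w u v : Fin n → ℝ) :
    lin₃ X w u v = ∑ k, w k * ∑ i, ∑ j, u i * v j * X k i j := by
  simp only [lin₃, lin_apply (fun i => lin₂ (X i)), LinearMap.sum_apply, LinearMap.smul_apply,
    smul_eq_mul, lin₂_apply]

lemma lin₄_eval {W : Type*} [AddCommGroup W] [Module ℝ W]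
    (X : Fin n → Fin n → Fin n → Fin n → W) (z : Fin n → ℝ) :
    lin₄ X z = ∑ l, z l • lin₃ (X l) := rfl

/-- The bilinear form of a matrix. -/
def matForm (X : Matrix (Fin n) (Fin n) ℝ) : (Fin n → ℝ) →ₗ[ℝ] (Fin n → ℝ) →ₗ[ℝ] ℝ :=
  lin₂ fun i j => X i j

@[simp]
lemma matForm_single (X : Matrix (Fin n) (Fin n) ℝ) (i j : Fin n) :
    matForm X (Pi.single i 1) (Pi.single j 1) = X i j := lin₂_single _ i j

lemma matForm_apply (X : Matrix (Fin n) (Fin n) ℝ) (u v : Fin n → ℝ) :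
    matForm X u v = ∑ i, ∑ j, u i * v j * X i j := lin₂_apply _ u v

/-- Two additive and homogeneous functions that agree on the standard basis are equal. -/
lemma eq_of_forall_single {W : Type*} [AddCommGroup W] [Module ℝ W] {A B : (Fin n → ℝ) → W}
    (hA : IsLinearMap ℝ A) (hB : IsLinearMap ℝ B)
    (h : ∀ i, A (Pi.single i 1) = B (Pi.single i 1)) (u : Fin n → ℝ) : A u = B u := by
  have : hA.mk' A = hB.mk' B := (Pi.basisFun ℝ (Fin n)).ext fun i => by simpa using h i
  exact DFunLike.congr_fun this u

variable {G : Matrix (Fin n) (Fin n) ℝ} {dG : Fin n → Fin n → Fin n → ℝ}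
  {ddG : Fin n → Fin n → Fin n → Fin n → ℝ}

/-- The Christoffel symbols of a jet as a bilinear map. -/
def christoffelMap (G : Matrix (Fin n) (Fin n) ℝ) (dG : Fin n → Fin n → Fin n → ℝ) :
    (Fin n → ℝ) →ₗ[ℝ] (Fin n → ℝ) →ₗ[ℝ] (Fin n → ℝ) :=
  lin₂ fun μ ν σ => christoffel G dG σ μ ν

/-- The derivatives of the Christoffel symbols of a jet as a trilinear map. -/
def dChristoffelMap (G : Matrix (Fin n) (Fin n) ℝ) (dG : Fin n → Fin n → Fin n → ℝ)
    (ddG : Fin n → Fin n → Fin n → Fin n → ℝ) :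
    (Fin n → ℝ) →ₗ[ℝ] (Fin n → ℝ) →ₗ[ℝ] (Fin n → ℝ) →ₗ[ℝ] (Fin n → ℝ) :=
  lin₃ fun ρ μ ν σ => dChristoffel G dG ddG ρ σ μ ν

lemma lin₂_single_left' (G : Fin n → Fin n → ℝ) (i : Fin n) (x : Fin n → ℝ) :
    lin₂ G (Pi.single i 1) x = ∑ j, G i j * x j := by
  simp [lin₂, lin_apply (G i), mul_comm]

lemma matForm_single_left (X : Matrix (Fin n) (Fin n) ℝ) (i : Fin n) (x : Fin n → ℝ) :
    matForm X (Pi.single i 1) x = ∑ j, X i j * x j := lin₂_single_left' _ i x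

lemma lin₃_single_left (dG : Fin n → Fin n → Fin n → ℝ) (k i : Fin n) (x : Fin n → ℝ) :
    lin₃ dG (Pi.single k 1) (Pi.single i 1) x = ∑ j, dG k i j * x j := by
  simp [lin₃, lin₂_single_left']

lemma sum_mul_inv_mul (hG : G.det ≠ 0) (S : Fin n → ℝ) (k : Fin n) :
    ∑ j, G k j * ∑ l, G⁻¹ j l * S l = S k := by
  have h : G * G⁻¹ = 1 := Matrix.mul_nonsing_inv G (isUnit_iff_ne_zero.2 hG)
  have := congrFun (congrArg (fun A => A.mulVec S) h) k
  simp only [← Matrix.mulVec_mulVec, Matrix.one_mulVec] at this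
  exact this

/-- Inserting `∂G⁻¹ = -G⁻¹ ∂G G⁻¹`, the last two factors reassemble to a Christoffel symbol. A
single `G⁻¹` remains in front, so that lowering the index gives the differentiated Koszul formula.
-/
lemma dChristoffel_eq (G : Matrix (Fin n) (Fin n) ℝ) (dG : Fin n → Fin n → Fin n → ℝ)
    (ddG : Fin n → Fin n → Fin n → Fin n → ℝ) (ρ σ μ ν : Fin n) :
    dChristoffel G dG ddG ρ σ μ ν = ∑ a, G⁻¹ σ a * (1 / 2 * (ddG ρ μ a ν + ddG ρ ν a μ - ddG ρ a μ ν)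
      - ∑ b, dG ρ a b * christoffel G dG b μ ν) := by
  set S : Fin n → ℝ := fun l => dG μ l ν + dG ν l μ - dG l μ ν with hS
  have e : ∑ l, dInv G dG ρ σ l * S l
      = - ∑ a, G⁻¹ σ a * ∑ b, dG ρ a b * ∑ l, G⁻¹ b l * S l := by
    simp only [dInv, neg_mul, Finset.sum_neg_distrib, Finset.sum_mul, Finset.mul_sum]
    rw [Finset.sum_comm]
    refine congrArg Neg.neg (Finset.sum_congr rfl fun a _ => ?_)
    rw [Finset.sum_comm]
    exact Finset.sum_congr rfl fun b _ => Finset.sum_congr rfl fun l _ => by ring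
  have hX : ∀ b, christoffel G dG b μ ν = 1 / 2 * ∑ l, G⁻¹ b l * S l := fun _ => rfl
  simp only [dChristoffel, hX]
  rw [Finset.sum_add_distrib, e, ← Finset.sum_neg_distrib, ← Finset.sum_add_distrib, Finset.mul_sum]
  refine Finset.sum_congr rfl fun a _ => ?_
  simp only [mul_left_comm _ (1 / 2 : ℝ), ← Finset.mul_sum]
  ring

/-- By multilinearity the Koszul formulas need only be checked on basis vectors, where `G` contracts
with the leading `G⁻¹` to the identity. -/
lemma isKoszul_of_jet (hG : G.det ≠ 0) (hs : ∀ i j, G i j = G j i)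
    (hds : ∀ k i j, dG k i j = dG k j i) :
    IsKoszul (matForm G) (lin₃ dG) (lin₄ ddG) (christoffelMap G dG) (dChristoffelMap G dG ddG) where
  symm u v := by
    rw [matForm_apply, matForm_apply, Finset.sum_comm]
    exact Finset.sum_congr rfl fun i _ => Finset.sum_congr rfl fun j _ => by rw [hs i j]; ring
  dsymm w u v := by
    rw [lin₃_apply, lin₃_apply]
    refine Finset.sum_congr rfl fun k _ => ?_
    rw [Finset.sum_comm]
    congr 1
    exact Finset.sum_congr rfl fun i _ => Finset.sum_congr rfl fun j _ => by rw [hds k i j]; ring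
  nondeg x hx := by
    refine Matrix.eq_zero_of_mulVec_eq_zero hG (funext fun i => ?_)
    have := hx (Pi.single i 1)
    rwa [matForm_single_left] at this
  koszul u v w := by
    refine eq_of_forall_single (A := fun u => 2 * matForm G w (christoffelMap G dG u v))
      (B := fun u => lin₃ dG u w v + lin₃ dG v w u - lin₃ dG w u v)
      ⟨fun _ _ => by simp; ring, fun _ _ => by simp; ring⟩
      ⟨fun _ _ => by simp; ring, fun _ _ => by simp; ring⟩ (fun μ => ?_) u
    refine eq_of_forall_single (A := fun v => 2 * matForm G w (christoffelMap G dG (Pi.single μ 1) v))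
      (B := fun v => lin₃ dG (Pi.single μ 1) w v + lin₃ dG v w (Pi.single μ 1)
        - lin₃ dG w (Pi.single μ 1) v)
      ⟨fun _ _ => by simp; ring, fun _ _ => by simp; ring⟩
      ⟨fun _ _ => by simp; ring, fun _ _ => by simp; ring⟩ (fun ν => ?_) v
    refine eq_of_forall_single (A := fun w => 2 * matForm G w (christoffelMap G dG (Pi.single μ 1)
        (Pi.single ν 1)))
      (B := fun w => lin₃ dG (Pi.single μ 1) w (Pi.single ν 1) + lin₃ dG (Pi.single ν 1) w
        (Pi.single μ 1) - lin₃ dG w (Pi.single μ 1) (Pi.single ν 1))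
      ⟨fun _ _ => by simp; ring, fun _ _ => by simp; ring⟩
      ⟨fun _ _ => by simp; ring, fun _ _ => by simp; ring⟩ (fun k => ?_) w
    simp only [christoffelMap, lin₂_single, lin₃_single, matForm_single_left]
    have := sum_mul_inv_mul hG (fun l => dG μ l ν + dG ν l μ - dG l μ ν) k
    simp only [christoffel]
    rw [← this, Finset.mul_sum]
    exact Finset.sum_congr rfl fun j _ => by ring
  koszul' z u v w := by
    refine eq_of_forall_single (A := fun z => 2 * matForm G w (dChristoffelMap G dG ddG z u v))
      (B := fun z => lin₄ ddG z u w v + lin₄ ddG z v w u - lin₄ ddG z w u v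
        - 2 * lin₃ dG z w (christoffelMap G dG u v))
      ⟨fun _ _ => by simp; ring, fun _ _ => by simp; ring⟩
      ⟨fun _ _ => by simp; ring, fun _ _ => by simp; ring⟩ (fun ρ => ?_) z
    refine eq_of_forall_single
      (A := fun u => 2 * matForm G w (dChristoffelMap G dG ddG (Pi.single ρ 1) u v))
      (B := fun u => lin₄ ddG (Pi.single ρ 1) u w v + lin₄ ddG (Pi.single ρ 1) v w u
        - lin₄ ddG (Pi.single ρ 1) w u v
        - 2 * lin₃ dG (Pi.single ρ 1) w (christoffelMap G dG u v))
      ⟨fun _ _ => by simp; ring, fun _ _ => by simp; ring⟩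
      ⟨fun _ _ => by simp; ring, fun _ _ => by simp; ring⟩ (fun μ => ?_) u
    refine eq_of_forall_single
      (A := fun v => 2 * matForm G w (dChristoffelMap G dG ddG (Pi.single ρ 1) (Pi.single μ 1) v))
      (B := fun v => lin₄ ddG (Pi.single ρ 1) (Pi.single μ 1) w v
        + lin₄ ddG (Pi.single ρ 1) v w (Pi.single μ 1) - lin₄ ddG (Pi.single ρ 1) w (Pi.single μ 1) v
        - 2 * lin₃ dG (Pi.single ρ 1) w (christoffelMap G dG (Pi.single μ 1) v))
      ⟨fun _ _ => by simp; ring, fun _ _ => by simp; ring⟩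
      ⟨fun _ _ => by simp; ring, fun _ _ => by simp; ring⟩ (fun ν => ?_) v
    refine eq_of_forall_single
      (A := fun w => 2 * matForm G w (dChristoffelMap G dG ddG (Pi.single ρ 1) (Pi.single μ 1)
        (Pi.single ν 1)))
      (B := fun w => lin₄ ddG (Pi.single ρ 1) (Pi.single μ 1) w (Pi.single ν 1)
        + lin₄ ddG (Pi.single ρ 1) (Pi.single ν 1) w (Pi.single μ 1)
        - lin₄ ddG (Pi.single ρ 1) w (Pi.single μ 1) (Pi.single ν 1)
        - 2 * lin₃ dG (Pi.single ρ 1) w (christoffelMap G dG (Pi.single μ 1) (Pi.single ν 1)))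
      ⟨fun _ _ => by simp; ring, fun _ _ => by simp; ring⟩
      ⟨fun _ _ => by simp; ring, fun _ _ => by simp; ring⟩ (fun k => ?_) w
    simp only [christoffelMap, dChristoffelMap, lin₂_single, lin₃_single, lin₄_single,
      matForm_single_left, lin₃_single_left, dChristoffel_eq]
    rw [sum_mul_inv_mul hG]
    ring

/-- The Ricci tensor of a jet as a trace. -/
lemma ricci_eq_trace (μ ν : Fin n) : ricci G dG ddG μ ν = ∑ ρ, riemann (christoffelMap G dG)
    (dChristoffelMap G dG ddG) (Pi.single ρ 1) (Pi.single ν 1) (Pi.single μ 1) ρ := by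
  have hΓ : ∀ (ρ : Fin n) (x : Fin n → ℝ) (σ : Fin n),
      christoffelMap G dG (Pi.single ρ 1) x σ = ∑ l, christoffel G dG σ ρ l * x l := by
    intro ρ x σ
    simp [christoffelMap, lin₂, lin_apply (fun j σ => christoffel G dG σ ρ j), Finset.sum_apply,
      mul_comm]
  have hΓ0 : ∀ μ ν : Fin n, christoffelMap G dG (Pi.single μ 1) (Pi.single ν 1)
      = fun σ => christoffel G dG σ μ ν := fun μ ν => lin₂_single _ μ ν
  simp only [ricci, riemann, Pi.add_apply, Pi.sub_apply, hΓ0, hΓ]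
  rw [← Finset.sum_add_distrib]
  refine Finset.sum_congr rfl fun ρ _ => ?_
  rw [Finset.sum_sub_distrib]
  simp only [dChristoffelMap, lin₃_single]
  ring

/-- The map `w ↦ R(w, u) v`. -/
def riemannMap (Γ : (Fin n → ℝ) →ₗ[ℝ] (Fin n → ℝ) →ₗ[ℝ] (Fin n → ℝ))
    (DΓ : (Fin n → ℝ) →ₗ[ℝ] (Fin n → ℝ) →ₗ[ℝ] (Fin n → ℝ) →ₗ[ℝ] (Fin n → ℝ)) (u v : Fin n → ℝ) :
    (Fin n → ℝ) →ₗ[ℝ] (Fin n → ℝ) where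
  toFun w := riemann Γ DΓ w u v
  map_add' _ _ := by simp only [riemann, map_add, LinearMap.add_apply]; abel
  map_smul' _ _ := by
    simp only [riemann, map_smul, LinearMap.smul_apply, RingHom.id_apply, smul_sub, smul_add]

/-- The Ricci form `(v, u) ↦ tr (w ↦ R(w, u) v)`. -/
def ricciForm (Γ : (Fin n → ℝ) →ₗ[ℝ] (Fin n → ℝ) →ₗ[ℝ] (Fin n → ℝ))
    (DΓ : (Fin n → ℝ) →ₗ[ℝ] (Fin n → ℝ) →ₗ[ℝ] (Fin n → ℝ) →ₗ[ℝ] (Fin n → ℝ)) (v u : Fin n → ℝ) : ℝ :=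
  LinearMap.trace ℝ _ (riemannMap Γ DΓ u v)

lemma ricciForm_eq (Γ : (Fin n → ℝ) →ₗ[ℝ] (Fin n → ℝ) →ₗ[ℝ] (Fin n → ℝ))
    (DΓ : (Fin n → ℝ) →ₗ[ℝ] (Fin n → ℝ) →ₗ[ℝ] (Fin n → ℝ) →ₗ[ℝ] (Fin n → ℝ)) (v u : Fin n → ℝ) :
    ricciForm Γ DΓ v u = ∑ ρ, riemann Γ DΓ (Pi.single ρ 1) u v ρ := by
  rw [ricciForm, LinearMap.trace_eq_matrix_trace ℝ (Pi.basisFun ℝ (Fin n)), Matrix.trace]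
  refine Finset.sum_congr rfl fun ρ _ => ?_
  simp [riemannMap]

/-- Both sides are bilinear and agree on basis vectors; this carries the basis-free trace back to
the components in `scalarOfJet`. -/
lemma ricciForm_eq_lin₂ : ∀ u v, ricciForm (christoffelMap G dG) (dChristoffelMap G dG ddG) v u
    = lin₂ (fun μ ν => ricci G dG ddG μ ν) v u := by
  intro u v
  refine eq_of_forall_single (A := fun v => ricciForm (christoffelMap G dG)
    (dChristoffelMap G dG ddG) v u) (B := fun v => lin₂ (fun μ ν => ricci G dG ddG μ ν) v u)
    ⟨fun _ _ => ?_, fun _ _ => ?_⟩ ⟨fun _ _ => by simp, fun _ _ => by simp⟩ (fun μ => ?_) v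
  · simp only [ricciForm_eq, riemann, ← Finset.sum_add_distrib]
    refine Finset.sum_congr rfl fun ρ _ => ?_
    simp only [map_add, LinearMap.add_apply, Pi.add_apply, Pi.sub_apply]; ring
  · simp only [ricciForm_eq, riemann, Finset.smul_sum]
    refine Finset.sum_congr rfl fun ρ _ => ?_
    simp only [map_smul, LinearMap.smul_apply, Pi.add_apply, Pi.sub_apply, Pi.smul_apply,
      smul_eq_mul]; ring
  refine eq_of_forall_single (A := fun u => ricciForm (christoffelMap G dG)
    (dChristoffelMap G dG ddG) (Pi.single μ 1) u)
    (B := fun u => lin₂ (fun μ ν => ricci G dG ddG μ ν) (Pi.single μ 1) u)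
    ⟨fun _ _ => ?_, fun _ _ => ?_⟩ ⟨fun _ _ => by simp, fun _ _ => by simp⟩ (fun ν => ?_) u
  · simp only [ricciForm_eq, riemann, ← Finset.sum_add_distrib]
    refine Finset.sum_congr rfl fun ρ _ => ?_
    simp only [map_add, LinearMap.add_apply, Pi.add_apply, Pi.sub_apply]; ring
  · simp only [ricciForm_eq, riemann, Finset.smul_sum]
    refine Finset.sum_congr rfl fun ρ _ => ?_
    simp only [map_smul, LinearMap.smul_apply, Pi.add_apply, Pi.sub_apply, Pi.smul_apply,
      smul_eq_mul]; ring
  simp only [ricciForm_eq, lin₂_single, ricci_eq_trace]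

variable {G' : Matrix (Fin n) (Fin n) ℝ} {dG' : Fin n → Fin n → Fin n → ℝ}
  {ddG' : Fin n → Fin n → Fin n → Fin n → ℝ}

/-- The scalar curvature of a 2-jet is invariant under changes of coordinates. -/
theorem scalarOfJet_pullback (hG : G.det ≠ 0) (hs : ∀ i j, G i j = G j i)
    (hds : ∀ k i j, dG k i j = dG k j i) (hG' : G'.det ≠ 0) (hs' : ∀ i j, G' i j = G' j i)
    (hds' : ∀ k i j, dG' k i j = dG' k j i) {J : (Fin n → ℝ) ≃ₗ[ℝ] (Fin n → ℝ)}
    {K : (Fin n → ℝ) →ₗ[ℝ] (Fin n → ℝ) →ₗ[ℝ] (Fin n → ℝ)}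
    {L : (Fin n → ℝ) →ₗ[ℝ] (Fin n → ℝ) →ₗ[ℝ] (Fin n → ℝ) →ₗ[ℝ] (Fin n → ℝ)}
    (hP : IsJetPullback (matForm G) (lin₃ dG) (lin₄ ddG) (matForm G') (lin₃ dG') (lin₄ ddG') J K L) :
    scalarOfJet G dG ddG = scalarOfJet G' dG' ddG' := by
  have k1 := isKoszul_of_jet (ddG := ddG) hG hs hds
  have k2 := isKoszul_of_jet (ddG := ddG') hG' hs' hds'
  -- The curvature endomorphisms of the two jets are conjugate by `J`, so their traces agree.
  have hR : ∀ u v, ricciForm (christoffelMap G dG) (dChristoffelMap G dG ddG) v u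
      = ricciForm (christoffelMap G' dG') (dChristoffelMap G' dG' ddG') (J v) (J u) := by
    intro u v
    have : riemannMap (christoffelMap G' dG') (dChristoffelMap G' dG' ddG') (J u) (J v)
        = J.conj (riemannMap (christoffelMap G dG) (dChristoffelMap G dG ddG) u v) := by
      refine LinearMap.ext fun w => ?_
      have := hP.riemann k1 k2 (J.symm w) u v
      rw [J.apply_symm_apply] at this
      exact this.symm
    rw [ricciForm, ricciForm, this, LinearMap.trace_conj']
  -- With the Jacobian matrix `A`, metric and Ricci tensor both transform as `X = Aᵀ X' A`. The
  -- scalar curvature is the trace of inverse metric times Ricci tensor, and this product is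
  -- conjugated by `A`.
  set A : Matrix (Fin n) (Fin n) ℝ := Matrix.of fun a i => J (Pi.single i 1) a with hA
  set B : Matrix (Fin n) (Fin n) ℝ := Matrix.of fun μ ν => ricci G dG ddG μ ν with hB
  set B' : Matrix (Fin n) (Fin n) ℝ := Matrix.of fun μ ν => ricci G' dG' ddG' μ ν with hB'
  have bil : ∀ (X : Matrix (Fin n) (Fin n) ℝ) (i j : Fin n),
      matForm X (J (Pi.single i 1)) (J (Pi.single j 1)) = (A.transpose * X * A) i j := by
    intro X i j
    simp only [matForm_apply, Matrix.mul_apply, Matrix.transpose_apply, hA, Matrix.of_apply,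
      Finset.sum_mul]
    rw [Finset.sum_comm]
    exact Finset.sum_congr rfl fun a _ => Finset.sum_congr rfl fun b _ => by ring
  have hGA : G = A.transpose * G' * A := by
    ext i j
    rw [← bil, ← hP.pull, matForm_single]
  have hBA : B = A.transpose * B' * A := by
    ext i j
    rw [← bil]
    have h1 := hR (Pi.single j 1) (Pi.single i 1)
    rw [ricciForm_eq_lin₂, ricciForm_eq_lin₂, lin₂_single] at h1
    exact h1
  have hAu : IsUnit A.det := by
    refine isUnit_iff_ne_zero.2 fun h => hG ?_
    rw [hGA, Matrix.det_mul, h, mul_zero]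
  have hAtu : IsUnit A.transpose.det := by rwa [Matrix.det_transpose]
  have tr : ∀ (X Y : Matrix (Fin n) (Fin n) ℝ), ∑ μ, ∑ ν, X μ ν * Y μ ν = (X.transpose * Y).trace := by
    intro X Y
    simp only [Matrix.trace, Matrix.diag, Matrix.mul_apply, Matrix.transpose_apply]
    rw [Finset.sum_comm]
  have e1 : scalarOfJet G dG ddG = ((G⁻¹).transpose * B).trace := tr _ _
  have e2 : scalarOfJet G' dG' ddG' = ((G'⁻¹).transpose * B').trace := tr _ _
  have e3 : ((A.transpose * G' * A)⁻¹).transpose * (A.transpose * B' * A)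
      = A⁻¹ * ((G'⁻¹).transpose * B' * A) := by
    rw [Matrix.mul_inv_rev, Matrix.mul_inv_rev, Matrix.transpose_mul, Matrix.transpose_mul,
      Matrix.transpose_nonsing_inv, Matrix.transpose_nonsing_inv (A := A), Matrix.transpose_transpose]
    simp only [Matrix.mul_assoc]
    rw [Matrix.nonsing_inv_mul_cancel_left _ _ hAtu]
  rw [e1, e2, hGA, hBA, e3, Matrix.trace_mul_comm, Matrix.mul_assoc, Matrix.mul_nonsing_inv _ hAu,
    Matrix.mul_one]

/-- The behaviour of the scalar curvature of a 2-jet under scaling. -/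
lemma scalarOfJet_smul {c : ℝ} (hc : c ≠ 0) (G : Matrix (Fin n) (Fin n) ℝ)
    (dG : Fin n → Fin n → Fin n → ℝ) (ddG : Fin n → Fin n → Fin n → Fin n → ℝ) :
    scalarOfJet (c • G) (fun k i j => c * dG k i j) (fun k l i j => c * ddG k l i j)
      = c⁻¹ * scalarOfJet G dG ddG := by
  -- No invertibility is needed: the inverse of a singular matrix is `0` by convention, on both
  -- sides.
  have hinv : (c • G)⁻¹ = c⁻¹ • G⁻¹ := by
    by_cases h : IsUnit G.det
    · refine Matrix.inv_eq_left_inv ?_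
      rw [Matrix.smul_mul, Matrix.mul_smul, Matrix.nonsing_inv_mul _ h, smul_smul,
        inv_mul_cancel₀ hc, one_smul]
    · have h' : ¬ IsUnit (c • G).det := by
        rw [Matrix.det_smul]
        simpa [isUnit_iff_ne_zero, hc] using h
      rw [Matrix.nonsing_inv_apply_not_isUnit _ h, Matrix.nonsing_inv_apply_not_isUnit _ h',
        smul_zero]
  have hc1 : ∀ x : ℝ, c⁻¹ * (c * x) = x := fun x => inv_mul_cancel_left₀ hc x
  -- Every Christoffel symbol has one inverse metric and one derivative of the metric, so `c`
  -- cancels. Only the final contraction leaves a factor `c⁻¹`.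
  have hΓ : ∀ σ μ ν, christoffel (c • G) (fun k i j => c * dG k i j) σ μ ν
      = christoffel G dG σ μ ν := by
    intro σ μ ν
    simp only [christoffel, hinv, Matrix.smul_apply, smul_eq_mul]
    congr 1
    refine Finset.sum_congr rfl fun l _ => ?_
    rw [← mul_add, ← mul_sub]
    linear_combination hc1 (G⁻¹ σ l * (dG μ l ν + dG ν l μ - dG l μ ν))
  have hDΓ : ∀ ρ σ μ ν, dChristoffel (c • G) (fun k i j => c * dG k i j)
      (fun k l i j => c * ddG k l i j) ρ σ μ ν = dChristoffel G dG ddG ρ σ μ ν := by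
    intro ρ σ μ ν
    simp only [dChristoffel_eq, hinv, Matrix.smul_apply, smul_eq_mul, hΓ]
    refine Finset.sum_congr rfl fun a _ => ?_
    have : ∑ b, c * dG ρ a b * christoffel G dG b μ ν = c * ∑ b, dG ρ a b * christoffel G dG b μ ν := by
      rw [Finset.mul_sum]
      exact Finset.sum_congr rfl fun b _ => by ring
    rw [this]
    linear_combination hc1 (G⁻¹ σ a * (1 / 2 * (ddG ρ μ a ν + ddG ρ ν a μ - ddG ρ a μ ν)
      - ∑ b, dG ρ a b * christoffel G dG b μ ν))
  simp only [scalarOfJet, ricci, hΓ, hDΓ, hinv, Matrix.smul_apply, smul_eq_mul, Finset.mul_sum,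
    mul_assoc]

end concrete

end jet_algebra

/-! ## Weak 2-jets -/

section wjet

variable {n : ℕ} {U U' V : Set (EuclideanSpace ℝ (Fin n))}

/-- `f₁ k` are the weak partial derivatives of `f` on `U` and `f₂ l k` those of `f₁ k`. -/
structure WJet (U : Set (EuclideanSpace ℝ (Fin n))) (f : EuclideanSpace ℝ (Fin n) → ℝ)
    (f₁ : Fin n → EuclideanSpace ℝ (Fin n) → ℝ)
    (f₂ : Fin n → Fin n → EuclideanSpace ℝ (Fin n) → ℝ) : Prop where
  one : ∀ k, HasWeakPartial U k f (f₁ k)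
  two : ∀ l k, HasWeakPartial U l (f₁ k) (f₂ l k)

variable {f : EuclideanSpace ℝ (Fin n) → ℝ} {f₁ : Fin n → EuclideanSpace ℝ (Fin n) → ℝ}
  {f₂ : Fin n → Fin n → EuclideanSpace ℝ (Fin n) → ℝ}

lemma MemW2Loc.wJet {p : ℝ≥0∞} (hU : IsOpen U) (h : MemW2Loc p U f) :
    WJet U f (fun k => weakPartial U k f) (fun l k => weakPartial U l (weakPartial U k f)) :=
  ⟨fun k => h.hasWeakPartial k, fun l k => h.hasWeakPartial₂ hU k l⟩

namespace WJet

lemma mono (h : WJet U f f₁ f₂) (hV : V ⊆ U) : WJet V f f₁ f₂ :=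
  ⟨fun k => (h.one k).mono hV, fun l k => (h.two l k).mono hV⟩

lemma congr (hU : IsOpen U) (h : WJet U f f₁ f₂) {g : EuclideanSpace ℝ (Fin n) → ℝ}
    (hfg : EqOn f g U) : WJet U g f₁ f₂ :=
  ⟨fun k => (h.one k).congr_ae hU ((ae_restrict_iff' hU.measurableSet).2
    (Filter.Eventually.of_forall hfg)) (by rfl), h.two⟩

lemma ae_unique (hU : IsOpen U) (h : WJet U f f₁ f₂)
    {g₁ : Fin n → EuclideanSpace ℝ (Fin n) → ℝ}
    {g₂ : Fin n → Fin n → EuclideanSpace ℝ (Fin n) → ℝ} (h' : WJet U f g₁ g₂) :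
    ∀ᵐ y ∂volume.restrict U, (∀ k, f₁ k y = g₁ k y) ∧ ∀ l k, f₂ l k y = g₂ l k y := by
  have e1 : ∀ k, f₁ k =ᵐ[volume.restrict U] g₁ k := fun k => (h.one k).ae_unique hU (h'.one k)
  have e2 : ∀ l k, f₂ l k =ᵐ[volume.restrict U] g₂ l k := fun l k =>
    ((h.two l k).congr_ae hU (e1 k) (by rfl)).ae_unique hU (h'.two l k)
  filter_upwards [ae_all_iff.2 e1, ae_all_iff.2 fun l => ae_all_iff.2 fun k => e2 l k]
    with y h1 h2 using ⟨h1, h2⟩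

lemma sum (hU : IsOpen U) {ι : Type*} (s : Finset ι) {F : ι → EuclideanSpace ℝ (Fin n) → ℝ}
    {F₁ : ι → Fin n → EuclideanSpace ℝ (Fin n) → ℝ}
    {F₂ : ι → Fin n → Fin n → EuclideanSpace ℝ (Fin n) → ℝ} (h : ∀ a ∈ s, WJet U (F a) (F₁ a) (F₂ a)) :
    WJet U (fun y => ∑ a ∈ s, F a y) (fun k y => ∑ a ∈ s, F₁ a k y)
      (fun l k y => ∑ a ∈ s, F₂ a l k y) :=
  ⟨fun k => HasWeakPartial.sum hU s fun a ha => (h a ha).one k,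
    fun l k => HasWeakPartial.sum hU s fun a ha => (h a ha).two l k⟩

lemma smooth_mul (hU : IsOpen U) (h : WJet U f f₁ f₂) {a : EuclideanSpace ℝ (Fin n) → ℝ}
    (ha : ContDiffOn ℝ ∞ a U) : WJet U (fun y => a y * f y) (fun k y => pd k a y * f y + a y * f₁ k y)
      (fun l k y => (pd l (pd k a) y * f y + pd k a y * f₁ l y)
        + (pd l a y * f₁ k y + a y * f₂ l k y)) :=
  ⟨fun k => (h.one k).smooth_mul hU ha, fun l k =>
    ((h.one l).smooth_mul hU (contDiffOn_pd hU ha)).add ((h.two l k).smooth_mul hU ha)⟩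

lemma comp {ψ ψ' : EuclideanSpace ℝ (Fin n) → EuclideanSpace ℝ (Fin n)} (h : WJet U' f f₁ f₂)
    (hψ : DiffeoOn U U' ψ ψ') (hf : LocallyIntegrableOn f U') : WJet U (fun y => f (ψ y))
      (fun k y => ∑ c, jac ψ c k y * f₁ c (ψ y))
      (fun l k y => (∑ c, pd l (jac ψ c k) y * f₁ c (ψ y))
        + ∑ c, jac ψ c k y * ∑ d, jac ψ d l y * f₂ d c (ψ y)) := by
  refine ⟨fun k => hψ.hasWeakPartial_comp h.one hf k, fun l k => ?_⟩
  have h1 : ∀ c, HasWeakPartial U l (fun y => jac ψ c k y * f₁ c (ψ y))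
      (fun y => pd l (jac ψ c k) y * f₁ c (ψ y) + jac ψ c k y * ∑ d, jac ψ d l y * f₂ d c (ψ y)) :=
    fun c => (hψ.hasWeakPartial_comp (fun d => h.two d c) (h.one c).2.1 l).smooth_mul hψ.isOpen
      (hψ.smooth_jac c k)
  have h2 := HasWeakPartial.sum hψ.isOpen Finset.univ fun c _ => h1 c
  simpa only [Finset.sum_add_distrib] using h2

end WJet

/-- Second partial derivatives of smooth functions commute. -/
lemma pd_comm (hU : IsOpen U) (hf : ContDiffOn ℝ ∞ f U) {y} (hy : y ∈ U) (i j : Fin n) :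
    pd i (pd j f) y = pd j (pd i f) y := by
  have hc : ContDiffAt ℝ ∞ f y := hf.contDiffAt (hU.mem_nhds hy)
  have hs := hc.isSymmSndFDerivAt
    (by simpa using (WithTop.coe_le_coe.2 (le_top : (2 : ℕ∞) ≤ ⊤) : (2 : WithTop ℕ∞) ≤ ((⊤ : ℕ∞) : WithTop ℕ∞)))
  have hd : DifferentiableAt ℝ (fderiv ℝ f) y :=
    (hc.fderiv_right (m := ∞) (by simp)).differentiableAt (by simp)
  have e : ∀ i j : Fin n, pd i (pd j f) y = fderiv ℝ (fderiv ℝ f) y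
      (EuclideanSpace.single i (1 : ℝ)) (EuclideanSpace.single j (1 : ℝ)) := fun i j => by
    have := (hd.hasFDerivAt.clm_apply (hasFDerivAt_const (EuclideanSpace.single j (1 : ℝ)) y)).fderiv
    simp only [pd]
    erw [this]
    simp
  rw [e, e]
  exact hs _ _

lemma lin₃_apply' (X : Fin n → Fin n → Fin n → ℝ) (w u v : Fin n → ℝ) :
    lin₃ X w u v = ∑ i, ∑ j, u i * v j * ∑ k, w k * X k i j := by
  rw [lin₃_apply]
  simp only [Finset.mul_sum]
  rw [Finset.sum_comm]
  refine Finset.sum_congr rfl fun i _ => ?_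
  rw [Finset.sum_comm]
  exact Finset.sum_congr rfl fun j _ => Finset.sum_congr rfl fun k _ => by ring

lemma lin₄_apply' (X : Fin n → Fin n → Fin n → Fin n → ℝ) (z w u v : Fin n → ℝ) :
    lin₄ X z w u v = ∑ i, ∑ j, u i * v j * ∑ k, w k * ∑ l, z l * X l k i j := by
  have h : lin₄ X z w u v = ∑ l, z l * lin₃ (X l) w u v := by
    simp only [lin₄_eval, LinearMap.sum_apply, LinearMap.smul_apply, smul_eq_mul]
  rw [h]
  simp only [lin₃_apply', Finset.mul_sum]
  rw [Finset.sum_comm]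
  refine Finset.sum_congr rfl fun i _ => ?_
  rw [Finset.sum_comm]
  refine Finset.sum_congr rfl fun j _ => ?_
  rw [Finset.sum_comm]
  exact Finset.sum_congr rfl fun k _ => Finset.sum_congr rfl fun l _ => by ring

namespace DiffeoOn

variable {ψ ψ' : EuclideanSpace ℝ (Fin n) → EuclideanSpace ℝ (Fin n)}

lemma lin_jac (h : DiffeoOn U U' ψ ψ') {y} (hy : y ∈ U) (u : Fin n → ℝ) (a : Fin n) :
    lin (fun i a => jac ψ a i y) u a = fderiv ℝ ψ y (WithLp.toLp 2 u) a := by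
  have : (WithLp.toLp 2 u : EuclideanSpace ℝ (Fin n))
      = ∑ i, u i • EuclideanSpace.single i (1 : ℝ) := by
    ext j; simp [Finset.sum_apply, Pi.single_apply]
  rw [this, map_sum]
  simp [lin_apply, h.jac_eq hy]

/-- The Jacobian of a diffeomorphism as a linear equivalence. -/
def jacEquiv (h : DiffeoOn U U' ψ ψ') {y} (hy : y ∈ U) : (Fin n → ℝ) ≃ₗ[ℝ] (Fin n → ℝ) :=
  LinearEquiv.ofInjectiveEndo (lin fun i a => jac ψ a i y) <| by
    intro u v huv
    have h1 : fderiv ℝ ψ y (WithLp.toLp 2 u) = fderiv ℝ ψ y (WithLp.toLp 2 v) := by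
      ext a
      rw [← h.lin_jac hy, ← h.lin_jac hy, huv]
    have h2 := fun w => DFunLike.congr_fun (h.comp_fderiv hy) w
    simp only [ContinuousLinearMap.comp_apply, ContinuousLinearMap.id_apply] at h2
    have h3 : (WithLp.toLp 2 u : EuclideanSpace ℝ (Fin n)) = WithLp.toLp 2 v := by
      rw [← h2 (WithLp.toLp 2 u), h1, h2]
    exact WithLp.toLp_injective 2 h3

lemma jacEquiv_single (h : DiffeoOn U U' ψ ψ') {y} (hy : y ∈ U) (i : Fin n) :
    h.jacEquiv hy (Pi.single i 1) = fun a => jac ψ a i y := lin_single _ i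

/-- A relation between the components of 2-jets in coordinates gives a pullback of jets. -/
lemma isJetPullback (h : DiffeoOn U U' ψ ψ') {y} (hy : y ∈ U) {G G' : Matrix (Fin n) (Fin n) ℝ}
    {dG dG' : Fin n → Fin n → Fin n → ℝ} {ddG ddG' : Fin n → Fin n → Fin n → Fin n → ℝ}
    (h0 : ∀ i j, G i j = ∑ a, ∑ b, jac ψ a i y * (jac ψ b j y * G' a b))
    (h1 : ∀ k i j, dG k i j = ∑ a, ∑ b, (pd k (jac ψ a i) y * (jac ψ b j y * G' a b)
      + jac ψ a i y * (pd k (jac ψ b j) y * G' a b + jac ψ b j y * ∑ c, jac ψ c k y * dG' c a b)))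
    (h2 : ∀ l k i j, ddG l k i j = ∑ a, ∑ b,
      ((pd l (pd k (jac ψ a i)) y * (jac ψ b j y * G' a b)
        + pd k (jac ψ a i) y * (pd l (jac ψ b j) y * G' a b
          + jac ψ b j y * ∑ c, jac ψ c l y * dG' c a b))
      + (pd l (jac ψ a i) y * (pd k (jac ψ b j) y * G' a b
          + jac ψ b j y * ∑ c, jac ψ c k y * dG' c a b)
        + jac ψ a i y * ((pd l (pd k (jac ψ b j)) y * G' a b
          + pd k (jac ψ b j) y * ∑ c, jac ψ c l y * dG' c a b)
          + (pd l (jac ψ b j) y * ∑ c, jac ψ c k y * dG' c a b + jac ψ b j y *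
            ((∑ c, pd l (jac ψ c k) y * dG' c a b)
              + ∑ c, jac ψ c k y * ∑ d, jac ψ d l y * ddG' d c a b)))))) :
    IsJetPullback (matForm G) (lin₃ dG) (lin₄ ddG) (matForm G') (lin₃ dG') (lin₄ ddG')
      (h.jacEquiv hy) (lin₂ fun k i a => pd k (jac ψ a i) y)
      (lin₃ fun l k i a => pd l (pd k (jac ψ a i)) y) := by
  -- The symmetries of `K` and `L` express that partial derivatives of the smooth map `ψ` commute.
  have hψa : ∀ a, ContDiffOn ℝ ∞ (fun y => ψ y a) U := fun a =>
    (EuclideanSpace.proj (𝕜 := ℝ) a).contDiff.comp_contDiffOn h.smooth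
  have cK : ∀ {z}, z ∈ U → ∀ a k i, pd k (jac ψ a i) z = pd i (jac ψ a k) z := fun hz a k i =>
    pd_comm h.isOpen (hψa a) hz k i
  have cL : ∀ a l k i, pd l (pd k (jac ψ a i)) y = pd l (pd i (jac ψ a k)) y := fun a l k i => by
    have : pd k (jac ψ a i) =ᶠ[𝓝 y] pd i (jac ψ a k) := by
      filter_upwards [h.isOpen.mem_nhds hy] with z hz using cK hz a k i
    simp only [pd] at this ⊢
    rw [this.fderiv_eq]
  have cL' : ∀ a l k i, pd l (pd k (jac ψ a i)) y = pd k (pd l (jac ψ a i)) y := fun a l k i =>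
    pd_comm h.isOpen (h.smooth_jac a i) hy l k
  refine ⟨fun u v => ?_, fun z u v => ?_, fun z u v => ?_, fun u v => ?_, fun w u v => ?_,
    fun z w u v => ?_⟩
  · refine eq_of_forall_single (A := fun u => lin₂ (fun k i a => pd k (jac ψ a i) y) u v)
      (B := fun u => lin₂ (fun k i a => pd k (jac ψ a i) y) v u)
      ⟨by simp, by simp⟩ ⟨by simp, by simp⟩ (fun i => ?_) u
    refine eq_of_forall_single (A := fun v => lin₂ (fun k i a => pd k (jac ψ a i) y) _ v)
      (B := fun v => lin₂ (fun k i a => pd k (jac ψ a i) y) v _)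
      ⟨by simp, by simp⟩ ⟨by simp, by simp⟩ (fun j => ?_) v
    rw [lin₂_single, lin₂_single]
    exact funext fun a => cK hy a i j
  · refine eq_of_forall_single (A := fun z => lin₃ (fun l k i a => pd l (pd k (jac ψ a i)) y) z u v)
      (B := fun z => lin₃ (fun l k i a => pd l (pd k (jac ψ a i)) y) z v u)
      ⟨by simp, by simp⟩ ⟨by simp, by simp⟩ (fun i => ?_) z
    refine eq_of_forall_single (A := fun u => lin₃ (fun l k i a => pd l (pd k (jac ψ a i)) y) _ u v)
      (B := fun u => lin₃ (fun l k i a => pd l (pd k (jac ψ a i)) y) _ v u)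
      ⟨by simp, by simp⟩ ⟨by simp, by simp⟩ (fun j => ?_) u
    refine eq_of_forall_single (A := fun v => lin₃ (fun l k i a => pd l (pd k (jac ψ a i)) y) _ _ v)
      (B := fun v => lin₃ (fun l k i a => pd l (pd k (jac ψ a i)) y) _ v _)
      ⟨by simp, by simp⟩ ⟨by simp, by simp⟩ (fun k => ?_) v
    rw [lin₃_single, lin₃_single]
    exact funext fun a => cL a i j k
  · refine eq_of_forall_single (A := fun z => lin₃ (fun l k i a => pd l (pd k (jac ψ a i)) y) z u v)
      (B := fun z => lin₃ (fun l k i a => pd l (pd k (jac ψ a i)) y) u z v)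
      ⟨by simp, by simp⟩ ⟨by simp, by simp⟩ (fun i => ?_) z
    refine eq_of_forall_single (A := fun u => lin₃ (fun l k i a => pd l (pd k (jac ψ a i)) y) _ u v)
      (B := fun u => lin₃ (fun l k i a => pd l (pd k (jac ψ a i)) y) u _ v)
      ⟨by simp, by simp⟩ ⟨by simp, by simp⟩ (fun j => ?_) u
    refine eq_of_forall_single (A := fun v => lin₃ (fun l k i a => pd l (pd k (jac ψ a i)) y) _ _ v)
      (B := fun v => lin₃ (fun l k i a => pd l (pd k (jac ψ a i)) y) _ _ v)
      ⟨by simp, by simp⟩ ⟨by simp, by simp⟩ (fun k => ?_) v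
    rw [lin₃_single, lin₃_single]
    exact funext fun a => cL' a i j k
  · refine eq_of_forall_single (A := fun u => matForm G u v)
      (B := fun u => matForm G' (h.jacEquiv hy u) (h.jacEquiv hy v))
      ⟨by simp, by simp⟩ ⟨by simp, by simp⟩ (fun i => ?_) u
    refine eq_of_forall_single (A := fun v => matForm G _ v)
      (B := fun v => matForm G' (h.jacEquiv hy _) (h.jacEquiv hy v))
      ⟨by simp, by simp⟩ ⟨by simp, by simp⟩ (fun j => ?_) v
    rw [matForm_single, h0, jacEquiv_single, jacEquiv_single, matForm_apply]
    exact Finset.sum_congr rfl fun a _ => Finset.sum_congr rfl fun b _ => by ring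
  · set K := lin₂ fun k i a => pd k (jac ψ a i) y with hK
    set J := h.jacEquiv hy with hJ
    refine eq_of_forall_single (A := fun w => lin₃ dG w u v)
      (B := fun w => lin₃ dG' (J w) (J u) (J v) + matForm G' (K w u) (J v) + matForm G' (J u) (K w v))
      ⟨by simp, by simp⟩
      ⟨fun _ _ => by simp; ring, fun _ _ => by simp; ring⟩ (fun k => ?_) w
    refine eq_of_forall_single (A := fun u => lin₃ dG _ u v)
      (B := fun u => lin₃ dG' (J _) (J u) (J v) + matForm G' (K _ u) (J v) + matForm G' (J u) (K _ v))
      ⟨by simp, by simp⟩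
      ⟨fun _ _ => by simp; ring, fun _ _ => by simp; ring⟩ (fun i => ?_) u
    refine eq_of_forall_single (A := fun v => lin₃ dG _ _ v)
      (B := fun v => lin₃ dG' (J _) (J _) (J v) + matForm G' (K _ _) (J v) + matForm G' (J _) (K _ v))
      ⟨by simp, by simp⟩
      ⟨fun _ _ => by simp; ring, fun _ _ => by simp; ring⟩ (fun j => ?_) v
    rw [lin₃_single, h1, hJ, hK, jacEquiv_single, jacEquiv_single, jacEquiv_single, lin₂_single,
      lin₂_single, matForm_apply, matForm_apply, lin₃_apply']
    simp only [← Finset.sum_add_distrib]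
    exact Finset.sum_congr rfl fun a _ => Finset.sum_congr rfl fun b _ => by ring
  · set K := lin₂ fun k i a => pd k (jac ψ a i) y with hK
    set J := h.jacEquiv hy with hJ
    set L := lin₃ fun l k i a => pd l (pd k (jac ψ a i)) y with hL
    -- Linearity of the right-hand side in each of the four slots, so that the identity may be
    -- checked on basis vectors, where it is `h2`.
    have lz : ∀ w u v, IsLinearMap ℝ fun z =>
        lin₄ ddG' (J z) (J w) (J u) (J v) + lin₃ dG' (K z w) (J u) (J v)
        + lin₃ dG' (J w) (K z u) (J v) + lin₃ dG' (J w) (J u) (K z v)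
        + (lin₃ dG' (J z) (K w u) (J v) + matForm G' (L z w u) (J v) + matForm G' (K w u) (K z v))
        + (lin₃ dG' (J z) (J u) (K w v) + matForm G' (K z u) (K w v) + matForm G' (J u) (L z w v)) :=
      fun w u v => ⟨fun _ _ => by simp only [map_add, LinearMap.add_apply]; ring,
        fun _ _ => by simp only [map_smul, LinearMap.smul_apply, smul_eq_mul]; ring⟩
    have lw : ∀ z u v, IsLinearMap ℝ fun w =>
        lin₄ ddG' (J z) (J w) (J u) (J v) + lin₃ dG' (K z w) (J u) (J v)
        + lin₃ dG' (J w) (K z u) (J v) + lin₃ dG' (J w) (J u) (K z v)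
        + (lin₃ dG' (J z) (K w u) (J v) + matForm G' (L z w u) (J v) + matForm G' (K w u) (K z v))
        + (lin₃ dG' (J z) (J u) (K w v) + matForm G' (K z u) (K w v) + matForm G' (J u) (L z w v)) :=
      fun w u v => ⟨fun _ _ => by simp only [map_add, LinearMap.add_apply]; ring,
        fun _ _ => by simp only [map_smul, LinearMap.smul_apply, smul_eq_mul]; ring⟩
    have lu : ∀ z w v, IsLinearMap ℝ fun u =>
        lin₄ ddG' (J z) (J w) (J u) (J v) + lin₃ dG' (K z w) (J u) (J v)
        + lin₃ dG' (J w) (K z u) (J v) + lin₃ dG' (J w) (J u) (K z v)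
        + (lin₃ dG' (J z) (K w u) (J v) + matForm G' (L z w u) (J v) + matForm G' (K w u) (K z v))
        + (lin₃ dG' (J z) (J u) (K w v) + matForm G' (K z u) (K w v) + matForm G' (J u) (L z w v)) :=
      fun w u v => ⟨fun _ _ => by simp only [map_add, LinearMap.add_apply]; ring,
        fun _ _ => by simp only [map_smul, LinearMap.smul_apply, smul_eq_mul]; ring⟩
    have lv : ∀ z w u, IsLinearMap ℝ fun v =>
        lin₄ ddG' (J z) (J w) (J u) (J v) + lin₃ dG' (K z w) (J u) (J v)
        + lin₃ dG' (J w) (K z u) (J v) + lin₃ dG' (J w) (J u) (K z v)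
        + (lin₃ dG' (J z) (K w u) (J v) + matForm G' (L z w u) (J v) + matForm G' (K w u) (K z v))
        + (lin₃ dG' (J z) (J u) (K w v) + matForm G' (K z u) (K w v) + matForm G' (J u) (L z w v)) :=
      fun w u v => ⟨fun _ _ => by simp only [map_add]; ring,
        fun _ _ => by simp only [map_smul, smul_eq_mul]; ring⟩
    refine eq_of_forall_single (A := fun z => lin₄ ddG z w u v) ⟨by simp, by simp⟩ (lz w u v)
      (fun l => ?_) z
    refine eq_of_forall_single (A := fun w => lin₄ ddG _ w u v) ⟨by simp, by simp⟩ (lw _ u v)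
      (fun k => ?_) w
    refine eq_of_forall_single (A := fun u => lin₄ ddG _ _ u v) ⟨by simp, by simp⟩ (lu _ _ v)
      (fun i => ?_) u
    refine eq_of_forall_single (A := fun v => lin₄ ddG _ _ _ v) ⟨by simp, by simp⟩ (lv _ _ _)
      (fun j => ?_) v
    simp only [lin₄_single, hJ, hK, hL, jacEquiv_single, lin₂_single, lin₃_single, h2,
      matForm_apply, lin₃_apply', lin₄_apply']
    simp only [← Finset.sum_add_distrib (s := (Finset.univ : Finset (Fin n)))
      (f := fun a => ∑ b, _)]
    simp only [← Finset.sum_add_distrib]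
    refine Finset.sum_congr rfl fun a _ => Finset.sum_congr rfl fun b _ => ?_
    simp only [Finset.sum_add_distrib]
    ring

end DiffeoOn

end wjet

/-! ## Change of charts -/

section charts

variable {n : ℕ} {M : Mfld n} {r s : ℕ} {p : ℝ≥0∞}

/-- The domain of the transition map `e' ∘ e⁻¹`. -/
abbrev overlap (e e' : M.Chart) : Set (EuclideanSpace ℝ (Fin n)) :=
  e.target ∩ e.symm ⁻¹' e'.source

lemma isOpen_overlap (e e' : M.Chart) : IsOpen (overlap e e') :=
  e.symm.isOpen_inter_preimage e'.open_source

lemma diffeoOn_transition {e e' : M.Chart} (he : e ∈ M.charts) (he' : e' ∈ M.charts) :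
    DiffeoOn (overlap e e') (overlap e' e) (fun y => e' (e.symm y)) (fun y => e (e'.symm y)) := by
  have key : ∀ {e e' : M.Chart}, e ∈ M.charts → e' ∈ M.charts →
      ContDiffOn ℝ ∞ (fun y => e' (e.symm y)) (overlap e e') := fun {e e'} he he' => by
    rw [← contMDiffOn_iff_contDiffOn]
    have h1 : ContMDiffOn (𝓡 n) (𝓡 n) ∞ e.symm e.target :=
      contMDiffOn_symm_of_mem_maximalAtlas (IsManifold.subset_maximalAtlas he)
    have h2 : ContMDiffOn (𝓡 n) (𝓡 n) ∞ e' e'.source :=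
      contMDiffOn_of_mem_maximalAtlas (IsManifold.subset_maximalAtlas he')
    exact h2.comp (h1.mono inter_subset_left) fun y hy => hy.2
  refine ⟨isOpen_overlap e e', isOpen_overlap e' e, key he he', key he' he,
    fun y hy => ⟨e'.map_source hy.2, ?_⟩, fun y hy => ⟨e.map_source hy.2, ?_⟩,
    fun y hy => ?_, fun y hy => ?_⟩
  · simpa [e'.left_inv hy.2] using e.map_target hy.1
  · simpa [e.left_inv hy.2] using e'.map_target hy.1
  · simp [e'.left_inv hy.2, e.right_inv hy.1]
  · simp [e.left_inv hy.2, e'.right_inv hy.1]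

/-- Near `y` the map `e.symm` is `e'.symm` after the transition map; this is differentiated. The
vectors belong to tangent spaces at points that are only provably equal, so they are compared in the
model space. -/
lemma coordVec_transition {e e' : M.Chart} (he : e ∈ M.charts) (he' : e' ∈ M.charts) (i : Fin n)
    {y : EuclideanSpace ℝ (Fin n)} (hy : y ∈ overlap e e') :
    (coordVec e i y : EuclideanSpace ℝ (Fin n)) = ∑ a, jac (fun y => e' (e.symm y)) a i y •
      (coordVec e' a (e' (e.symm y)) : EuclideanSpace ℝ (Fin n)) := by
  have hD := diffeoOn_transition he he'
  have hd : HasMFDerivAt (𝓡 n) (𝓡 n) (fun y => e' (e.symm y)) y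
      (fderiv ℝ (fun y => e' (e.symm y)) y) := (hD.hasFDerivAt hy).hasMFDerivAt
  have hi : HasMFDerivAt (𝓡 n) (𝓡 n) e'.symm (e' (e.symm y))
      (mfderiv (𝓡 n) (𝓡 n) e'.symm (e' (e.symm y))) :=
    (mdifferentiableAt_atlas_symm he' (hD.mapsTo hy).1).hasMFDerivAt
  have hc := hi.comp y hd
  have he : (fun y => e'.symm (e' (e.symm y))) =ᶠ[𝓝 y] e.symm := by
    filter_upwards [(isOpen_overlap e e').mem_nhds hy] with z hz using e'.left_inv hz.2
  have h1 := (hc.congr_of_eventuallyEq he.symm).mfderiv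
  have h2 : (coordVec e i y : EuclideanSpace ℝ (Fin n))
      = mfderiv (𝓡 n) (𝓡 n) e'.symm (e' (e.symm y))
        (fderiv ℝ (fun y => e' (e.symm y)) y (EuclideanSpace.single i (1 : ℝ))) :=
    DFunLike.congr_fun h1 (EuclideanSpace.single i (1 : ℝ) : EuclideanSpace ℝ (Fin n))
  rw [h2, hD.fderiv_single hy]
  exact (map_sum (mfderiv (𝓡 n) (𝓡 n) e'.symm (e' (e.symm y))) _ _).trans
    (Finset.sum_congr rfl fun a _ => map_smul (mfderiv (𝓡 n) (𝓡 n) e'.symm (e' (e.symm y))) _ _)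

lemma tensor_congr_point (T : Tensor2 M) {x x' : M} (h : x = x') (u v : EuclideanSpace ℝ (Fin n)) :
    T x (u : TangentSpace (𝓡 n) x) (v : TangentSpace (𝓡 n) x)
      = T x' (u : TangentSpace (𝓡 n) x') (v : TangentSpace (𝓡 n) x') := by
  subst h; rfl

lemma bilin_sum_smul {V : Type*} [AddCommGroup V] [Module ℝ V] (B : LinearMap.BilinForm ℝ V)
    {ι : Type*} [Fintype ι] (c d : ι → ℝ) (u v : ι → V) :
    B (∑ a, c a • u a) (∑ b, d b • v b) = ∑ a, ∑ b, c a * (d b * B (u a) (v b)) := by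
  simp only [map_sum, map_smul, LinearMap.sum_apply, LinearMap.smul_apply, smul_eq_mul,
    Finset.mul_sum]
  rw [Finset.sum_comm]
  exact Finset.sum_congr rfl fun a _ => Finset.sum_congr rfl fun b _ => by ring

lemma component_transition (T : Tensor2 M) {e e' : M.Chart} (he : e ∈ M.charts)
    (he' : e' ∈ M.charts) (i j : Fin n) {y : EuclideanSpace ℝ (Fin n)} (hy : y ∈ overlap e e') :
    component T e i j y = ∑ a, ∑ b, jac (fun y => e' (e.symm y)) a i y *
      (jac (fun y => e' (e.symm y)) b j y * component T e' a b (e' (e.symm y))) := by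
  have hx : e.symm y = e'.symm (e' (e.symm y)) := (e'.left_inv hy.2).symm
  have h1 := tensor_congr_point T hx (coordVec e i y) (coordVec e j y)
  refine h1.trans ?_
  have hi := coordVec_transition he he' i hy
  have hj := coordVec_transition he he' j hy
  exact (congrArg₂ (fun u v : TangentSpace (𝓡 n) (e'.symm (e' (e.symm y))) =>
    T (e'.symm (e' (e.symm y))) u v) hi hj).trans (bilin_sum_smul _ _ _ _ _)

lemma HasSignature.symm {V : Type*} [AddCommGroup V] [Module ℝ V] {B : LinearMap.BilinForm ℝ V}
    (h : HasSignature r s B) (u v : V) : B u v = B v u := by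
  obtain ⟨b, hb⟩ := h
  have : B = B.flip := b.ext fun i => b.ext fun j => by
    show B (b i) (b j) = B (b j) (b i)
    rw [hb, hb]
    by_cases hij : i = j
    · subst hij; rfl
    · rw [if_neg hij, if_neg (Ne.symm hij)]
  conv_lhs => rw [this]
  rfl

lemma HasSignature.eq_zero {V : Type*} [AddCommGroup V] [Module ℝ V] {B : LinearMap.BilinForm ℝ V}
    (h : HasSignature r s B) {u : V} (hu : ∀ v, B u v = 0) : u = 0 := by
  obtain ⟨b, hb⟩ := h
  refine b.ext_elem fun j => ?_
  have h1 := hu (b j)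
  rw [← b.sum_repr u, map_sum, LinearMap.sum_apply] at h1
  simp only [map_smul, LinearMap.smul_apply, hb, smul_eq_mul, mul_ite, mul_zero,
    Finset.sum_ite_eq', Finset.mem_univ, if_true] at h1
  rw [map_zero, Finsupp.zero_apply]
  rcases j with j | j <;> simpa using h1

lemma EHMetric.component_symm (g : EHMetric M r s p) (e : M.Chart) (i j : Fin n)
    (y : EuclideanSpace ℝ (Fin n)) : component g.toTensor e i j y = component g.toTensor e j i y :=
  (g.hasSignature _).symm _ _

/-- A null vector of the Gram matrix gives a tangent vector orthogonal to the range of the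
derivative of `e.symm`, which is everything. It is zero by nondegeneracy, and injectivity of the
derivative finishes the proof. -/
lemma EHMetric.det_ne_zero (g : EHMetric M r s p) {e : M.Chart} (he : e ∈ M.charts)
    {y : EuclideanSpace ℝ (Fin n)} (hy : y ∈ e.target) :
    (gramMatrix g.toTensor e y).det ≠ 0 := by
  intro h0
  obtain ⟨c, hc, h1⟩ := Matrix.exists_vecMul_eq_zero_iff.2 h0
  have hm := mdifferentiable_of_mem_atlas (I := 𝓡 n) he
  have hsurj := hm.symm.mfderiv_surjective (x := y) hy
  have hinj := hm.symm.mfderiv_injective (x := y) hy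
  set D := mfderiv (𝓡 n) (𝓡 n) e.symm y with hD
  set B := g.toTensor (e.symm y) with hB
  have key : ∀ u, B (D (WithLp.toLp 2 c : EuclideanSpace ℝ (Fin n))) (D u) = 0 := by
    intro u
    have e1 : ∀ u : EuclideanSpace ℝ (Fin n), D u = ∑ i, u i • coordVec e i y := fun u => by
      have : u = ∑ i, u i • EuclideanSpace.single i (1 : ℝ) := by
        ext j; simp [Finset.sum_apply, Pi.single_apply]
      conv_lhs => rw [this]
      exact (map_sum D _ _).trans (Finset.sum_congr rfl fun a _ => map_smul D _ _)
    have h2 : ∀ j, ∑ i, c i * B (coordVec e i y) (coordVec e j y) = 0 := fun j => congrFun h1 j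
    refine (congrArg₂ (fun a b => B a b) (e1 _) (e1 u)).trans ((bilin_sum_smul B _ _ _ _).trans ?_)
    rw [Finset.sum_comm]
    refine Finset.sum_eq_zero fun j _ => ?_
    have h4 := congrArg ((show EuclideanSpace ℝ (Fin n) from u) j * ·) (h2 j)
    simp only [Finset.mul_sum, mul_zero] at h4
    refine Eq.trans (Finset.sum_congr rfl fun i _ => ?_) h4
    exact mul_left_comm _ _ _
  have h3 : D (WithLp.toLp 2 c : EuclideanSpace ℝ (Fin n)) = 0 :=
    (g.hasSignature _).eq_zero fun v => by
      obtain ⟨u, rfl⟩ := hsurj v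
      exact key u
  have h4 : (WithLp.toLp 2 c : EuclideanSpace ℝ (Fin n)) = 0 := hinj (h3.trans (map_zero D).symm)
  exact hc (by simpa using congrArg (fun v : EuclideanSpace ℝ (Fin n) => v.ofLp) h4)

end charts

/-! ### Existence and uniqueness of scalar curvature and volume. -/

section curvature

variable {n : ℕ} {M : Mfld n} {r s : ℕ} {p : ℝ≥0∞}

/-- The coordinate expressions of the scalar curvature agree on the overlap of two charts. -/
theorem chartScalar_transition (g : EHMetric M r s p) {e e' : M.Chart} (he : e ∈ M.charts)
    (he' : e' ∈ M.charts) : ∀ᵐ y ∂volume.restrict (overlap e e'),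
      chartScalar g.toTensor e y = chartScalar g.toTensor e' (e' (e.symm y)) := by
  have hD := diffeoOn_transition he he'
  have hU := isOpen_overlap e e'
  -- The components in `e` have two weak 2-jets: the chosen one, and the one computed from the
  -- transformation law by the product and chain rules. They agree almost everywhere; from there on
  -- the argument is pointwise algebra.
  have hW : ∀ i j, ∀ᵐ y ∂volume.restrict (overlap e e'), _ := fun i j =>
    ((WJet.sum hU Finset.univ fun a _ => WJet.sum hU Finset.univ fun b _ =>
      ((((g.isW2Loc e' he' a b).2.wJet e'.open_target).mono inter_subset_left).comp hD
        (((g.isW2Loc e' he' a b).1.mono inter_subset_left).locallyIntegrableOn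
          (isOpen_overlap e' e).measurableSet)
        |>.smooth_mul hU (hD.smooth_jac b j)).smooth_mul hU (hD.smooth_jac a i)).congr hU
      (fun y hy => (component_transition g.toTensor he he' i j hy).symm)).ae_unique hU
      (((g.isW2Loc e he i j).2.wJet e.open_target).mono inter_subset_left)
  filter_upwards [ae_all_iff.2 fun i => ae_all_iff.2 fun j => hW i j,
    ae_restrict_mem hU.measurableSet] with y hy hyU
  have hs : ∀ e : M.Chart, ∀ i j, component g.toTensor e i j = component g.toTensor e j i :=
    fun e i j => funext (g.component_symm e i j)
  refine scalarOfJet_pullback (g.det_ne_zero he hyU.1) (fun i j => g.component_symm e i j y)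
    (fun k i j => by rw [hs e i j]) (g.det_ne_zero he' (hD.mapsTo hyU).1)
    (fun i j => g.component_symm e' i j _) (fun k i j => by rw [hs e' i j])
    (hD.isJetPullback hyU (fun i j => component_transition g.toTensor he he' i j hyU)
      (fun k i j => ((hy i j).1 k).symm) (fun l k i j => ((hy i j).2 l k).symm))

/-- The density `|det g_{ij}|^{1/2}` of the volume in a chart. -/
def density (g : Tensor2 M) (e : M.Chart) (y : EuclideanSpace ℝ (Fin n)) : ℝ :=
  √|(gramMatrix g e y).det|

lemma density_nonneg (g : Tensor2 M) (e : M.Chart) (y) : 0 ≤ density g e y := Real.sqrt_nonneg _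

/-- The Gram matrices satisfy `G = Jᵀ G' J`, so the determinant gains the factor `(det J)²`, whose
root is `|det J|`. -/
lemma density_transition (g : Tensor2 M) {e e' : M.Chart} (he : e ∈ M.charts)
    (he' : e' ∈ M.charts) {y : EuclideanSpace ℝ (Fin n)} (hy : y ∈ overlap e e') :
    density g e y = |(fderiv ℝ (fun y => e' (e.symm y)) y).det| * density g e' (e' (e.symm y)) := by
  have hD := diffeoOn_transition he he'
  set ψ := fun y => e' (e.symm y) with hψ
  set J : Matrix (Fin n) (Fin n) ℝ := Matrix.of fun a i => jac ψ a i y with hJ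
  have h1 : gramMatrix g e y = J.transpose * gramMatrix g e' (ψ y) * J := by
    ext i j
    rw [gramMatrix, Matrix.of_apply, component_transition g he he' i j hy]
    simp only [Matrix.mul_apply, Finset.sum_mul, Matrix.transpose_apply, hJ, Matrix.of_apply,
      gramMatrix]
    rw [Finset.sum_comm]
    exact Finset.sum_congr rfl fun a _ => Finset.sum_congr rfl fun b _ => by ring
  have h2 : (fderiv ℝ ψ y).det = J.det := by
    have : J = LinearMap.toMatrix (EuclideanSpace.basisFun (Fin n) ℝ).toBasis
        (EuclideanSpace.basisFun (Fin n) ℝ).toBasis (fderiv ℝ ψ y : _ →ₗ[ℝ] _) := by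
      ext a i
      simp [LinearMap.toMatrix_apply, hJ, hD.jac_eq hy]
    rw [this, LinearMap.det_toMatrix]
  rw [density, density, h1, Matrix.det_mul, Matrix.det_mul, Matrix.det_transpose, h2, abs_mul,
    abs_mul, mul_right_comm, Real.sqrt_mul (by positivity), Real.sqrt_mul_self (abs_nonneg _)]

/-- The volume measure of `g` on the domain of a chart. -/
def chartMeasure (g : Tensor2 M) (e : M.Chart) : Measure M :=
  Measure.map (fun z : e.target => e.symm z) (Measure.comap Subtype.val
    (volume.withDensity fun y => ((density g e y).toNNReal : ℝ≥0∞)))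

lemma measurableEmbedding_chart_symm (e : M.Chart) :
    MeasurableEmbedding (fun z : e.target => e.symm z) :=
  (e.symm.isOpenEmbedding_restrict).measurableEmbedding

lemma image_val_preimage (e : M.Chart) (A : Set M) :
    Subtype.val '' ((fun z : e.target => e.symm z) ⁻¹' A) = e.target ∩ e.symm ⁻¹' A := by
  ext y
  constructor
  · rintro ⟨z, hz, rfl⟩
    exact ⟨z.2, hz⟩
  · rintro ⟨h1, h2⟩
    exact ⟨⟨y, h1⟩, h2, rfl⟩

lemma measurableSet_target_inter (e : M.Chart) {A : Set M} (hA : MeasurableSet A) :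
    MeasurableSet (e.target ∩ e.symm ⁻¹' A) := by
  rw [← image_val_preimage]
  exact (MeasurableEmbedding.subtype_coe e.open_target.measurableSet).measurableSet_image.2
    ((measurableEmbedding_chart_symm e).measurable hA)

lemma chartMeasure_apply (g : Tensor2 M) (e : M.Chart) {A : Set M} (hA : MeasurableSet A) :
    chartMeasure g e A = ∫⁻ y in e.target ∩ e.symm ⁻¹' A, ENNReal.ofReal (density g e y) := by
  rw [chartMeasure, (measurableEmbedding_chart_symm e).map_apply,
    (MeasurableEmbedding.subtype_coe e.open_target.measurableSet).comap_apply, image_val_preimage,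
    withDensity_apply _ (measurableSet_target_inter e hA)]
  rfl

lemma chartMeasure_restrict_source (g : Tensor2 M) (e : M.Chart) :
    (chartMeasure g e).restrict e.source = chartMeasure g e := by
  refine Measure.ext fun A hA => ?_
  rw [Measure.restrict_apply hA, chartMeasure_apply g e (hA.inter e.open_source.measurableSet),
    chartMeasure_apply g e hA]
  congr 2
  ext y
  exact ⟨fun h => ⟨h.1, h.2.1⟩, fun h => ⟨h.1, h.2, e.map_target h.1⟩⟩

/-- The Jacobian in the change of variables is exactly the factor in `density_transition`. -/
lemma chartMeasure_transition (g : Tensor2 M) {e e' : M.Chart} (he : e ∈ M.charts)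
    (he' : e' ∈ M.charts) {A : Set M} (hA : MeasurableSet A) (h : A ⊆ e.source)
    (h' : A ⊆ e'.source) : chartMeasure g e A = chartMeasure g e' A := by
  have hD := diffeoOn_transition he he'
  rw [chartMeasure_apply g e hA, chartMeasure_apply g e' hA]
  have hS : e.target ∩ e.symm ⁻¹' A ⊆ overlap e e' := fun y hy => ⟨hy.1, h' hy.2⟩
  have himg : e'.target ∩ e'.symm ⁻¹' A
      = (fun y => e' (e.symm y)) '' (e.target ∩ e.symm ⁻¹' A) := by
    ext z
    constructor
    · rintro ⟨h1, h2⟩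
      refine ⟨e (e'.symm z), ⟨e.map_source (h h2), ?_⟩, ?_⟩
      · simpa [e.left_inv (h h2)] using h2
      · simp [e.left_inv (h h2), e'.right_inv h1]
    · rintro ⟨y, hy, rfl⟩
      refine ⟨e'.map_source (h' hy.2), ?_⟩
      simpa [e'.left_inv (h' hy.2)] using hy.2
  have hm := measurableSet_target_inter e hA
  rw [himg, lintegral_image_eq_lintegral_abs_det_fderiv_mul volume hm
    (fun y hy => (hD.hasFDerivAt (hS hy)).hasFDerivWithinAt) (hD.injOn.mono hS)]
  refine setLIntegral_congr_fun hm fun y hy => ?_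
  rw [density_transition g he he' (hS hy), ENNReal.ofReal_mul (abs_nonneg _)]

/-- An almost everywhere statement in coordinates holds almost everywhere on the chart domain. -/
lemma ae_chartMeasure (g : Tensor2 M) (e : M.Chart) {P : M → Prop}
    (h : ∀ᵐ y ∂volume.restrict e.target, P (e.symm y)) : ∀ᵐ x ∂chartMeasure g e, P x := by
  rw [chartMeasure, (measurableEmbedding_chart_symm e).ae_map_iff]
  refine (ae_restrict_iff_subtype (p := fun y => P (e.symm y)) e.open_target.measurableSet).1 ?_
  exact (withDensity_absolutelyContinuous _ _).restrict _ h

/-- Here and in `setIntegral_chartMeasure` the function `f` is arbitrary: integrals against images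
under measurable embeddings, and against densities with values in `ℝ≥0`, can be rewritten without
measurability of the integrand. -/
lemma integrableOn_chartMeasure_iff {g : Tensor2 M} {e : M.Chart}
    (hd : AEMeasurable (density g e) (volume.restrict e.target)) {A : Set M}
    (hA : MeasurableSet A) (f : M → ℝ) : IntegrableOn f A (chartMeasure g e) ↔
      IntegrableOn (fun y => density g e y * f (e.symm y)) (e.target ∩ e.symm ⁻¹' A) := by
  have hm := MeasurableEmbedding.subtype_coe e.open_target.measurableSet
  have hS := measurableSet_target_inter e hA
  have hp : (fun z : e.target => e.symm z) ⁻¹' A = Subtype.val ⁻¹' (e.target ∩ e.symm ⁻¹' A) := by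
    ext z
    exact ⟨fun h => ⟨z.2, h⟩, fun h => h.2⟩
  rw [chartMeasure, (measurableEmbedding_chart_symm e).integrableOn_map_iff, hp]
  refine (hm.integrableOn_iff_comap (f := fun y => f (e.symm y)) (by simp)).symm.trans ?_
  rw [IntegrableOn, restrict_withDensity hS, integrable_withDensity_iff_integrable_smul₀
    (hd.mono_measure (Measure.restrict_mono inter_subset_left le_rfl)).real_toNNReal]
  refine integrable_congr (Filter.Eventually.of_forall fun y => ?_)
  simp [NNReal.smul_def, Real.coe_toNNReal _ (density_nonneg g e y)]

lemma setIntegral_chartMeasure {g : Tensor2 M} {e : M.Chart}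
    (hd : AEMeasurable (density g e) (volume.restrict e.target)) {A : Set M}
    (hA : MeasurableSet A) (f : M → ℝ) : ∫ x in A, f x ∂chartMeasure g e =
      ∫ y in e.target ∩ e.symm ⁻¹' A, density g e y * f (e.symm y) := by
  have hm := MeasurableEmbedding.subtype_coe e.open_target.measurableSet
  have hS := measurableSet_target_inter e hA
  have hp : (fun z : e.target => e.symm z) ⁻¹' A = Subtype.val ⁻¹' (e.target ∩ e.symm ⁻¹' A) := by
    ext z
    exact ⟨fun h => ⟨z.2, h⟩, fun h => h.2⟩
  rw [chartMeasure, (measurableEmbedding_chart_symm e).setIntegral_map, hp,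
    ← hm.setIntegral_map (fun y => f (e.symm y)),
    map_comap_subtype_coe e.open_target.measurableSet, Measure.restrict_restrict hS,
    inter_eq_left.2 inter_subset_left, setIntegral_withDensity_eq_setIntegral_smul₀
      (hd.mono_measure (Measure.restrict_mono inter_subset_left le_rfl)).real_toNNReal _ hS]
  refine integral_congr_ae (Filter.Eventually.of_forall fun y => ?_)
  simp [NNReal.smul_def, Real.coe_toNNReal _ (density_nonneg g e y)]

variable (M) in
-- Second countability gives a countable subcover by charts; a point of `M` is needed to index it by
-- `ℕ`.
lemma exists_countable_charts [Nonempty M] : ∃ E : ℕ → M.Chart, (∀ k, E k ∈ M.charts) ∧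
    ⋃ k, (E k).source = univ := by
  obtain ⟨t, ht, hU⟩ := TopologicalSpace.countable_cover_nhds
    fun x : M => chart_source_mem_nhds (EuclideanSpace ℝ (Fin n)) x
  have hne : t.Nonempty := by
    by_contra h
    rw [not_nonempty_iff_eq_empty] at h
    simp [h] at hU
    exact (univ_nonempty (α := M)).ne_empty hU.symm
  obtain ⟨f, rfl⟩ := ht.exists_eq_range hne
  exact ⟨fun k => chartAt _ (f k), fun k => chart_mem_atlas _ _, by simpa using hU⟩

lemma isVolumeMeasure_iff {g : Tensor2 M} {μ : Measure M} :
    IsVolumeMeasure g μ ↔ ∀ e ∈ M.charts, μ.restrict e.source = chartMeasure g e := by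
  constructor
  · intro h e he
    rw [← chartMeasure_restrict_source]
    refine Measure.ext fun A hA => ?_
    have hA' := hA.inter e.open_source.measurableSet
    rw [Measure.restrict_apply hA, Measure.restrict_apply hA, h e he _ inter_subset_right hA',
      chartMeasure_apply g e hA']
    rfl
  · intro h e he A hA hm
    have h1 := congrArg (fun ν => ν A) (h e he)
    simp only [Measure.restrict_apply hm, inter_eq_left.2 hA, chartMeasure_apply g e hm] at h1
    exact h1

lemma IsVolumeMeasure.unique {g : Tensor2 M} {μ ν : Measure M} (hμ : IsVolumeMeasure g μ)
    (hν : IsVolumeMeasure g ν) : μ = ν := by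
  rcases isEmpty_or_nonempty M with hM | hM
  · rw [Measure.eq_zero_of_isEmpty μ, Measure.eq_zero_of_isEmpty ν]
  obtain ⟨E, hE, hU⟩ := exists_countable_charts M
  rw [Measure.ext_iff_of_iUnion_eq_univ hU]
  intro k
  rw [isVolumeMeasure_iff.1 hμ _ (hE k), isVolumeMeasure_iff.1 hν _ (hE k)]

/-- Countably many charts suffice, and coordinate null sets are null for the volume measure since
that has a density in each chart. -/
lemma IsScalarCurvature.ae_eq {g : Tensor2 M} {μ : Measure M} (hμ : IsVolumeMeasure g μ)
    {R R' : M → ℝ} (hR : IsScalarCurvature g R) (hR' : IsScalarCurvature g R') : R =ᵐ[μ] R' := by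
  rcases isEmpty_or_nonempty M with hM | hM
  · exact Filter.Eventually.of_forall fun x => isEmptyElim x
  obtain ⟨E, hE, hU⟩ := exists_countable_charts M
  rw [Filter.EventuallyEq, ← Measure.restrict_univ (μ := μ), ← hU, ae_restrict_iUnion_iff]
  intro k
  rw [isVolumeMeasure_iff.1 hμ _ (hE k)]
  refine ae_chartMeasure g (E k) ?_
  filter_upwards [hR _ (hE k), hR' _ (hE k)] with y h1 h2
  rw [h1, h2]

lemma volumeMeasure_eq {g : Tensor2 M} {μ : Measure M} (hμ : IsVolumeMeasure g μ) :
    volumeMeasure g = μ := by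
  have h : ∃ μ, IsVolumeMeasure g μ := ⟨μ, hμ⟩
  rw [volumeMeasure, dif_pos h]
  exact h.choose_spec.unique hμ

lemma scalarCurvature_ae_eq {g : Tensor2 M} {μ : Measure M} (hμ : IsVolumeMeasure g μ)
    {R : M → ℝ} (hR : IsScalarCurvature g R) : scalarCurvature g =ᵐ[μ] R := by
  have h : ∃ R, IsScalarCurvature g R := ⟨R, hR⟩
  rw [scalarCurvature, dif_pos h]
  exact h.choose_spec.ae_eq hμ hR

/-- The action may be computed with any representatives of curvature and volume. -/
theorem lagrangianIntegral_eq {g : Tensor2 M} {μ : Measure M} (hμ : IsVolumeMeasure g μ)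
    {R : M → ℝ} (hR : IsScalarCurvature g R) (Ω : Set M) :
    lagrangianIntegral g Ω = ∫ x in Ω, R x ∂μ := by
  rw [lagrangianIntegral, volumeMeasure_eq hμ]
  exact integral_congr_ae (ae_restrict_of_ae (scalarCurvature_ae_eq hμ hR))

/-- At each point the coordinate expression is taken in one chart of a countable cover. In another
chart it differs from the local expression only on countably many null sets, by
`chartScalar_transition`. -/
theorem EHMetric.exists_isScalarCurvature (g : EHMetric M r s p) :
    ∃ R, IsScalarCurvature g.toTensor R := by
  rcases isEmpty_or_nonempty M with hM | hM
  · exact ⟨0, fun e he => Filter.Eventually.of_forall fun y => isEmptyElim (e.symm y)⟩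
  obtain ⟨E, hE, hU⟩ := exists_countable_charts M
  choose k hk using fun x : M => mem_iUnion.1 (hU.symm ▸ mem_univ x : x ∈ ⋃ k, (E k).source)
  refine ⟨fun x => chartScalar g.toTensor (E (k x)) (E (k x) x), fun e he => ?_⟩
  have h : ∀ j, ∀ᵐ y ∂volume.restrict e.target, y ∈ e.symm ⁻¹' (E j).source →
      chartScalar g.toTensor e y = chartScalar g.toTensor (E j) (E j (e.symm y)) := fun j => by
    have h1 := (ae_restrict_iff' (isOpen_overlap e (E j)).measurableSet).1
      (chartScalar_transition g he (hE j))
    rw [ae_restrict_iff' e.open_target.measurableSet]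
    filter_upwards [h1] with y hy h2 h3 using hy ⟨h2, h3⟩
  filter_upwards [ae_all_iff.2 h] with y hy
  exact (hy _ (hk (e.symm y))).symm

variable (M) in
-- A countable cover by charts is made disjoint and the chart measures on the pieces are added;
-- `chartMeasure_transition` shows that the result is right in every chart.
theorem exists_isVolumeMeasure (g : Tensor2 M) : ∃ μ, IsVolumeMeasure g μ := by
  rcases isEmpty_or_nonempty M with hM | hM
  · refine ⟨0, fun e he A hA hm => ?_⟩
    rw [eq_empty_of_isEmpty A]
    simp
  obtain ⟨E, hE, hU⟩ := exists_countable_charts M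
  set D := disjointed fun k => (E k).source with hD
  have hDm : ∀ k, MeasurableSet (D k) :=
    fun k => MeasurableSet.disjointed (fun k => (E k).open_source.measurableSet) k
  refine ⟨Measure.sum fun k => (chartMeasure g (E k)).restrict (D k), fun e he A hA hm => ?_⟩
  rw [Measure.sum_apply _ hm]
  have h1 : ∀ k, (chartMeasure g (E k)).restrict (D k) A = chartMeasure g e (A ∩ D k) := fun k => by
    rw [Measure.restrict_apply hm]
    exact chartMeasure_transition g (hE k) he (hm.inter (hDm k))
      (inter_subset_right.trans (disjointed_subset _ _)) (inter_subset_left.trans hA)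
  simp only [h1]
  rw [← measure_iUnion (fun i j hij => ((disjoint_disjointed _ hij).mono inter_subset_right
    inter_subset_right)) fun k => hm.inter (hDm k), ← inter_iUnion, iUnion_disjointed, hU,
    inter_univ, chartMeasure_apply g e hm]
  rfl

end curvature

/-! ## Continuity of the action -/

section convergence

variable {ι X : Type*} [MeasurableSpace X] {ν : Measure X} {l : Filter ι} {q q₁ q₂ : ℝ≥0∞}

/-- The functions `F i` converge to `f` in `L^q` along `l`. -/
structure ConvLp (l : Filter ι) (ν : Measure X) (q : ℝ≥0∞) (F : ι → X → ℝ) (f : X → ℝ) : Prop where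
  memLp : ∀ i, MemLp (F i) q ν
  memLp_lim : MemLp f q ν
  tendsto : Filter.Tendsto (fun i => eLpNorm (fun x => F i x - f x) q ν) l (𝓝 0)

namespace ConvLp

variable {F G : ι → X → ℝ} {f g : X → ℝ}

lemma add [hq : Fact (1 ≤ q)] (hF : ConvLp l ν q F f) (hG : ConvLp l ν q G g) :
    ConvLp l ν q (fun i x => F i x + G i x) (fun x => f x + g x) := by
  refine ⟨fun i => (hF.memLp i).add (hG.memLp i), hF.memLp_lim.add hG.memLp_lim, ?_⟩
  refine tendsto_of_tendsto_of_tendsto_of_le_of_le tendsto_const_nhds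
    (by simpa using hF.tendsto.add hG.tendsto) (fun _ => zero_le) fun i => ?_
  have : (fun x => F i x + G i x - (f x + g x)) = (fun x => F i x - f x) + fun x => G i x - g x := by
    funext x
    simp only [Pi.add_apply]
    ring
  rw [this]
  exact eLpNorm_add_le ((hF.memLp i).sub hF.memLp_lim).1 ((hG.memLp i).sub hG.memLp_lim).1 hq.1

lemma const_mul (c : ℝ) (hF : ConvLp l ν q F f) :
    ConvLp l ν q (fun i x => c * F i x) (fun x => c * f x) := by
  refine ⟨fun i => (hF.memLp i).const_mul c, hF.memLp_lim.const_mul c, ?_⟩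
  have : (fun i => eLpNorm (fun x => c * F i x - c * f x) q ν)
      = fun i => ‖c‖ₑ * eLpNorm (fun x => F i x - f x) q ν := by
    funext i
    rw [← eLpNorm_const_smul]
    congr 1
    funext x
    simp [mul_sub]
  rw [this]
  simpa using ENNReal.Tendsto.const_mul hF.tendsto (Or.inr enorm_ne_top)

lemma neg (hF : ConvLp l ν q F f) : ConvLp l ν q (fun i x => -F i x) (fun x => -f x) := by
  simpa using hF.const_mul (-1)

lemma sub [Fact (1 ≤ q)] (hF : ConvLp l ν q F f) (hG : ConvLp l ν q G g) :
    ConvLp l ν q (fun i x => F i x - G i x) (fun x => f x - g x) := by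
  simpa only [sub_eq_add_neg] using hF.add hG.neg

lemma sum [Fact (1 ≤ q)] {κ : Type*} (s : Finset κ) {F : κ → ι → X → ℝ} {f : κ → X → ℝ}
    (h : ∀ k, ConvLp l ν q (F k) (f k)) :
    ConvLp l ν q (fun i x => ∑ k ∈ s, F k i x) (fun x => ∑ k ∈ s, f k x) := by
  classical
  induction s using Finset.induction_on with
  | empty =>
    simp only [Finset.sum_empty]
    exact ⟨fun _ => MemLp.zero, MemLp.zero, by simpa using tendsto_const_nhds⟩
  | insert a s ha ih =>
    simp only [Finset.sum_insert ha]
    exact (h a).add ih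

/-- Hölder's inequality applied to `FG - fg = (F - f)(G - g) + (F - f)g + f(G - g)`. -/
lemma mul [hq : Fact (1 ≤ q)] [ENNReal.HolderTriple q₁ q₂ q] (hF : ConvLp l ν q₁ F f)
    (hG : ConvLp l ν q₂ G g) : ConvLp l ν q (fun i x => F i x * G i x) (fun x => f x * g x) := by
  refine ⟨fun i => (hG.memLp i).mul' (hF.memLp i), hG.memLp_lim.mul' hF.memLp_lim, ?_⟩
  have h1 : Filter.Tendsto (fun i => eLpNorm (fun x => F i x - f x) q₁ ν
      * eLpNorm (fun x => G i x - g x) q₂ ν + eLpNorm (fun x => F i x - f x) q₁ ν * eLpNorm g q₂ ν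
      + eLpNorm f q₁ ν * eLpNorm (fun x => G i x - g x) q₂ ν) l (𝓝 0) := by
    have a1 := ENNReal.Tendsto.mul hF.tendsto (Or.inr ENNReal.zero_ne_top) hG.tendsto
      (Or.inr ENNReal.zero_ne_top)
    have a2 := ENNReal.Tendsto.mul_const hF.tendsto (Or.inr hG.memLp_lim.eLpNorm_ne_top)
    have a3 := ENNReal.Tendsto.const_mul hG.tendsto (Or.inr hF.memLp_lim.eLpNorm_ne_top)
    simpa using (a1.add a2).add a3
  refine tendsto_of_tendsto_of_tendsto_of_le_of_le tendsto_const_nhds h1 (fun _ => zero_le)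
    fun i => ?_
  have mF := (hF.memLp i).sub hF.memLp_lim
  have mG := (hG.memLp i).sub hG.memLp_lim
  have e : (fun x => F i x * G i x - f x * g x) = ((fun x => F i x - f x) • (fun x => G i x - g x)
      + (fun x => F i x - f x) • g) + f • fun x => G i x - g x := by
    funext x
    simp only [Pi.add_apply, smul_eq_mul, Pi.mul_apply]
    ring
  rw [e]
  refine (eLpNorm_add_le ((mF.1.smul mG.1).add (mF.1.smul hG.memLp_lim.1))
    (hF.memLp_lim.1.smul mG.1) hq.1).trans (add_le_add ((eLpNorm_add_le (mF.1.smul mG.1)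
      (mF.1.smul hG.memLp_lim.1) hq.1).trans (add_le_add ?_ ?_)) ?_)
  · exact eLpNorm_smul_le_mul_eLpNorm mG.1 mF.1
  · exact eLpNorm_smul_le_mul_eLpNorm hG.memLp_lim.1 mF.1
  · exact eLpNorm_smul_le_mul_eLpNorm mG.1 hF.memLp_lim.1

/-- Uniform convergence on a compact set is preserved by continuous functions. -/
lemma comp_of_tendstoUniformlyOn [TopologicalSpace X] [T2Space X] [OpensMeasurableSpace X]
    [IsFiniteMeasureOnCompacts ν]
    [SecondCountableTopology X] {Y : Type*} [UniformSpace Y] {K : Set X} (hK : IsCompact K)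
    {F : ι → X → Y} {f : X → Y} {φ : Y → ℝ} (hF : ∀ i, ContinuousOn (F i) K)
    (hf : ContinuousOn f K) (h : TendstoUniformlyOn F f l K)
    (hφF : ∀ i, ∀ y ∈ K, ContinuousAt φ (F i y)) (hφf : ∀ y ∈ K, ContinuousAt φ (f y)) :
    ConvLp l (ν.restrict K) ⊤ (fun i y => φ (F i y)) (fun y => φ (f y)) := by
  have hmem : ∀ {f : X → Y}, ContinuousOn f K → (∀ y ∈ K, ContinuousAt φ (f y)) →
      MemLp (fun y => φ (f y)) ⊤ (ν.restrict K) := fun {f} hf hφ => by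
    have hc : ContinuousOn (fun y => φ (f y)) K := fun y hy =>
      (hφ y hy).comp_continuousWithinAt (hf y hy)
    obtain ⟨B, hB⟩ := hK.exists_bound_of_continuousOn hc
    exact memLp_top_of_bound (hc.aestronglyMeasurable hK.measurableSet) B
      ((ae_restrict_iff' hK.measurableSet).2 (Filter.Eventually.of_forall hB))
  refine ⟨fun i => hmem (hF i) (hφF i), hmem hf hφf, ?_⟩
  rw [ENNReal.tendsto_nhds_zero]
  intro ε hε
  -- Continuity of `φ` at the points of the compact set `f '' K` already gives a modulus that is
  -- uniform along this set.
  have h1 := (hK.image_of_continuousOn hf).uniformContinuousAt_of_continuousAt φ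
    (by rintro _ ⟨y, hy, rfl⟩; exact hφf y hy) (edist_mem_uniformity hε)
  filter_upwards [h _ h1] with i hi
  refine (eLpNorm_exponent_top).trans_le (eLpNormEssSup_le_of_ae_enorm_bound ?_)
  refine (ae_restrict_iff' hK.measurableSet).2 (Filter.Eventually.of_forall fun y hy => ?_)
  have := hi y hy ⟨y, hy, rfl⟩
  rw [← edist_eq_enorm_sub, edist_comm]
  exact le_of_lt this

end ConvLp

variable {n : ℕ} {G : ι → X → Matrix (Fin n) (Fin n) ℝ} {G₀ : X → Matrix (Fin n) (Fin n) ℝ}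
  {dG : ι → X → Fin n → Fin n → Fin n → ℝ} {dG₀ : X → Fin n → Fin n → Fin n → ℝ}
  {ddG : ι → X → Fin n → Fin n → Fin n → Fin n → ℝ} {ddG₀ : X → Fin n → Fin n → Fin n → Fin n → ℝ}

/-- The scalar curvature is continuous in `L^1` as a function of the 2-jet, with the inverse metric
in `L^∞`, first derivatives in `L^2` and second derivatives in `L^1`. -/
lemma convLp_scalarOfJet
    (h0 : ∀ a b, ConvLp l ν ⊤ (fun i x => (G i x)⁻¹ a b) (fun x => (G₀ x)⁻¹ a b))
    (h1 : ∀ k a b, ConvLp l ν 2 (fun i x => dG i x k a b) (fun x => dG₀ x k a b))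
    (h2 : ∀ k m a b, ConvLp l ν 1 (fun i x => ddG i x k m a b) (fun x => ddG₀ x k m a b)) :
    ConvLp l ν 1 (fun i x => scalarOfJet (G i x) (dG i x) (ddG i x))
      (fun x => scalarOfJet (G₀ x) (dG₀ x) (ddG₀ x)) := by
  have : Fact ((1 : ℝ≥0∞) ≤ 2) := ⟨one_le_two⟩
  -- The exponents are those of Hölder: `∞` with `2` gives `2`, `2` with `2` gives `1`, and `∞` with
  -- `1` gives `1`.
  have hΓ : ∀ a b c, ConvLp l ν 2 (fun i x => christoffel (G i x) (dG i x) a b c)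
      (fun x => christoffel (G₀ x) (dG₀ x) a b c) := fun a b c =>
    (ConvLp.sum _ fun m => (h0 a m).mul (((h1 b m c).add (h1 c m b)).sub (h1 m b c))).const_mul _
  have hI : ∀ a b c, ConvLp l ν 2 (fun i x => dInv (G i x) (dG i x) a b c)
      (fun x => dInv (G₀ x) (dG₀ x) a b c) := fun a b c =>
    (ConvLp.sum _ fun d => ConvLp.sum _ fun d' => ((h0 b d).mul (h1 a d d') : ConvLp l ν 2 _ _).mul
      (h0 d' c)).neg
  have hdΓ : ∀ a b c d, ConvLp l ν 1
      (fun i x => dChristoffel (G i x) (dG i x) (ddG i x) a b c d)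
      (fun x => dChristoffel (G₀ x) (dG₀ x) (ddG₀ x) a b c d) := fun a b c d =>
    (ConvLp.sum _ fun m => ((hI a b m).mul (((h1 c m d).add (h1 d m c)).sub (h1 m c d))).add
      ((h0 b m).mul (((h2 a c m d).add (h2 a d m c)).sub (h2 a m c d)))).const_mul _
  have hR : ∀ a b, ConvLp l ν 1 (fun i x => ricci (G i x) (dG i x) (ddG i x) a b)
      (fun x => ricci (G₀ x) (dG₀ x) (ddG₀ x) a b) := fun a b =>
    (ConvLp.sum _ fun c => (hdΓ c c a b).sub (hdΓ b c a c)).add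
      (ConvLp.sum _ fun c => ConvLp.sum _ fun d =>
        ((hΓ c c d).mul (hΓ d a b)).sub ((hΓ c b d).mul (hΓ d a c)))
  exact ConvLp.sum _ fun a => ConvLp.sum _ fun b => (h0 a b).mul (hR a b)

end convergence

/-! ### Convergence of the Lagrangian density in a chart. -/

section families

variable {n : ℕ} {M : Mfld n} {r s : ℕ} {p : ℝ≥0∞}

lemma HasWeakPartial.sub {U : Set (EuclideanSpace ℝ (Fin n))} {i : Fin n}
    {f f' g g' : EuclideanSpace ℝ (Fin n) → ℝ} (hf : HasWeakPartial U i f f')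
    (hg : HasWeakPartial U i g g') : HasWeakPartial U i (f - g) (f' - g') := by
  have := hf.add (hg.const_smul (-1))
  simpa only [neg_smul, one_smul, ← sub_eq_add_neg] using this

lemma IsW2Loc.sub {S T : Tensor2 M} (hS : IsW2Loc p S) (hT : IsW2Loc p T) :
    IsW2Loc p (S - T) := by
  have h : S + (-1 : ℝ) • T = S - T := by
    refine funext fun x => LinearMap.ext₂ fun u v => ?_
    change S x u v + (-1 : ℝ) * T x u v = S x u v - T x u v
    ring
  exact h ▸ hS.add (hT.const_smul (-1))

lemma scalarSobolevNorm_lt_top {U K : Set (EuclideanSpace ℝ (Fin n))} (hU : IsOpen U)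
    {u : EuclideanSpace ℝ (Fin n) → ℝ} (hu : MemW2Loc p U u) (hKU : K ⊆ U) (hK : IsCompact K) :
    scalarSobolevNorm p U K u < ⊤ := by
  have hr : volume.restrict K ≤ volume.restrict U := Measure.restrict_mono hKU le_rfl
  refine ENNReal.add_lt_top.2 ⟨ENNReal.add_lt_top.2 ⟨(hu.1 K hKU hK).2,
    ENNReal.sum_lt_top.2 fun k _ => ?_⟩, ENNReal.sum_lt_top.2 fun k _ =>
    ENNReal.sum_lt_top.2 fun m _ => ?_⟩
  · obtain ⟨f₁, h1, h2, -⟩ := hu.2 k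
    rw [eLpNorm_congr_ae (ae_mono hr (h1.weakPartial_ae_eq hU))]
    exact (h2 K hKU hK).2
  · obtain ⟨f₁, h1, h2, h3⟩ := hu.2 k
    obtain ⟨f₂, h4, h5⟩ := h3 m
    have h6 : weakPartial U m (weakPartial U k u) =ᵐ[volume.restrict U] f₂ :=
      (hu.hasWeakPartial₂ hU k m).ae_unique hU
        (h4.congr_ae hU (h1.weakPartial_ae_eq hU).symm (by rfl))
    rw [eLpNorm_congr_ae (ae_mono hr h6)]
    exact (h5 K hKU hK).2

lemma HasWeakPartial.aestronglyMeasurable {U K : Set (EuclideanSpace ℝ (Fin n))} {i : Fin n}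
    {f f' : EuclideanSpace ℝ (Fin n) → ℝ} (h : HasWeakPartial U i f f') (hKU : K ⊆ U)
    (hK : IsCompact K) : AEStronglyMeasurable f' (volume.restrict K) :=
  (h.2.1.integrableOn_compact_subset hKU hK).1

lemma sobolevNorm_eq (e : M.Chart) (K : Set (EuclideanSpace ℝ (Fin n))) (T : Tensor2 M) :
    sobolevNorm p e K T = ∑ i, ∑ j, scalarSobolevNorm p e.target K (component T e i j) := rfl

lemma scalarSobolevNorm_le_sobolevNorm (e : M.Chart) (K : Set (EuclideanSpace ℝ (Fin n)))
    (T : Tensor2 M) (i j : Fin n) :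
    scalarSobolevNorm p e.target K (component T e i j) ≤ sobolevNorm p e K T := by
  rw [sobolevNorm_eq]
  refine (Finset.single_le_sum (f := fun j => scalarSobolevNorm p e.target K (component T e i j))
    (fun _ _ => zero_le) (Finset.mem_univ j)).trans ?_
  exact Finset.single_le_sum
    (f := fun i => ∑ j, scalarSobolevNorm p e.target K (component T e i j))
    (fun _ _ => zero_le) (Finset.mem_univ i)

lemma component_sub (S T : Tensor2 M) (e : M.Chart) (i j : Fin n) :
    component (S - T) e i j = component S e i j - component T e i j := by
  ext y; simp [component]

variable {ι : Type*} {l : Filter ι}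

/-- Convergence of metrics in the topology of `W^{2,p}_loc`. -/
def SobolevTendsto (l : Filter ι) (G : ι → EHMetric M r s p) (g : EHMetric M r s p) : Prop :=
  ∀ e ∈ M.charts, ∀ K ⊆ e.target, IsCompact K →
    Filter.Tendsto (fun i => sobolevNorm p e K ((G i).toTensor - g.toTensor)) l (𝓝 0)

lemma EHMetric.continuousOn_gramMatrix (g : EHMetric M r s p) {e : M.Chart} (he : e ∈ M.charts) :
    ContinuousOn (gramMatrix g.toTensor e) e.target := by
  refine continuousOn_pi.2 fun i => continuousOn_pi.2 fun j => ?_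
  exact (g.isW2Loc e he i j).1

lemma continuous_sqrt_abs_det :
    Continuous fun A : Matrix (Fin n) (Fin n) ℝ => √|A.det| :=
  Real.continuous_sqrt.comp (continuous_id.matrix_det).abs

lemma EHMetric.aemeasurable_density (g : EHMetric M r s p) {e : M.Chart} (he : e ∈ M.charts) :
    AEMeasurable (density g.toTensor e) (volume.restrict e.target) :=
  (continuous_sqrt_abs_det.comp_continuousOn (g.continuousOn_gramMatrix he)).aemeasurable
    e.open_target.measurableSet

lemma continuousAt_inv_apply {A : Matrix (Fin n) (Fin n) ℝ} (hA : A.det ≠ 0) (a b : Fin n) :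
    ContinuousAt (fun B : Matrix (Fin n) (Fin n) ℝ => B⁻¹ a b) A := by
  have h : ContinuousAt Inv.inv A := continuousAt_matrix_inv A (by
    rw [Ring.inverse_eq_inv']
    exact continuousAt_inv₀ hA)
  exact ((continuous_apply b).comp (continuous_apply a)).continuousAt.comp h

/-- Locally the Lagrangian density depends continuously in `L^1` on the metric. -/
theorem exists_convLp_chart (hn : 2 < n) (hp : (n : ℝ≥0∞) / 2 < p) {e : M.Chart}
    (he : e ∈ M.charts) {y₀ : EuclideanSpace ℝ (Fin n)} (hy₀ : y₀ ∈ e.target) :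
    ∃ K ∈ 𝓝 y₀, IsCompact K ∧ K ⊆ e.target ∧
      ∀ {ι : Type} {l : Filter ι} (G : ι → EHMetric M r s p) (g : EHMetric M r s p),
        SobolevTendsto l G g →
        ConvLp l (volume.restrict K) ⊤ (fun i => density (G i).toTensor e) (density g.toTensor e) ∧
        ConvLp l (volume.restrict K) 1
          (fun i y => density (G i).toTensor e y * chartScalar (G i).toTensor e y)
          (fun y => density g.toTensor e y * chartScalar g.toTensor e y) := by
  obtain ⟨K, hKn, hK, hKU, K', hK'U, hK', C, hC⟩ :=
    exists_local_sobolev (p := p) hn hp e.open_target hy₀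
  refine ⟨K, hKn, hK, hKU, fun {ι l} G g hG => ?_⟩
  have hU := e.open_target
  have hlim : Filter.Tendsto (fun i => C * sobolevNorm p e K' ((G i).toTensor - g.toTensor)) l
      (𝓝 0) := by
    simpa using ENNReal.Tendsto.const_mul (hG e he K' hK'U hK') (Or.inr ENNReal.coe_ne_top)
  have hle : ∀ T : Tensor2 M, ∀ a b, C * scalarSobolevNorm p e.target K' (component T e a b)
      ≤ C * sobolevNorm p e K' T := fun T a b =>
    mul_le_mul_right (scalarSobolevNorm_le_sobolevNorm e K' T a b) _
  have hfin : ∀ (g : EHMetric M r s p) a b,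
      C * scalarSobolevNorm p e.target K' (component g.toTensor e a b) < ⊤ := fun g a b =>
    ENNReal.mul_lt_top ENNReal.coe_lt_top
      (scalarSobolevNorm_lt_top hU (g.isW2Loc e he a b).2 hK'U hK')
  have hdiff : ∀ i, IsW2Loc p ((G i).toTensor - g.toTensor) := fun i => (G i).isW2Loc.sub g.isW2Loc
  -- The supremum bound is applied to the differences of components; uniform convergence of matrices
  -- is that of the entries.
  have hunif : TendstoUniformlyOn (fun i => gramMatrix (G i).toTensor e) (gramMatrix g.toTensor e)
      l K := by
    rw [tendstoUniformlyOn_iff_tendsto, Matrix.uniformity]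
    refine Filter.tendsto_iInf.2 fun a => Filter.tendsto_iInf.2 fun b =>
      Filter.tendsto_comap_iff.2 ?_
    have : TendstoUniformlyOn (fun i => component (G i).toTensor e a b)
        (component g.toTensor e a b) l K := by
      rw [EMetric.tendstoUniformlyOn_iff]
      intro ε hε
      filter_upwards [hlim.eventually_lt_const hε] with i hi y hy
      refine lt_of_le_of_lt ?_ hi
      rw [edist_comm, edist_eq_enorm_sub]
      have := ((hC _ (hdiff i e he a b).1 (hdiff i e he a b).2).1 y hy).trans (hle _ a b)
      rwa [component_sub] at this
    exact tendstoUniformlyOn_iff_tendsto.1 this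
  have h0 : ∀ a b, ConvLp l (volume.restrict K) ⊤ (fun i y => (gramMatrix (G i).toTensor e y)⁻¹ a b)
      (fun y => (gramMatrix g.toTensor e y)⁻¹ a b) := fun a b =>
    ConvLp.comp_of_tendstoUniformlyOn hK (fun i => ((G i).continuousOn_gramMatrix he).mono hKU)
      ((g.continuousOn_gramMatrix he).mono hKU) hunif
      (φ := fun A : Matrix (Fin n) (Fin n) ℝ => A⁻¹ a b)
      (fun i y hy => continuousAt_inv_apply ((G i).det_ne_zero he (hKU hy)) a b)
      (fun y hy => continuousAt_inv_apply (g.det_ne_zero he (hKU hy)) a b)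
  have hd : ConvLp l (volume.restrict K) ⊤ (fun i => density (G i).toTensor e)
      (density g.toTensor e) :=
    ConvLp.comp_of_tendstoUniformlyOn hK (fun i => ((G i).continuousOn_gramMatrix he).mono hKU)
      ((g.continuousOn_gramMatrix he).mono hKU) hunif
      (φ := fun A : Matrix (Fin n) (Fin n) ℝ => √|A.det|)
      (fun i y hy => continuous_sqrt_abs_det.continuousAt)
      (fun y hy => continuous_sqrt_abs_det.continuousAt)
  have hr : volume.restrict K ≤ volume.restrict e.target := Measure.restrict_mono hKU le_rfl
  -- Since `weakPartial` is chosen, it is additive only up to null sets of the chart.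
  have hw : ∀ i k a b, (fun y => weakPartial e.target k (component (G i).toTensor e a b) y
      - weakPartial e.target k (component g.toTensor e a b) y) =ᵐ[volume.restrict e.target]
      weakPartial e.target k (component ((G i).toTensor - g.toTensor) e a b) := fun i k a b => by
    rw [component_sub]
    exact (HasWeakPartial.weakPartial_ae_eq hU (((G i).isW2Loc e he a b).2.hasWeakPartial k |>.sub
      ((g.isW2Loc e he a b).2.hasWeakPartial k))).symm
  have hw2 : ∀ i k m a b,
      (fun y => weakPartial e.target m (weakPartial e.target k (component (G i).toTensor e a b)) y
      - weakPartial e.target m (weakPartial e.target k (component g.toTensor e a b)) y)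
      =ᵐ[volume.restrict e.target]
      weakPartial e.target m (weakPartial e.target k
        (component ((G i).toTensor - g.toTensor) e a b)) := fun i k m a b => by
    refine ((((G i).isW2Loc e he a b).2.hasWeakPartial₂ hU k m).sub
      ((g.isW2Loc e he a b).2.hasWeakPartial₂ hU k m)).ae_unique hU ?_
    exact (((hdiff i) e he a b).2.hasWeakPartial₂ hU k m).congr_ae hU (hw i k a b).symm (by rfl)
  have h1 : ∀ k a b, ConvLp l (volume.restrict K) 2
      (fun i y => weakPartial e.target k (component (G i).toTensor e a b) y)
      (fun y => weakPartial e.target k (component g.toTensor e a b) y) := fun k a b => by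
    have hm : ∀ g : EHMetric M r s p, MemLp (weakPartial e.target k (component g.toTensor e a b)) 2
        (volume.restrict K) := fun g =>
      ⟨((g.isW2Loc e he a b).2.hasWeakPartial k).aestronglyMeasurable hKU hK,
        ((hC _ (g.isW2Loc e he a b).1 (g.isW2Loc e he a b).2).2.1 k).trans_lt (hfin g a b)⟩
    refine ⟨fun i => hm (G i), hm g, ?_⟩
    refine tendsto_of_tendsto_of_tendsto_of_le_of_le tendsto_const_nhds hlim (fun _ => zero_le)
      fun i => ?_
    dsimp only
    rw [eLpNorm_congr_ae (ae_mono hr (hw i k a b))]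
    exact ((hC _ (hdiff i e he a b).1 (hdiff i e he a b).2).2.1 k).trans (hle _ a b)
  have h2 : ∀ m k a b, ConvLp l (volume.restrict K) 1
      (fun i y => weakPartial e.target m (weakPartial e.target k (component (G i).toTensor e a b)) y)
      (fun y => weakPartial e.target m (weakPartial e.target k (component g.toTensor e a b)) y) :=
    fun m k a b => by
    have hm : ∀ g : EHMetric M r s p,
        MemLp (weakPartial e.target m (weakPartial e.target k (component g.toTensor e a b))) 1
        (volume.restrict K) := fun g =>
      ⟨((g.isW2Loc e he a b).2.hasWeakPartial₂ hU k m).aestronglyMeasurable hKU hK,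
        ((hC _ (g.isW2Loc e he a b).1 (g.isW2Loc e he a b).2).2.2 k m).trans_lt (hfin g a b)⟩
    refine ⟨fun i => hm (G i), hm g, ?_⟩
    refine tendsto_of_tendsto_of_tendsto_of_le_of_le tendsto_const_nhds hlim (fun _ => zero_le)
      fun i => ?_
    dsimp only
    rw [eLpNorm_congr_ae (ae_mono hr (hw2 i k m a b))]
    exact ((hC _ (hdiff i e he a b).1 (hdiff i e he a b).2).2.2 k m).trans (hle _ a b)
  exact ⟨hd, hd.mul (convLp_scalarOfJet (X := EuclideanSpace ℝ (Fin n)) h0 h1 h2)⟩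

end families

/-! ### Integrability and continuity over precompact sets. -/

section globalization

variable {n : ℕ} {M : Mfld n} {r s : ℕ} {p : ℝ≥0∞}

lemma isVolumeMeasure_volumeMeasure (g : Tensor2 M) : IsVolumeMeasure g (volumeMeasure g) := by
  rw [volumeMeasure, dif_pos (exists_isVolumeMeasure M g)]
  exact (exists_isVolumeMeasure M g).choose_spec

lemma EHMetric.isScalarCurvature (g : EHMetric M r s p) :
    IsScalarCurvature g.toTensor (scalarCurvature g.toTensor) := by
  rw [scalarCurvature, dif_pos g.exists_isScalarCurvature]
  exact g.exists_isScalarCurvature.choose_spec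

lemma volumeMeasure_restrict (g : Tensor2 M) {e : M.Chart} (he : e ∈ M.charts) {A : Set M}
    (hA : A ⊆ e.source) : (volumeMeasure g).restrict A = (chartMeasure g e).restrict A := by
  rw [← isVolumeMeasure_iff.1 (isVolumeMeasure_volumeMeasure g) e he,
    Measure.restrict_restrict' e.open_source.measurableSet, inter_eq_left.2 hA]

lemma EHMetric.density_mul_ae_eq (g : EHMetric M r s p) {e : M.Chart} (he : e ∈ M.charts)
    (A : Set M) :
    (fun y => density g.toTensor e y * scalarCurvature g.toTensor (e.symm y))
      =ᵐ[volume.restrict (e.target ∩ e.symm ⁻¹' A)]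
      fun y => density g.toTensor e y * chartScalar g.toTensor e y := by
  filter_upwards [ae_restrict_of_ae_restrict_of_subset
    (inter_subset_left (t := e.symm ⁻¹' A)) (g.isScalarCurvature e he)] with y hy
  rw [hy]

/-- The action in a chart. -/
lemma EHMetric.lagrangianIntegral_chart (g : EHMetric M r s p) {e : M.Chart} (he : e ∈ M.charts)
    {A : Set M} (hA : MeasurableSet A) (hAe : A ⊆ e.source) :
    lagrangianIntegral g.toTensor A = ∫ y in e.target ∩ e.symm ⁻¹' A,
      density g.toTensor e y * chartScalar g.toTensor e y := by
  rw [lagrangianIntegral, volumeMeasure_restrict _ he hAe,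
    setIntegral_chartMeasure (g.aemeasurable_density he) hA]
  exact integral_congr_ae (g.density_mul_ae_eq he A)

lemma EHMetric.integrableOn_chart_iff (g : EHMetric M r s p) {e : M.Chart} (he : e ∈ M.charts)
    {A : Set M} (hA : MeasurableSet A) (hAe : A ⊆ e.source) :
    IntegrableOn (scalarCurvature g.toTensor) A (volumeMeasure g.toTensor) ↔
      IntegrableOn (fun y => density g.toTensor e y * chartScalar g.toTensor e y)
        (e.target ∩ e.symm ⁻¹' A) := by
  rw [IntegrableOn, volumeMeasure_restrict _ he hAe, ← IntegrableOn,
    integrableOn_chartMeasure_iff (g.aemeasurable_density he) hA]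
  exact integrable_congr (g.density_mul_ae_eq he A)

/-- With the trivial filter the convergence theorem applies to a single metric and yields the
integrability statements it contains. -/
lemma EHMetric.sobolevTendsto_bot (g : EHMetric M r s p) :
    SobolevTendsto (⊥ : Filter Unit) (fun _ => g) g := fun _ _ _ _ _ => Filter.tendsto_bot

/-- Every point has a neighbourhood on whose subsets curvature and volume are integrable and the
action is continuous. -/
lemma exists_nhds_action (hn : 2 < n) (hp : (n : ℝ≥0∞) / 2 < p) (x : M) :
    ∃ V ∈ 𝓝 x, MeasurableSet V ∧
      (∀ g : EHMetric M r s p,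
        IntegrableOn (scalarCurvature g.toTensor) V (volumeMeasure g.toTensor) ∧
          volumeMeasure g.toTensor V < ⊤) ∧
      ∀ {ι : Type} {l : Filter ι} (G : ι → EHMetric M r s p) (g : EHMetric M r s p),
        SobolevTendsto l G g → ∀ A ⊆ V, MeasurableSet A →
        Filter.Tendsto (fun i => lagrangianIntegral (G i).toTensor A) l
          (𝓝 (lagrangianIntegral g.toTensor A)) := by
  set e := chartAt (EuclideanSpace ℝ (Fin n)) x with he
  have hee : e ∈ M.charts := chart_mem_atlas _ x
  have hx : x ∈ e.source := mem_chart_source _ x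
  obtain ⟨K, hKn, hK, hKU, hconv⟩ := exists_convLp_chart (r := r) (s := s) hn hp hee
    (e.map_source hx)
  have hVK : e.symm '' K = e.source ∩ e ⁻¹' K := e.symm_image_eq_source_inter_preimage hKU
  have hVm : MeasurableSet (e.symm '' K) :=
    (hK.image_of_continuousOn (e.continuousOn_symm.mono hKU)).measurableSet
  have hVs : e.symm '' K ⊆ e.source := hVK ▸ inter_subset_left
  have hsub : ∀ A ⊆ e.symm '' K, e.target ∩ e.symm ⁻¹' A ⊆ K := fun A hA y hy => by
    obtain ⟨z, hz, hzy⟩ := hA hy.2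
    have := congrArg e hzy
    rw [e.right_inv (hKU hz), e.right_inv hy.1] at this
    exact this ▸ hz
  refine ⟨e.symm '' K, ?_, hVm, fun g => ?_, fun {ι l} G g hG A hA hAm => ?_⟩
  · rw [hVK]
    exact Filter.inter_mem (e.open_source.mem_nhds hx) ((e.continuousAt hx).preimage_mem_nhds hKn)
  · obtain ⟨h1, h2⟩ := hconv _ g g.sobolevTendsto_bot
    refine ⟨(g.integrableOn_chart_iff hee hVm hVs).2 ?_, ?_⟩
    · exact IntegrableOn.mono_set (memLp_one_iff_integrable.1 h2.memLp_lim) (hsub _ subset_rfl)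
    · rw [isVolumeMeasure_volumeMeasure g.toTensor e hee _ hVs hVm]
      refine (lintegral_mono_set (hsub _ subset_rfl)).trans_lt ?_
      have : IsFiniteMeasure (volume.restrict K) := ⟨by simpa using hK.measure_lt_top⟩
      have h3 : Integrable (density g.toTensor e) (volume.restrict K) :=
        h1.memLp_lim.integrable le_top
      refine lt_of_le_of_lt (lintegral_mono fun y => ?_) h3.2
      exact (ofReal_norm (density g.toTensor e y)) ▸ ENNReal.ofReal_le_ofReal (le_abs_self _)
  · obtain ⟨h1, h2⟩ := hconv G g hG
    have hAs := hA.trans hVs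
    have hm := measurableSet_target_inter e hAm
    have := tendsto_setIntegral_of_L1' _ h2.memLp_lim.1
      (Filter.Eventually.of_forall fun i => memLp_one_iff_integrable.1 (h2.memLp i)) h2.tendsto
      (e.target ∩ e.symm ⁻¹' A)
    simp only [Measure.restrict_restrict hm, inter_eq_left.2 (hsub A hA)] at this
    simpa only [fun g : EHMetric M r s p => g.lagrangianIntegral_chart hee hAm hAs] using this

theorem EHMetric.integrableOn_scalarCurvature (hn : 2 < n) (hp : (n : ℝ≥0∞) / 2 < p)
    (g : EHMetric M r s p) {S : Set M} (hS : IsCompact S) :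
    IntegrableOn (scalarCurvature g.toTensor) S (volumeMeasure g.toTensor) :=
  LocallyIntegrableOn.integrableOn_isCompact (fun x _ => by
    obtain ⟨V, hV, -, h, -⟩ := exists_nhds_action (r := r) (s := s) hn hp x
    exact ⟨V, nhdsWithin_le_nhds hV, (h g).1⟩) hS

theorem EHMetric.volumeMeasure_lt_top (hn : 2 < n) (hp : (n : ℝ≥0∞) / 2 < p)
    (g : EHMetric M r s p) {S : Set M} (hS : IsCompact S) : volumeMeasure g.toTensor S < ⊤ :=
  hS.measure_lt_top_of_nhdsWithin fun x _ => by
    obtain ⟨V, hV, -, h, -⟩ := exists_nhds_action (r := r) (s := s) hn hp x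
    exact ⟨V, nhdsWithin_le_nhds hV, (h g).2⟩

/-- The action over a precompact set is a continuous function of the metric. -/
theorem tendsto_lagrangianIntegral (hn : 2 < n) (hp : (n : ℝ≥0∞) / 2 < p) {ι : Type}
    {l : Filter ι} {G : ι → EHMetric M r s p} {g : EHMetric M r s p} (hG : SobolevTendsto l G g)
    {S A : Set M} (hS : IsCompact S) (hA : MeasurableSet A) (hAS : A ⊆ S) :
    Filter.Tendsto (fun i => lagrangianIntegral (G i).toTensor A) l
      (𝓝 (lagrangianIntegral g.toTensor A)) := by
  -- The statement for induction over compact sets concerns all measurable subsets of a measurable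
  -- set `V`. This makes it stable under unions: `A` is cut into `A ∩ V` and `A \ V`, and each piece
  -- lies in one of the two sets.
  suffices h : ∃ V, S ⊆ V ∧ MeasurableSet V ∧ (∀ g : EHMetric M r s p,
      IntegrableOn (scalarCurvature g.toTensor) V (volumeMeasure g.toTensor)) ∧
      ∀ A ⊆ V, MeasurableSet A → Filter.Tendsto (fun i => lagrangianIntegral (G i).toTensor A) l
        (𝓝 (lagrangianIntegral g.toTensor A)) by
    obtain ⟨V, hSV, -, -, h⟩ := h
    exact h A (hAS.trans hSV) hA
  refine hS.induction_on (p := fun S => ∃ V, S ⊆ V ∧ MeasurableSet V ∧ (∀ g : EHMetric M r s p,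
      IntegrableOn (scalarCurvature g.toTensor) V (volumeMeasure g.toTensor)) ∧
      ∀ A ⊆ V, MeasurableSet A → Filter.Tendsto (fun i => lagrangianIntegral (G i).toTensor A) l
        (𝓝 (lagrangianIntegral g.toTensor A))) ?_ ?_ ?_ ?_
  · refine ⟨∅, subset_rfl, MeasurableSet.empty, fun g => integrableOn_empty, fun A hA _ => ?_⟩
    rw [subset_empty_iff.1 hA]
    simpa [lagrangianIntegral] using tendsto_const_nhds
  · rintro S T hST ⟨V, hTV, h⟩
    exact ⟨V, hST.trans hTV, h⟩
  · rintro S T ⟨V, hSV, hV, hVi, hVt⟩ ⟨W, hTW, hW, hWi, hWt⟩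
    refine ⟨V ∪ W, union_subset_union hSV hTW, hV.union hW, fun g => (hVi g).union (hWi g),
      fun A hA hAm => ?_⟩
    have hA2 : A \ V ⊆ W := fun x hx => (hA hx.1).resolve_left hx.2
    have h1 : ∀ g : EHMetric M r s p, lagrangianIntegral g.toTensor A
        = lagrangianIntegral g.toTensor (A ∩ V) + lagrangianIntegral g.toTensor (A \ V) := fun g =>
      (integral_inter_add_sdiff hV (((hVi g).union (hWi g)).mono_set hA)).symm
    simp only [h1]
    exact (hVt _ inter_subset_right (hAm.inter hV)).add (hWt _ hA2 (hAm.diff hV))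
  · intro x _
    obtain ⟨V, hV, hVm, h1, h2⟩ := exists_nhds_action (r := r) (s := s) hn hp x
    exact ⟨V, nhdsWithin_le_nhds hV, V, subset_rfl, hVm, fun g => (h1 g).1, h2 G g hG⟩

/-- Even for the zero field the chosen weak derivatives are known to vanish only almost everywhere.
-/
lemma sobolevNorm_zero {e : M.Chart} {K : Set (EuclideanSpace ℝ (Fin n))} (hK : K ⊆ e.target) :
    sobolevNorm p e K (0 : Tensor2 M) = 0 := by
  have hU := e.open_target
  have hr : volume.restrict K ≤ volume.restrict e.target := Measure.restrict_mono hK le_rfl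
  have h0 : ∀ i j, component (0 : Tensor2 M) e i j = 0 := fun i j => by ext y; simp [component]
  have hw : ∀ k, HasWeakPartial e.target k (0 : EuclideanSpace ℝ (Fin n) → ℝ) 0 :=
    fun k => hasWeakPartial_const hU 0
  have h1 : ∀ k, weakPartial e.target k (0 : EuclideanSpace ℝ (Fin n) → ℝ)
      =ᵐ[volume.restrict e.target] 0 := fun k => (hw k).weakPartial_ae_eq hU
  have h2 : ∀ k m, weakPartial e.target m (weakPartial e.target k
      (0 : EuclideanSpace ℝ (Fin n) → ℝ)) =ᵐ[volume.restrict e.target] 0 := fun k m =>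
    ((hw m).congr_ae hU (h1 k).symm (by rfl)).weakPartial_ae_eq hU
  simp only [sobolevNorm, h0, eLpNorm_congr_ae (ae_mono hr (h1 _)),
    eLpNorm_congr_ae (ae_mono hr (h2 _ _)), eLpNorm_zero, Finset.sum_const_zero, add_zero]

/-- The varied metric depends continuously on the variation. -/
lemma Config.sobolevTendsto_varied (c : Config n r s p) (h₀ : c.Variation) :
    SobolevTendsto (𝓝 h₀) c.varied (c.varied h₀) := by
  intro e he K hK hKc
  have hsub : ∀ h : c.Variation, (c.varied h).toTensor - (c.varied h₀).toTensor
      = h.1.toTensor - h₀.1.toTensor := fun h => by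
    refine funext fun x => LinearMap.ext₂ fun u v => ?_
    change (c.g.toTensor x u v + h.1.toTensor x u v) - (c.g.toTensor x u v + h₀.1.toTensor x u v)
      = h.1.toTensor x u v - h₀.1.toTensor x u v
    ring
  simp only [hsub]
  rw [ENNReal.tendsto_nhds_zero]
  intro δ hδ
  -- The topology is generated by balls about arbitrary centres, so this set is open by definition.
  have ho : IsOpen {h : SymVar c.M p c.Ω | sobolevNorm p e K (h.toTensor - h₀.1.toTensor) < δ} :=
    TopologicalSpace.isOpen_generateFrom_of_mem ⟨h₀.1, e, he, K, hK, hKc, δ, hδ, rfl⟩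
  have hmem : h₀.1 ∈ {h : SymVar c.M p c.Ω |
      sobolevNorm p e K (h.toTensor - h₀.1.toTensor) < δ} := by
    have h0 : h₀.1.toTensor - h₀.1.toTensor = 0 :=
      funext fun x => LinearMap.ext₂ fun u v => sub_self (h₀.1.toTensor x u v)
    rw [mem_ofPred_eq, h0, sobolevNorm_zero hK]
    exact hδ
  have hcont : Continuous (fun h : c.Variation => h.1) := continuous_subtype_val
  filter_upwards [(ho.preimage hcont).mem_nhds hmem] with h hh using le_of_lt hh

theorem Config.continuous_lagrangianIntegral_varied (hn : 2 < n) (hp : (n : ℝ≥0∞) / 2 < p)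
    (c : Config n r s p) :
    Continuous fun h : c.Variation => lagrangianIntegral (c.varied h).toTensor c.Ω :=
  continuous_iff_continuousAt.2 fun h₀ => tendsto_lagrangianIntegral hn hp
    (c.sobolevTendsto_varied h₀) c.isCompact_closure c.isOpen.measurableSet subset_closure

end globalization

/-! ## Disjoint unions and rescalings -/

section operations

variable {n : ℕ} {M M' N : Mfld n} {r s : ℕ} {p : ℝ≥0∞}

lemma gramMatrix_congr {g : Tensor2 M} {h : Tensor2 N} {e : M.Chart} {f : N.Chart}
    (hc : ∀ i j, EqOn (component g e i j) (component h f i j) e.target) :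
    EqOn (gramMatrix g e) (gramMatrix h f) e.target := fun y hy => by
  ext i j
  exact hc i j hy

/-- Only the components on the common target enter, and `weakPartial_congr` turns this into equality
at every point of it. -/
lemma chartScalar_congr {g : Tensor2 M} {h : Tensor2 N} {e : M.Chart} {f : N.Chart}
    (ht : e.target = f.target)
    (hc : ∀ i j, EqOn (component g e i j) (component h f i j) e.target) :
    EqOn (chartScalar g e) (chartScalar h f) e.target := fun y hy => by
  have h1 : ∀ k i j, weakPartial e.target k (component g e i j)
      = weakPartial f.target k (component h f i j) := fun k i j => by
    rw [← ht]
    exact weakPartial_congr e.open_target ((ae_restrict_iff' e.open_target.measurableSet).2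
      (Filter.Eventually.of_forall (hc i j)))
  simp only [chartScalar, gramMatrix_congr hc hy, h1]
  rw [ht]

/-- The inclusion of `M` in `M ⊔ M'`. -/
def Mfld.inl (M M' : Mfld n) (x : M) : M.sum M' := (Sum.inl x : M.carrier ⊕ M'.carrier)

/-- The inclusion of `M'` in `M ⊔ M'`. -/
def Mfld.inr (M M' : Mfld n) (x : M') : M.sum M' := (Sum.inr x : M.carrier ⊕ M'.carrier)

/-- The function on `M ⊔ M'` that is given by functions on `M` and `M'`. -/
def Mfld.sumElim {M M' : Mfld n} (R : M → ℝ) (R' : M' → ℝ) : M.sum M' → ℝ :=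
  fun x : M.carrier ⊕ M'.carrier => Sum.elim R R' x

/-- A chart of `M` as a chart of `M ⊔ M'`. -/
def Mfld.chartInl (M' : Mfld n) (f : M.Chart) : (M.sum M').Chart :=
  f.lift_openEmbedding (IsOpenEmbedding.inl : IsOpenEmbedding
    (Sum.inl : M.carrier → M.carrier ⊕ M'.carrier))

/-- A chart of `M'` as a chart of `M ⊔ M'`. -/
def Mfld.chartInr (M : Mfld n) (f : M'.Chart) : (M.sum M').Chart :=
  f.lift_openEmbedding (IsOpenEmbedding.inr : IsOpenEmbedding
    (Sum.inr : M'.carrier → M.carrier ⊕ M'.carrier))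

lemma Mfld.mem_charts_sum {e : (M.sum M').Chart} (he : e ∈ (M.sum M').charts) :
    (∃ f ∈ M.charts, e = Mfld.chartInl M' f) ∨ ∃ f ∈ M'.charts, e = Mfld.chartInr M f :=
  ChartedSpace.mem_atlas_sum (M := M.carrier) (M' := M'.carrier) he

lemma Mfld.isOpenEmbedding_inl : IsOpenEmbedding (Mfld.inl M M') :=
  (IsOpenEmbedding.inl : IsOpenEmbedding (Sum.inl : M.carrier → M.carrier ⊕ M'.carrier))

lemma Mfld.isOpenEmbedding_inr : IsOpenEmbedding (Mfld.inr M M') :=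
  (IsOpenEmbedding.inr : IsOpenEmbedding (Sum.inr : M'.carrier → M.carrier ⊕ M'.carrier))

lemma Mfld.inl_injective : Function.Injective (Mfld.inl M M') := Mfld.isOpenEmbedding_inl.injective

lemma Mfld.inr_injective : Function.Injective (Mfld.inr M M') := Mfld.isOpenEmbedding_inr.injective

lemma Mfld.inl_ne_inr (x : M) (y : M') : Mfld.inl M M' x ≠ Mfld.inr M M' y := Sum.inl_ne_inr

lemma Mfld.chartInl_target (f : M.Chart) : (Mfld.chartInl M' f).target = f.target := rfl

lemma Mfld.chartInr_target (f : M'.Chart) : (Mfld.chartInr M f).target = f.target := rfl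

lemma Mfld.chartInl_source (f : M.Chart) :
    (Mfld.chartInl M' f).source = Mfld.inl M M' '' f.source := rfl

lemma Mfld.chartInr_source (f : M'.Chart) :
    (Mfld.chartInr M f).source = Mfld.inr M M' '' f.source := rfl

lemma component_chartInl (g : Tensor2 M) (g' : Tensor2 M') {f : M.Chart} (hf : f ∈ M.charts)
    (i j : Fin n) : EqOn (component (M := M.sum M') (sumTensor g g') (Mfld.chartInl M' f) i j)
      (component g f i j) (Mfld.chartInl M' f).target :=
  (component_sum_inl g g' hf i j).symm

lemma component_chartInr (g : Tensor2 M) (g' : Tensor2 M') {f : M'.Chart} (hf : f ∈ M'.charts)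
    (i j : Fin n) : EqOn (component (M := M.sum M') (sumTensor g g') (Mfld.chartInr M f) i j)
      (component g' f i j) (Mfld.chartInr M f).target :=
  (component_sum_inr g g' hf i j).symm

/-- The atlas of a disjoint union consists of the charts of the two summands, so the condition is
that for `M` together with that for `M'`; likewise for the volume in `IsVolumeMeasure.sum`. -/
lemma IsScalarCurvature.sum {g : Tensor2 M} {g' : Tensor2 M'} {R : M → ℝ} {R' : M' → ℝ}
    (h : IsScalarCurvature g R) (h' : IsScalarCurvature g' R') :
    IsScalarCurvature (M := M.sum M') (sumTensor g g') (Mfld.sumElim R R') := by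
  intro e he
  obtain ⟨f, hf, rfl⟩ | ⟨f, hf, rfl⟩ := Mfld.mem_charts_sum he
  · rw [Mfld.chartInl_target]
    filter_upwards [h f hf, ae_restrict_mem f.open_target.measurableSet] with y hy hyt
    rw [chartScalar_congr (Mfld.chartInl_target f) (component_chartInl g g' hf) hyt, ← hy]
    rfl
  · rw [Mfld.chartInr_target]
    filter_upwards [h' f hf, ae_restrict_mem f.open_target.measurableSet] with y hy hyt
    rw [chartScalar_congr (Mfld.chartInr_target f) (component_chartInr g g' hf) hyt, ← hy]
    rfl

lemma IsVolumeMeasure.sum {g : Tensor2 M} {g' : Tensor2 M'} {μ : Measure M} {μ' : Measure M'}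
    (h : IsVolumeMeasure g μ) (h' : IsVolumeMeasure g' μ') :
    IsVolumeMeasure (M := M.sum M') (sumTensor g g')
      (μ.map (Mfld.inl M M') + μ'.map (Mfld.inr M M')) := by
  intro e he A hA hm
  have ml := (Mfld.isOpenEmbedding_inl (M := M) (M' := M')).measurableEmbedding
  have mr := (Mfld.isOpenEmbedding_inr (M := M) (M' := M')).measurableEmbedding
  rw [Measure.add_apply, ml.map_apply, mr.map_apply]
  obtain ⟨f, hf, rfl⟩ | ⟨f, hf, rfl⟩ := Mfld.mem_charts_sum he
  · rw [Mfld.chartInl_source] at hA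
    have h1 : Mfld.inr M M' ⁻¹' A = ∅ := by
      refine eq_empty_of_forall_notMem fun x hx => ?_
      obtain ⟨z, -, hz⟩ := hA hx
      exact Mfld.inl_ne_inr _ _ hz
    have h2 : Mfld.inl M M' ⁻¹' A ⊆ f.source := fun x hx => by
      obtain ⟨z, hz, hzx⟩ := hA hx
      exact Mfld.inl_injective hzx ▸ hz
    have h3 := ml.measurable hm
    rw [h1, measure_empty, add_zero, h f hf _ h2 h3]
    refine setLIntegral_congr_fun (measurableSet_target_inter f h3) fun y hy => ?_
    rw [gramMatrix_congr (component_chartInl g g' hf) hy.1]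
  · rw [Mfld.chartInr_source] at hA
    have h1 : Mfld.inl M M' ⁻¹' A = ∅ := by
      refine eq_empty_of_forall_notMem fun x hx => ?_
      obtain ⟨z, -, hz⟩ := hA hx
      exact Mfld.inl_ne_inr _ _ hz.symm
    have h2 : Mfld.inr M M' ⁻¹' A ⊆ f.source := fun x hx => by
      obtain ⟨z, hz, hzx⟩ := hA hx
      exact Mfld.inr_injective hzx ▸ hz
    have h3 := mr.measurable hm
    rw [h1, measure_empty, zero_add, h' f hf _ h2 h3]
    refine setLIntegral_congr_fun (measurableSet_target_inter f h3) fun y hy => ?_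
    rw [gramMatrix_congr (component_chartInr g g' hf) hy.1]

/-- The action is additive under disjoint unions. -/
lemma lagrangianIntegral_sum (hn : 2 < n) (hp : (n : ℝ≥0∞) / 2 < p) [CompactSpace M']
    (g : EHMetric M r s p) (g' : EHMetric M' r s p) {Ω : Set M} (hc : IsCompact (closure Ω)) :
    lagrangianIntegral (g.sum g').toTensor (Mfld.inl M M' '' Ω ∪ range (Mfld.inr M M'))
      = lagrangianIntegral g.toTensor Ω + lagrangianIntegral g'.toTensor univ := by
  have ml := (Mfld.isOpenEmbedding_inl (M := M) (M' := M')).measurableEmbedding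
  have mr := (Mfld.isOpenEmbedding_inr (M := M) (M' := M')).measurableEmbedding
  have hμ := (isVolumeMeasure_volumeMeasure g.toTensor).sum
    (isVolumeMeasure_volumeMeasure g'.toTensor)
  have hR := g.isScalarCurvature.sum g'.isScalarCurvature
  have h1 : Mfld.inl M M' ⁻¹' (Mfld.inl M M' '' Ω ∪ range (Mfld.inr M M')) = Ω := by
    ext x
    constructor
    · rintro (⟨z, hz, hzx⟩ | ⟨z, hzx⟩)
      · exact Mfld.inl_injective hzx ▸ hz
      · exact (Mfld.inl_ne_inr _ _ hzx.symm).elim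
    · exact fun hx => Or.inl ⟨x, hx, rfl⟩
  have h2 : Mfld.inr M M' ⁻¹' (Mfld.inl M M' '' Ω ∪ range (Mfld.inr M M')) = univ :=
    eq_univ_of_forall fun x => Or.inr ⟨x, rfl⟩
  -- Splitting an integral over a sum of measures needs integrability on both parts. It comes from
  -- the compactness of `closure Ω` and of `M'`.
  have i1 : IntegrableOn (scalarCurvature g.toTensor) Ω (volumeMeasure g.toTensor) :=
    (g.integrableOn_scalarCurvature hn hp hc).mono_set subset_closure
  have i2 : IntegrableOn (scalarCurvature g'.toTensor) univ (volumeMeasure g'.toTensor) :=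
    g'.integrableOn_scalarCurvature hn hp isCompact_univ
  refine (lagrangianIntegral_eq hμ hR _).trans ?_
  rw [Measure.restrict_add, integral_add_measure, ml.setIntegral_map, mr.setIntegral_map, h1, h2]
  · rfl
  · exact ml.integrableOn_map_iff.2 (h1.symm ▸ i1)
  · exact mr.integrableOn_map_iff.2 (h2.symm ▸ i2)

lemma component_smul (c : ℝ) (g : Tensor2 M) (e : M.Chart) (i j : Fin n) :
    component (c • g) e i j = c • component g e i j := by
  ext y; simp [component]

lemma gramMatrix_smul (c : ℝ) (g : Tensor2 M) (e : M.Chart) (y : EuclideanSpace ℝ (Fin n)) :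
    gramMatrix (c • g) e y = c • gramMatrix g e y := by
  ext i j
  simp [gramMatrix, component_smul]

/-- The whole 2-jet is multiplied by `ε`, up to null sets, and `scalarOfJet_smul` applies. -/
lemma EHMetric.isScalarCurvature_smul (g : EHMetric M r s p) {ε : ℝ} (hε : 0 < ε) :
    IsScalarCurvature (ε • g.toTensor) fun x => ε⁻¹ * scalarCurvature g.toTensor x := by
  intro e he
  have hU := e.open_target
  have h1 : ∀ k i j, weakPartial e.target k (component (ε • g.toTensor) e i j)
      =ᵐ[volume.restrict e.target] ε • weakPartial e.target k (component g.toTensor e i j) :=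
    fun k i j => by
      rw [component_smul]
      exact (((g.isW2Loc e he i j).2.hasWeakPartial k).const_smul ε).weakPartial_ae_eq hU
  have h2 : ∀ k m i j, weakPartial e.target k
      (weakPartial e.target m (component (ε • g.toTensor) e i j)) =ᵐ[volume.restrict e.target]
      ε • weakPartial e.target k (weakPartial e.target m (component g.toTensor e i j)) :=
    fun k m i j => by
      rw [weakPartial_congr hU (h1 m i j)]
      exact (((g.isW2Loc e he i j).2.hasWeakPartial₂ hU m k).const_smul ε).weakPartial_ae_eq hU
  filter_upwards [g.isScalarCurvature e he,
    ae_all_iff.2 fun k => ae_all_iff.2 fun i => ae_all_iff.2 fun j => h1 k i j,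
    ae_all_iff.2 fun k => ae_all_iff.2 fun m => ae_all_iff.2 fun i => ae_all_iff.2 fun j =>
      h2 k m i j] with y hy hy1 hy2
  rw [hy, chartScalar, chartScalar, ← scalarOfJet_smul hε.ne', gramMatrix_smul]
  simp only [hy1, hy2, Pi.smul_apply, smul_eq_mul]

lemma IsVolumeMeasure.smul {g : Tensor2 M} {μ : Measure M} (h : IsVolumeMeasure g μ) {ε : ℝ}
    (hε : 0 < ε) : IsVolumeMeasure (ε • g) (ENNReal.ofReal (√(ε ^ n)) • μ) := by
  intro e he A hA hm
  rw [Measure.smul_apply, h e he A hA hm, smul_eq_mul,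
    ← lintegral_const_mul' _ _ ENNReal.ofReal_ne_top]
  refine lintegral_congr fun y => ?_
  rw [gramMatrix_smul, Matrix.det_smul, Fintype.card_fin, abs_mul, Real.sqrt_mul (abs_nonneg _),
    abs_of_pos (pow_pos hε n), ENNReal.ofReal_mul (Real.sqrt_nonneg _)]

/-- The behaviour of the action under rescaling of the metric. -/
lemma EHMetric.lagrangianIntegral_scale (hn : 2 ≤ n) (g : EHMetric M r s p) {ε : ℝ} (hε : 0 < ε)
    (Ω : Set M) : lagrangianIntegral (g.scale ε hε).toTensor Ω
      = √(ε ^ (n - 2)) * lagrangianIntegral g.toTensor Ω := by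
  have hμ := (isVolumeMeasure_volumeMeasure g.toTensor).smul hε
  refine (lagrangianIntegral_eq hμ (g.isScalarCurvature_smul hε) Ω).trans ?_
  rw [Measure.restrict_smul, integral_smul_measure, integral_const_mul,
    ENNReal.toReal_ofReal (Real.sqrt_nonneg _), smul_eq_mul, ← mul_assoc]
  congr 1
  -- The factors `√(ε ^ n)` of the volume and `ε⁻¹` of the curvature combine to `√(ε ^ (n - 2))`.
  have : ε ^ n = ε ^ 2 * ε ^ (n - 2) := by rw [← pow_add]; congr 1; omega
  rw [this, Real.sqrt_mul (by positivity), Real.sqrt_sq hε.le]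
  field_simp

/-- The action along a deformation map. -/
theorem action_deformation (hn : 2 < n) (hp : (n : ℝ≥0∞) / 2 < p) (c : Config n r s p)
    (M' : Mfld n) [CompactSpace M'] (g' : EHMetric M' r s p) (x : c.Variation × ℝ≥0) :
    action (deformation c M' g' x) = lagrangianIntegral (c.varied x.1).toTensor c.Ω
      + √((x.2 : ℝ) ^ (n - 2)) * lagrangianIntegral g'.toTensor univ := by
  by_cases hε : x.2 = 0
  · rw [deformation, dif_pos hε, hε, NNReal.coe_zero, zero_pow (by omega), Real.sqrt_zero, zero_mul,
      add_zero]
    rfl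
  · have h0 : 0 < (x.2 : ℝ) := NNReal.coe_pos.2 (pos_iff_ne_zero.2 hε)
    rw [deformation, dif_neg hε, ← g'.lagrangianIntegral_scale hn.le h0]
    exact lagrangianIntegral_sum hn hp _ _ c.isCompact_closure

/-- The action is continuous for the topology `τ₁`. -/
theorem continuous_action (hn : 2 < n) (hp : (n : ℝ≥0∞) / 2 < p) :
    @Continuous (Config n r s p) ℝ tau1 inferInstance action := by
  refine continuous_iSup_dom.2 fun c => continuous_iSup_dom.2 fun M' => continuous_iSup_dom.2
    fun hM' => continuous_iSup_dom.2 fun g' => continuous_coinduced_dom.2 ?_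
  have : action ∘ deformation c M' g' = fun x => lagrangianIntegral (c.varied x.1).toTensor c.Ω
      + √((x.2 : ℝ) ^ (n - 2)) * lagrangianIntegral g'.toTensor univ :=
    funext (action_deformation hn hp c M' g')
  rw [this]
  exact ((c.continuous_lagrangianIntegral_varied hn hp).comp continuous_fst).add
    ((Real.continuous_sqrt.comp ((NNReal.continuous_coe.comp continuous_snd).pow _)).mul
      continuous_const)

/-- The action of `(M, g; Ω)` is a constant summand, so the derivative depends on `(M', g')` only.
On `[0, ∞)` the truncation `toNNReal` has no effect. -/
lemma hasTopologicalDeriv_action_iff (hn : 2 < n) (hp : (n : ℝ≥0∞) / 2 < p) (c : Config n r s p)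
    (M' : Mfld n) [CompactSpace M'] (g' : EHMetric M' r s p) (L : ℝ) :
    HasTopologicalDeriv action c M' g' L ↔
      HasDerivWithinAt (fun ε => √(ε ^ (n - 2)) * lagrangianIntegral g'.toTensor univ) L
        (Ici 0) 0 := by
  unfold HasTopologicalDeriv
  set S := lagrangianIntegral (c.varied 0).toTensor c.Ω with hS
  have h : EqOn (fun ε : ℝ => action (deformation c M' g' (0, ε.toNNReal)))
      (fun ε => S + √(ε ^ (n - 2)) * lagrangianIntegral g'.toTensor univ) (Ici 0) := fun ε hε => by
    dsimp only
    rw [action_deformation hn hp, Real.coe_toNNReal _ hε]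
  constructor
  · intro hd
    exact (hasDerivWithinAt_const_add_iff S).1 (hd.congr_of_mem (fun x hx => (h hx).symm)
      self_mem_Ici)
  · intro hd
    exact ((hasDerivWithinAt_const_add_iff S).2 hd).congr_of_mem h self_mem_Ici

/-- The mean scalar curvature of a closed manifold vanishes if and only if the action does. -/
lemma EHMetric.meanScalarCurvature_eq_zero_iff (hn : 2 < n) (hp : (n : ℝ≥0∞) / 2 < p)
    [CompactSpace M] (g : EHMetric M r s p) :
    meanScalarCurvature g.toTensor = 0 ↔ lagrangianIntegral g.toTensor univ = 0 := by
  have hfin := g.volumeMeasure_lt_top hn hp isCompact_univ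
  rw [meanScalarCurvature, average_eq, smul_eq_zero, lagrangianIntegral, Measure.restrict_univ,
    inv_eq_zero, measureReal_eq_zero_iff hfin.ne, Measure.measure_univ_eq_zero]
  -- The average is the integral divided by the volume, with `1 / 0 = 0`; if the volume is zero, the
  -- integral vanishes as well.
  refine ⟨fun h => h.elim (fun h => ?_) id, Or.inr⟩
  rw [h, integral_zero_measure]

/-- On `[0, ∞)` the root of `ε ^ 2` is `ε`. This is `n - 2 = 2`. -/
lemma hasDerivWithinAt_sqrt_pow_four (L : ℝ) :
    HasDerivWithinAt (fun ε : ℝ => √(ε ^ 2) * L) L (Ici 0) 0 := by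
  have h : HasDerivWithinAt (fun ε : ℝ => ε * L) L (Ici 0) 0 := by
    simpa using ((hasDerivAt_id (0 : ℝ)).mul_const L).hasDerivWithinAt
  exact h.congr_of_mem (fun ε hε => by rw [Real.sqrt_sq hε]) self_mem_Ici

/-- One factor `ε` is split off; the difference quotient is then `√(ε ^ (m - 2)) L`, which tends to
`0`. -/
lemma hasDerivWithinAt_sqrt_pow_of_lt {m : ℕ} (hm : 2 < m) (L : ℝ) :
    HasDerivWithinAt (fun ε : ℝ => √(ε ^ m) * L) 0 (Ici 0) 0 := by
  have h : HasDerivWithinAt (fun ε : ℝ => ε * (√(ε ^ (m - 2)) * L)) 0 (Ici 0) 0 := by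
    have hc : Continuous fun ε : ℝ => √(ε ^ (m - 2)) * L := by fun_prop
    rw [hasDerivWithinAt_iff_tendsto_slope]
    refine ((hc.tendsto 0).mono_left nhdsWithin_le_nhds).congr' ?_ |>.trans ?_
    · filter_upwards [self_mem_nhdsWithin] with ε hε
      have h0 : ε ≠ 0 := hε.2
      rw [slope_def_field]
      field_simp
      simp only [zero_mul, sub_zero]
      ring
    · rw [zero_pow (by omega), Real.sqrt_zero, zero_mul]
  refine h.congr_of_mem (fun ε hε => ?_) self_mem_Ici
  have : ε ^ m = ε ^ 2 * ε ^ (m - 2) := by rw [← pow_add]; congr 1; omega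
  rw [this, Real.sqrt_mul (by positivity), Real.sqrt_sq hε, mul_assoc]

/-- The difference quotient is `L / √ε`. Multiplied by `√ε` it is the constant `L`, while it would
tend to `0` if the quotient converged. -/
lemma eq_zero_of_hasDerivWithinAt_sqrt {L L' : ℝ}
    (h : HasDerivWithinAt (fun ε : ℝ => √(ε ^ 1) * L) L' (Ici 0) 0) : L = 0 := by
  have h1 := hasDerivWithinAt_iff_tendsto_slope.1 h
  rw [Ici_sdiff_left] at h1
  have h2 : Filter.Tendsto (fun ε : ℝ => √ε) (𝓝[>] 0) (𝓝 0) := by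
    simpa using (Real.continuous_sqrt.tendsto 0).mono_left nhdsWithin_le_nhds
  have h3 := h2.mul h1
  rw [zero_mul] at h3
  refine tendsto_nhds_unique (tendsto_const_nhds.congr' ?_) h3
  filter_upwards [self_mem_nhdsWithin] with ε hε
  have h0 : (0 : ℝ) < ε := hε
  rw [slope_def_field]
  simp only [pow_one, Real.sqrt_zero, zero_mul, sub_zero]
  rw [← mul_div_assoc, ← mul_assoc, Real.mul_self_sqrt h0.le, mul_div_cancel_left₀ _ h0.ne']

end operations

/-! ## A conformally flat metric on the torus -/

section conformal

variable {n : ℕ} {η : Fin n → ℝ} (i₀ : Fin n) (u w : ℝ)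

/-- The Kronecker symbol. -/
def kd (i j : Fin n) : ℝ := if i = j then 1 else 0

lemma kd_self (i : Fin n) : kd i i = 1 := if_pos rfl

lemma kd_ne {i j : Fin n} (h : i ≠ j) : kd i j = 0 := if_neg h

lemma kd_comm (i j : Fin n) : kd i j = kd j i := by simp [kd, eq_comm]

lemma mul_kd (f : Fin n → ℝ) (i j : Fin n) : f i * kd i j = f j * kd i j := by
  by_cases h : i = j
  · rw [h]
  · rw [kd_ne h, mul_zero, mul_zero]

lemma sum_kd_mul (f : Fin n → ℝ) (i : Fin n) : ∑ j, kd i j * f j = f i := by simp [kd]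

lemma sum_kd_mul' (f : Fin n → ℝ) (i : Fin n) : ∑ j, kd j i * f j = f i := by simp [kd]

lemma diagonal_eq_kd (i j : Fin n) : Matrix.diagonal η i j = η i * kd i j := by
  simp [Matrix.diagonal_apply, kd]

/-- The tensor `2 Γ / u` of the metric `e^ψ η`, where `ψ` depends on the coordinate `i₀` only and has
derivative `u`. -/
def confGamma (η : Fin n → ℝ) (i₀ σ μ ν : Fin n) : ℝ :=
  kd μ i₀ * kd σ ν + kd ν i₀ * kd σ μ - η i₀ * kd σ i₀ * (η μ * kd μ ν)

/-- The first derivatives of `e^ψ η` at a zero of `ψ`. -/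
def confD (η : Fin n → ℝ) (i₀ : Fin n) (u : ℝ) (k i j : Fin n) : ℝ := kd k i₀ * (u * (η i * kd i j))

/-- The second derivatives of `e^ψ η` at a zero of `ψ`. -/
def confDD (η : Fin n → ℝ) (i₀ : Fin n) (w : ℝ) (k l i j : Fin n) : ℝ :=
  kd k i₀ * (kd l i₀ * (w * (η i * kd i j)))

lemma confGamma_zero (μ ν : Fin n) :
    confGamma η i₀ i₀ μ ν = 2 * kd μ i₀ * kd ν i₀ - η i₀ * (η μ * kd μ ν) := by
  rw [confGamma, kd_self, kd_comm i₀ ν, kd_comm i₀ μ]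
  ring

variable (hη : ∀ i, η i * η i = 1)
include hη

lemma inv_diagonal_of_sq : (Matrix.diagonal η)⁻¹ = Matrix.diagonal η := by
  refine Matrix.inv_eq_right_inv ?_
  rw [Matrix.diagonal_mul_diagonal]
  simp [hη]

lemma confGamma_eq (σ μ ν : Fin n) : η σ * (confD η i₀ u μ σ ν + confD η i₀ u ν σ μ
    - confD η i₀ u σ μ ν) = u * confGamma η i₀ σ μ ν := by
  have h1 := mul_kd η σ i₀
  simp only [confD, confGamma]
  linear_combination (u * kd μ i₀ * kd σ ν + u * kd ν i₀ * kd σ μ) * hη σ - u * η μ * kd μ ν * h1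

lemma christoffel_conformal (σ μ ν : Fin n) :
    christoffel (Matrix.diagonal η) (confD η i₀ u) σ μ ν = u / 2 * confGamma η i₀ σ μ ν := by
  rw [christoffel, inv_diagonal_of_sq hη]
  simp only [diagonal_eq_kd, mul_assoc, ← Finset.mul_sum, sum_kd_mul]
  rw [confGamma_eq i₀ u hη]
  ring

lemma dInv_conformal (ρ σ l : Fin n) :
    dInv (Matrix.diagonal η) (confD η i₀ u) ρ σ l = - (kd ρ i₀ * (u * (η σ * kd σ l))) := by
  rw [dInv, inv_diagonal_of_sq hη]
  simp only [diagonal_eq_kd, mul_assoc, ← Finset.mul_sum, sum_kd_mul, confD]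
  linear_combination (-kd ρ i₀ * u * η σ * kd σ l) * hη σ

/-- The term `-u²` comes from the derivative of the inverse metric. As `w` is the second derivative
of `e^ψ` at a zero of `ψ`, the difference `w - u²` is the second derivative of `ψ`. -/
lemma dChristoffel_conformal (ρ σ μ ν : Fin n) :
    dChristoffel (Matrix.diagonal η) (confD η i₀ u) (confDD η i₀ w) ρ σ μ ν
      = kd ρ i₀ * ((w - u ^ 2) / 2 * confGamma η i₀ σ μ ν) := by
  have h1 := confGamma_eq i₀ u hη σ μ ν
  have h2 := confGamma_eq i₀ w hη σ μ ν
  rw [dChristoffel, inv_diagonal_of_sq hη]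
  simp only [dInv_conformal i₀ u hη, diagonal_eq_kd, Finset.sum_add_distrib, neg_mul, mul_assoc,
    ← Finset.mul_sum, sum_kd_mul, Finset.sum_neg_distrib]
  have h3 : confDD η i₀ w ρ μ σ ν + confDD η i₀ w ρ ν σ μ - confDD η i₀ w ρ σ μ ν = kd ρ i₀ *
      (confD η i₀ w μ σ ν + confD η i₀ w ν σ μ - confD η i₀ w σ μ ν) := by
    simp only [confD, confDD]
    ring
  rw [h3]
  linear_combination (-(kd ρ i₀ * u / 2)) * h1 + kd ρ i₀ / 2 * h2

lemma sum_confGamma (μ : Fin n) : ∑ ρ, confGamma η i₀ ρ μ ρ = n * kd μ i₀ := by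
  simp only [confGamma, Finset.sum_add_distrib, Finset.sum_sub_distrib, kd_self, mul_assoc,
    ← Finset.mul_sum, sum_kd_mul']
  rw [kd_comm i₀ μ]
  have h3 := mul_kd η μ i₀
  simp only [Finset.sum_const, Finset.card_univ, Fintype.card_fin, nsmul_eq_mul, mul_one]
  linear_combination (-η i₀) * h3 - kd μ i₀ * hη i₀

lemma sum_confGamma' (μ : Fin n) : ∑ ρ, confGamma η i₀ ρ ρ μ = n * kd μ i₀ := by
  rw [← sum_confGamma i₀ hη μ]
  refine Finset.sum_congr rfl fun ρ _ => ?_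
  simp only [confGamma]
  have := mul_kd η μ ρ
  rw [kd_comm ρ μ]
  linear_combination η i₀ * kd ρ i₀ * this

/-- For `μ = i₀` the symbol is the identity matrix in the other two indices. For `μ ≠ i₀` it has
only the entries at `(μ, i₀)` and `(i₀, μ)`, so just two terms of the sum survive. -/
lemma sum_confGamma_mul (μ : Fin n) : ∑ ρ, ∑ l, confGamma η i₀ ρ μ l * confGamma η i₀ l μ ρ
    = (n + 2 : ℝ) * kd μ i₀ - 2 * (η i₀ * η μ) := by
  by_cases h : μ = i₀
  · subst h
    have h1 : ∀ ρ l, confGamma η μ ρ μ l = kd ρ l := fun ρ l => by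
      rw [confGamma, kd_self, kd_comm l μ]
      linear_combination (-kd ρ μ * kd μ l) * hη μ
    simp only [h1, sum_kd_mul, kd_self]
    rw [hη]
    simp
  · have h1 : ∀ ρ l, confGamma η i₀ ρ μ l * confGamma η i₀ l μ ρ
        = kd ρ μ * (kd l i₀ * (-(η i₀ * η μ))) + kd ρ i₀ * (kd l μ * (-(η i₀ * η μ))) := by
      intro ρ l
      have e1 : kd ρ i₀ * kd ρ μ = 0 := by
        by_cases hr : ρ = μ
        · rw [hr, kd_ne h, zero_mul]
        · rw [kd_ne hr, mul_zero]
      have e2 : kd l i₀ * kd l μ = 0 := by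
        by_cases hr : l = μ
        · rw [hr, kd_ne h, zero_mul]
        · rw [kd_ne hr, mul_zero]
      have e3 : ∀ i j : Fin n, kd i j * kd i j = kd i j := fun i j => by simp [kd]
      simp only [confGamma, kd_ne h, zero_mul, zero_add]
      rw [kd_comm μ l, kd_comm μ ρ]
      linear_combination (kd l i₀ * kd l μ + η i₀ ^ 2 * η μ ^ 2 * kd l i₀ * kd l μ) * e1
        - η i₀ * η μ * kd ρ μ * kd ρ μ * e3 l i₀ - η i₀ * η μ * kd l i₀ * e3 ρ μ
        - η i₀ * η μ * kd l μ * kd l μ * e3 ρ i₀ - η i₀ * η μ * kd ρ i₀ * e3 l μ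
    simp only [h1, Finset.sum_add_distrib, ← Finset.mul_sum, sum_kd_mul']
    rw [kd_ne h]
    ring

/-- The scalar curvature of a conformally flat metric `e^ψ η`, where `ψ` depends on one coordinate,
at a zero of `ψ`. -/
lemma scalarOfJet_conformal :
    scalarOfJet (Matrix.diagonal η) (confD η i₀ u) (confDD η i₀ w)
      = -(η i₀ * (n - 1) * ((w - u ^ 2) + (n - 2) / 4 * u ^ 2)) := by
  -- The inverse metric is diagonal, so only the diagonal of the Ricci tensor contributes to the
  -- trace.
  have hric : ∀ μ, ricci (Matrix.diagonal η) (confD η i₀ u) (confDD η i₀ w) μ μ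
      = (w - u ^ 2) / 2 * (2 * kd μ i₀ * kd μ i₀ - η i₀ * η μ - n * kd μ i₀)
        + u ^ 2 / 4 * (n * (2 * kd μ i₀ * kd μ i₀ - η i₀ * η μ)
          - ((n + 2 : ℝ) * kd μ i₀ - 2 * (η i₀ * η μ))) := by
    intro μ
    have e1 : ∑ ρ, ∑ l, confGamma η i₀ ρ ρ l * confGamma η i₀ l μ μ
        = n * confGamma η i₀ i₀ μ μ := by
      rw [Finset.sum_comm]
      simp only [← Finset.sum_mul, sum_confGamma' i₀ hη, mul_assoc, ← Finset.mul_sum, sum_kd_mul']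
    have e2 := sum_confGamma_mul i₀ hη μ
    have e3 := confGamma_zero (η := η) i₀ μ μ
    rw [kd_self, mul_one] at e3
    rw [ricci]
    simp only [dChristoffel_conformal i₀ u w hη, christoffel_conformal i₀ u hη,
      Finset.sum_sub_distrib, ← Finset.mul_sum, sum_confGamma i₀ hη, sum_kd_mul']
    have e4 : ∑ ρ, ∑ l, u / 2 * confGamma η i₀ ρ ρ l * (u / 2 * confGamma η i₀ l μ μ)
        = u ^ 2 / 4 * (n * confGamma η i₀ i₀ μ μ) := by
      rw [← e1]
      simp only [Finset.mul_sum]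
      exact Finset.sum_congr rfl fun _ _ => Finset.sum_congr rfl fun _ _ => by ring
    have e5 : ∑ ρ, ∑ l, u / 2 * confGamma η i₀ ρ μ l * (u / 2 * confGamma η i₀ l μ ρ)
        = u ^ 2 / 4 * ((n + 2 : ℝ) * kd μ i₀ - 2 * (η i₀ * η μ)) := by
      rw [← e2]
      simp only [Finset.mul_sum]
      exact Finset.sum_congr rfl fun _ _ => Finset.sum_congr rfl fun _ _ => by ring
    rw [e4, e5, e3]
    have e6 : kd μ i₀ * kd μ i₀ = kd μ i₀ := by simp [kd]
    linear_combination (-(w - u ^ 2) / 2 * n) * e6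
  rw [scalarOfJet, inv_diagonal_of_sq hη]
  simp only [diagonal_eq_kd, mul_assoc, ← Finset.mul_sum, sum_kd_mul, hric]
  have e6 : ∀ μ, kd μ i₀ * kd μ i₀ = kd μ i₀ := fun μ => by simp [kd]
  have e7 : ∀ μ, η μ * ((w - u ^ 2) / 2 * (2 * kd μ i₀ * kd μ i₀ - η i₀ * η μ - n * kd μ i₀)
        + u ^ 2 / 4 * (n * (2 * kd μ i₀ * kd μ i₀ - η i₀ * η μ)
          - ((n + 2 : ℝ) * kd μ i₀ - 2 * (η i₀ * η μ))))
      = kd μ i₀ * (η μ * ((w - u ^ 2) / 2 * (2 - n) + u ^ 2 / 4 * (n - 2)))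
        + η i₀ * (-(w - u ^ 2) / 2 - u ^ 2 / 4 * (n - 2)) := fun μ => by
    linear_combination (η μ * (w - u ^ 2) + η μ * n * u ^ 2 / 2) * e6 μ
      + (-(w - u ^ 2) / 2 * η i₀ - u ^ 2 / 4 * (n - 2) * η i₀) * hη μ
  refine (Finset.sum_congr rfl fun μ _ => ?_).trans ((Finset.sum_congr rfl fun μ _ => e7 μ).trans ?_)
  · simp only [mul_assoc]
  · rw [Finset.sum_add_distrib, sum_kd_mul']
    simp only [Finset.sum_const, Finset.card_univ, Fintype.card_fin, nsmul_eq_mul]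
    ring

end conformal

/-! ### The torus as a closed manifold. -/

section torus

/-- The torus `(ℝ/ℤ)ⁿ`. -/
def Torus (n : ℕ) : Type := Fin n → AddCircle (1 : ℝ)

variable {n : ℕ}

instance : TopologicalSpace (Torus n) := inferInstanceAs (TopologicalSpace (Fin n → AddCircle (1 : ℝ)))
instance : T2Space (Torus n) := inferInstanceAs (T2Space (Fin n → AddCircle (1 : ℝ)))
instance : CompactSpace (Torus n) := inferInstanceAs (CompactSpace (Fin n → AddCircle (1 : ℝ)))
instance : SecondCountableTopology (Torus n) :=
  inferInstanceAs (SecondCountableTopology (Fin n → AddCircle (1 : ℝ)))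

/-- The chart of the torus with values in the cube with corner `c`. -/
def torusChart (c : Fin n → ℝ) : OpenPartialHomeomorph (Torus n) (EuclideanSpace ℝ (Fin n)) :=
  (OpenPartialHomeomorph.pi fun i => AddCircle.openPartialHomeomorphCoe (1 : ℝ) (c i)).symm
    |>.transHomeomorph (PiLp.homeomorph 2 fun _ => ℝ).symm

lemma mem_torusChart_target {c : Fin n → ℝ} {y : EuclideanSpace ℝ (Fin n)} :
    y ∈ (torusChart c).target ↔ ∀ i, y i ∈ Ioo (c i) (c i + 1) := by
  have : (torusChart c).target = {y | y.ofLp ∈ univ.pi fun i => Ioo (c i) (c i + 1)} := rfl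
  rw [this]
  exact mem_univ_pi

lemma mem_torusChart_source {c : Fin n → ℝ} {x : Torus n} :
    x ∈ (torusChart c).source ↔ ∀ i, x i ≠ (c i : AddCircle (1 : ℝ)) := by
  have : (torusChart c).source = univ.pi fun i => ({(c i : AddCircle (1 : ℝ))} : Set _)ᶜ := rfl
  rw [this]
  exact mem_univ_pi

lemma exists_int_of_coe_eq {a b : ℝ} (h : (a : AddCircle (1 : ℝ)) = b) : ∃ m : ℤ, a = b + m := by
  have h1 : ((a - b : ℝ) : AddCircle (1 : ℝ)) = 0 := by
    rw [AddCircle.coe_sub, h, sub_self]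
  obtain ⟨m, hm⟩ := (AddCircle.coe_eq_zero_iff (1 : ℝ)).1 h1
  exact ⟨m, by rw [zsmul_one] at hm; linarith⟩

/-- A point of the torus in the centre of a cube. -/
def torusCorner (x : Torus n) (i : Fin n) : ℝ := (AddCircle.equivIco (1 : ℝ) 0 (x i) : ℝ) - 1 / 2

/-- Otherwise a coordinate of `x` and the same coordinate minus `1 / 2` would differ by an integer.
-/
lemma mem_torusChart_corner (x : Torus n) : x ∈ (torusChart (torusCorner x)).source := by
  rw [mem_torusChart_source]
  intro i h
  have h1 : ((AddCircle.equivIco (1 : ℝ) 0 (x i) : ℝ) : AddCircle (1 : ℝ)) = x i :=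
    (AddCircle.equivIco (1 : ℝ) 0).symm_apply_apply (x i)
  obtain ⟨m, hm⟩ := exists_int_of_coe_eq (h1.trans h)
  rw [torusCorner] at hm
  have : (m : ℝ) = 1 / 2 := by linarith
  have h2 : ((2 * m : ℤ) : ℝ) = (1 : ℤ) := by push_cast; linarith
  have := Int.cast_injective h2
  omega

instance : ChartedSpace (EuclideanSpace ℝ (Fin n)) (Torus n) where
  atlas := range torusChart
  chartAt x := torusChart (torusCorner x)
  mem_chart_source := mem_torusChart_corner
  chart_mem_atlas _ := ⟨_, rfl⟩

/-- Transition maps of the torus are locally translations. -/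
lemma torusChart_transition (c c' : Fin n → ℝ) {y : EuclideanSpace ℝ (Fin n)}
    (hy : y ∈ ((torusChart c).symm.trans (torusChart c')).source) :
    ∃ v, ∀ᶠ z in 𝓝 y, torusChart c' ((torusChart c).symm z) = z + v := by
  set ψ := (torusChart c).symm.trans (torusChart c') with hψ
  -- Both charts lift the same point of the torus, so the coordinates differ by integers; by
  -- continuity these are locally constant.
  have hint : ∀ z ∈ ψ.source, ∀ i, ∃ m : ℤ, ψ z i = z i + m := fun z hz i => by
    refine exists_int_of_coe_eq ?_
    have h1 : (torusChart c').symm (ψ z) = (torusChart c).symm z :=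
      (torusChart c').left_inv hz.2
    exact congrFun h1 i
  refine ⟨ψ y - y, ?_⟩
  have hc : ContinuousAt (fun z => ψ z - z) y := (ψ.continuousAt hy).sub continuousAt_id
  filter_upwards [hc.eventually (Metric.ball_mem_nhds _ one_pos), ψ.open_source.mem_nhds hy]
    with z hz hzs
  have : ∀ i, ψ z i - z i = ψ y i - y i := fun i => by
    obtain ⟨m, hm⟩ := hint z hzs i
    obtain ⟨k, hk⟩ := hint y hy i
    have h1 : |(ψ z i - z i) - (ψ y i - y i)| < 1 := by
      rw [dist_eq_norm] at hz
      refine lt_of_le_of_lt ?_ hz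
      exact PiLp.norm_apply_le ((ψ z - z) - (ψ y - y)) i
    rw [hm, hk, add_sub_cancel_left, add_sub_cancel_left] at h1 ⊢
    have h2 : |m - k| < 1 := by
      have h4 : ((|m - k| : ℤ) : ℝ) < (1 : ℤ) := by
        push_cast
        exact h1
      exact Int.cast_lt.1 h4
    have h3 : m = k := by
      have := Int.abs_lt_one_iff.1 h2
      omega
    rw [h3]
  ext i
  have := this i
  change ψ z i = z i + (ψ y i - y i)
  linarith

instance : IsManifold (𝓡 n) ∞ (Torus n) := by
  refine isManifold_of_contDiffOn _ _ _ ?_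
  rintro _ _ ⟨c, rfl⟩ ⟨c', rfl⟩
  intro y hy
  have hy' : y ∈ ((torusChart c).symm.trans (torusChart c')).source := by simpa using hy
  obtain ⟨v, hv⟩ := torusChart_transition c c' hy'
  have h1 : ContDiffAt ℝ ∞ (fun z : EuclideanSpace ℝ (Fin n) => z + v) y :=
    (contDiff_id.add contDiff_const).contDiffAt
  exact (h1.congr_of_eventuallyEq hv).contDiffWithinAt

variable (n) in
/-- The torus as a closed manifold. -/
def torus : Mfld n where
  carrier := Torus n

instance : CompactSpace (torus n) := inferInstanceAs (CompactSpace (Torus n))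

lemma torusChart_mem_charts (c : Fin n → ℝ) : (torusChart c : (torus n).Chart) ∈ (torus n).charts :=
  ⟨c, rfl⟩

/-- The coordinate vectors of the torus are constant. -/
lemma coordVec_torus (c : Fin n → ℝ) (i : Fin n) {y : EuclideanSpace ℝ (Fin n)}
    (hy : y ∈ (torusChart c).target) :
    (coordVec (M := torus n) (torusChart c) i y : EuclideanSpace ℝ (Fin n))
      = EuclideanSpace.single i (1 : ℝ) := by
  have hm : MDifferentiableAt (𝓡 n) (𝓡 n) (torusChart c).symm y :=
    mdifferentiableAt_atlas_symm (torusChart_mem_charts c) hy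
  -- The manifold derivative is computed in the preferred chart at the image point, and the
  -- transition to that chart is locally a translation.
  have hy' : y ∈ ((torusChart c).symm.trans
      (torusChart (torusCorner ((torusChart c).symm y)))).source :=
    ⟨hy, mem_torusChart_corner _⟩
  obtain ⟨v, hv⟩ := torusChart_transition _ _ hy'
  have h1 : HasFDerivAt (fun z => torusChart (torusCorner ((torusChart c).symm y))
      ((torusChart c).symm z)) (ContinuousLinearMap.id ℝ (EuclideanSpace ℝ (Fin n))) y :=
    ((hasFDerivAt_id y).add_const v).congr_of_eventuallyEq hv
  have h2 : mfderiv (𝓡 n) (𝓡 n) (torusChart c).symm y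
      = ContinuousLinearMap.id ℝ (EuclideanSpace ℝ (Fin n)) := by
    rw [hm.mfderiv]
    simp only [mfld_simps, fderivWithin_univ]
    exact h1.fderiv
  exact DFunLike.congr_fun h2 (EuclideanSpace.single i (1 : ℝ) : EuclideanSpace ℝ (Fin n))

end torus

/-! ### A metric of signature `(r, s)` on the torus with non-zero total scalar curvature. -/

section torusMetric

variable {n r s : ℕ}

/-- The signs `-1, …, -1, 1, …, 1` with `r` minus signs and `s` plus signs. -/
def signs (hrs : r + s = n) (i : Fin n) : ℝ :=
  Sum.elim (fun _ : Fin r => (-1 : ℝ)) (fun _ : Fin s => 1)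
    (finSumFinEquiv.symm (finCongr hrs.symm i))

lemma signs_mul_self (hrs : r + s = n) (i : Fin n) : signs hrs i * signs hrs i = 1 := by
  rw [signs]
  rcases finSumFinEquiv.symm (finCongr hrs.symm i) with j | j <;> simp

/-- The bilinear form `∑ η_i u_i v_i`. -/
def diagForm (η : Fin n → ℝ) : LinearMap.BilinForm ℝ (EuclideanSpace ℝ (Fin n)) :=
  LinearMap.mk₂ ℝ (fun u v => ∑ i, η i * (u i * v i))
    (fun u u' v => by simp [add_mul, mul_add, Finset.sum_add_distrib])
    (fun c u v => by
      simp only [PiLp.smul_apply, smul_eq_mul, Finset.mul_sum]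
      exact Finset.sum_congr rfl fun _ _ => by ring)
    (fun u v v' => by simp [mul_add, Finset.sum_add_distrib])
    (fun c u v => by
      simp only [PiLp.smul_apply, smul_eq_mul, Finset.mul_sum]
      exact Finset.sum_congr rfl fun _ _ => by ring)

lemma diagForm_single (η : Fin n → ℝ) (i j : Fin n) :
    diagForm η (EuclideanSpace.single i 1) (EuclideanSpace.single j 1) = η i * kd i j := by
  change ∑ k, η k * ((EuclideanSpace.single i (1 : ℝ) : EuclideanSpace ℝ (Fin n)) k
    * (EuclideanSpace.single j (1 : ℝ) : EuclideanSpace ℝ (Fin n)) k) = _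
  by_cases h : i = j
  · simp [kd, h]
  · simp [kd, h, Ne.symm h]

lemma hasSignature_diagForm (hrs : r + s = n) : HasSignature r s (diagForm (signs hrs)) := by
  refine ⟨(EuclideanSpace.basisFun (Fin n) ℝ).toBasis.reindex
    (finSumFinEquiv.trans (finCongr hrs)).symm, fun i j => ?_⟩
  simp only [Module.Basis.reindex_apply, OrthonormalBasis.coe_toBasis, EuclideanSpace.basisFun_apply,
    Equiv.symm_symm]
  rw [diagForm_single, kd]
  simp [signs]

lemma periodic_exp_sin : Function.Periodic (fun t : ℝ => Real.exp (Real.sin (2 * Real.pi * t))) 1 :=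
  fun t => by
    simp only [mul_add, mul_one, Real.sin_add_two_pi]

/-- A non-constant conformal factor on the torus. -/
def torusFactor (i₀ : Fin n) (x : Torus n) : ℝ := periodic_exp_sin.lift (x i₀)

lemma torusFactor_pos (i₀ : Fin n) (x : Torus n) : 0 < torusFactor i₀ x := by
  obtain ⟨t, ht⟩ := QuotientAddGroup.mk_surjective (x i₀)
  rw [torusFactor, ← ht]
  exact Real.exp_pos _

/-- A conformally flat tensor field on the torus. -/
def torusTensor (η : Fin n → ℝ) (i₀ : Fin n) : Tensor2 (torus n) :=
  fun x => torusFactor i₀ x • (diagForm η : LinearMap.BilinForm ℝ (EuclideanSpace ℝ (Fin n)))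

/-- The conformal factor in coordinates. -/
def confFactor (t : ℝ) : ℝ := Real.exp (Real.sin (2 * Real.pi * t))

lemma component_torusTensor (η : Fin n → ℝ) (i₀ : Fin n) (c : Fin n → ℝ) (i j : Fin n) :
    EqOn (fun y => confFactor (y i₀) * (η i * kd i j))
      (component (torusTensor η i₀) (torusChart c) i j) (torusChart c).target := fun y hy => by
  have h1 := coordVec_torus c i hy
  have h2 := coordVec_torus c j hy
  refine Eq.symm ((congrArg₂ (fun u v : EuclideanSpace ℝ (Fin n) =>
    torusFactor i₀ ((torusChart c).symm y) * diagForm η u v) h1 h2).trans ?_)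
  rw [diagForm_single]
  rfl

lemma contDiff_confFactor : ContDiff ℝ ∞ confFactor :=
  Real.contDiff_exp.comp (Real.contDiff_sin.comp (contDiff_const.mul contDiff_id))

lemma memW2Loc_of_contDiffOn {p : ℝ≥0∞} {U : Set (EuclideanSpace ℝ (Fin n))} (hU : IsOpen U)
    {f : EuclideanSpace ℝ (Fin n) → ℝ} (hf : ContDiffOn ℝ ∞ f U) : MemW2Loc p U f := by
  have h : ∀ {g : EuclideanSpace ℝ (Fin n) → ℝ}, ContDiffOn ℝ ∞ g U → LocMemLp p U g :=
    fun {g} hg K hK hc => by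
      obtain ⟨B, hB⟩ := hc.exists_bound_of_continuousOn (hg.continuousOn.mono hK)
      have : IsFiniteMeasure (volume.restrict K) := ⟨by simpa using hc.measure_lt_top⟩
      exact (memLp_top_of_bound ((hg.continuousOn.mono hK).aestronglyMeasurable hc.measurableSet) B
        ((ae_restrict_iff' hc.measurableSet).2 (Filter.Eventually.of_forall hB))).mono_exponent le_top
  exact ⟨h hf, fun i => ⟨pd i f, hasWeakPartial_of_contDiffOn hU hf, h (contDiffOn_pd hU hf),
    fun j => ⟨pd j (pd i f), hasWeakPartial_of_contDiffOn hU (contDiffOn_pd hU hf),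
      h (contDiffOn_pd hU (contDiffOn_pd hU hf))⟩⟩⟩

lemma contDiff_comp_coord {φ : ℝ → ℝ} (hφ : ContDiff ℝ ∞ φ) (i₀ : Fin n) (c : ℝ) :
    ContDiff ℝ ∞ fun y : EuclideanSpace ℝ (Fin n) => φ (y i₀) * c :=
  (hφ.comp (EuclideanSpace.proj (𝕜 := ℝ) i₀).contDiff).mul contDiff_const

lemma pd_comp_coord {φ φ' : ℝ → ℝ} (hφ : ∀ t, HasDerivAt φ (φ' t) t) (i₀ k : Fin n) (c : ℝ) :
    pd k (fun y : EuclideanSpace ℝ (Fin n) => φ (y i₀) * c) = fun y => φ' (y i₀) * (kd k i₀ * c) := by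
  funext y
  have h1 : HasFDerivAt (fun y : EuclideanSpace ℝ (Fin n) => y i₀)
      (EuclideanSpace.proj (𝕜 := ℝ) i₀ : EuclideanSpace ℝ (Fin n) →L[ℝ] ℝ) y :=
    (EuclideanSpace.proj (𝕜 := ℝ) i₀ : EuclideanSpace ℝ (Fin n) →L[ℝ] ℝ).hasFDerivAt
  have h2 := (((hφ (y i₀)).comp_hasFDerivAt y h1).mul_const c).fderiv
  simp only [pd]
  erw [h2]
  by_cases h : k = i₀
  · simp [kd, h]
    ring
  · simp [kd, h]

/-- The conformally flat metric on the torus. -/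
def torusMetric (hrs : r + s = n) (p : ℝ≥0∞) (i₀ : Fin n) : EHMetric (torus n) r s p where
  toTensor := torusTensor (signs hrs) i₀
  isW2Loc := by
    rintro _ ⟨c, rfl⟩ i j
    have h1 := component_torusTensor (signs hrs) i₀ c i j
    have h2 := contDiff_comp_coord contDiff_confFactor i₀ (signs hrs i * kd i j)
    exact ⟨h2.continuous.continuousOn.congr h1.symm,
      (memW2Loc_of_contDiffOn (torusChart c).open_target h2.contDiffOn).congr
        (torusChart c).open_target h1⟩
  hasSignature := fun x => (hasSignature_diagForm hrs).const_smul (torusFactor_pos i₀ x)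

/-- The derivative of `log confFactor`. -/
def confLogDeriv (t : ℝ) : ℝ := 2 * Real.pi * Real.cos (2 * Real.pi * t)

/-- The second derivative of `log confFactor`. -/
def confLogDeriv₂ (t : ℝ) : ℝ := -(2 * Real.pi) ^ 2 * Real.sin (2 * Real.pi * t)

lemma hasDerivAt_two_pi_mul (t : ℝ) : HasDerivAt (fun t => 2 * Real.pi * t) (2 * Real.pi) t := by
  simpa using (hasDerivAt_id t).const_mul (2 * Real.pi)

lemma hasDerivAt_sin_two_pi (t : ℝ) :
    HasDerivAt (fun t => Real.sin (2 * Real.pi * t)) (confLogDeriv t) t :=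
  (hasDerivAt_two_pi_mul t).sin.congr_deriv (mul_comm _ _)

lemma hasDerivAt_confLogDeriv (t : ℝ) : HasDerivAt confLogDeriv (confLogDeriv₂ t) t := by
  have := ((hasDerivAt_two_pi_mul t).cos).const_mul (2 * Real.pi)
  refine this.congr_deriv ?_
  rw [confLogDeriv₂]
  ring

lemma hasDerivAt_confFactor (t : ℝ) : HasDerivAt confFactor (confFactor t * confLogDeriv t) t :=
  (hasDerivAt_sin_two_pi t).exp

lemma hasDerivAt_confFactor_mul (t : ℝ) : HasDerivAt (fun t => confFactor t * confLogDeriv t)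
    (confFactor t * (confLogDeriv₂ t + confLogDeriv t ^ 2)) t :=
  ((hasDerivAt_confFactor t).mul (hasDerivAt_confLogDeriv t)).congr_deriv (by ring)

/-- The Lagrangian density of the metric on the torus. -/
lemma lagrangian_torus (hrs : r + s = n) (p : ℝ≥0∞) (i₀ : Fin n) (c : Fin n → ℝ) :
    ∀ᵐ y ∂volume.restrict (torusChart c).target,
      density (torusMetric hrs p i₀).toTensor (torusChart c) y
        * chartScalar (torusMetric hrs p i₀).toTensor (torusChart c) y
      = -(signs hrs i₀ * (n - 1)) * (Real.exp ((n - 2) / 2 * Real.sin (2 * Real.pi * y i₀))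
        * (confLogDeriv₂ (y i₀) + (n - 2) / 4 * confLogDeriv (y i₀) ^ 2)) := by
  set η := signs hrs with hη
  have hη2 := signs_mul_self hrs
  have hU := (torusChart c).open_target
  have hcomp := component_torusTensor η i₀ c
  set F := fun i j => fun y : EuclideanSpace ℝ (Fin n) => confFactor (y i₀) * (η i * kd i j) with hF
  have hFs : ∀ i j, ContDiff ℝ ∞ (F i j) := fun i j => contDiff_comp_coord contDiff_confFactor i₀ _
  have e1 : ∀ k i j, weakPartial (torusChart c).target k
      (component (torusTensor η i₀) (torusChart c) i j) =ᵐ[volume.restrict (torusChart c).target]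
      pd k (F i j) := fun k i j => by
    rw [← weakPartial_congr hU ((ae_restrict_iff' hU.measurableSet).2
      (Filter.Eventually.of_forall (hcomp i j)))]
    exact (hasWeakPartial_of_contDiffOn hU (hFs i j).contDiffOn).weakPartial_ae_eq hU
  have e2 : ∀ k l i j, weakPartial (torusChart c).target k (weakPartial (torusChart c).target l
      (component (torusTensor η i₀) (torusChart c) i j)) =ᵐ[volume.restrict (torusChart c).target]
      pd k (pd l (F i j)) := fun k l i j => by
    rw [weakPartial_congr hU (e1 l i j)]
    exact (hasWeakPartial_of_contDiffOn hU
      (contDiffOn_pd hU (hFs i j).contDiffOn)).weakPartial_ae_eq hU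
  filter_upwards [ae_all_iff.2 fun k => ae_all_iff.2 fun i => ae_all_iff.2 fun j => e1 k i j,
    ae_all_iff.2 fun k => ae_all_iff.2 fun l => ae_all_iff.2 fun i => ae_all_iff.2 fun j =>
      e2 k l i j, ae_restrict_mem hU.measurableSet] with y h1 h2 hy
  have hpos : 0 < confFactor (y i₀) := Real.exp_pos _
  have hG : gramMatrix (torusMetric hrs p i₀).toTensor (torusChart c) y
      = confFactor (y i₀) • Matrix.diagonal η := by
    ext i j
    rw [Matrix.smul_apply, diagonal_eq_kd, smul_eq_mul]
    exact (hcomp i j hy).symm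
  have hS : chartScalar (torusMetric hrs p i₀).toTensor (torusChart c) y
      = (confFactor (y i₀))⁻¹ * -(η i₀ * (n - 1) * (confLogDeriv₂ (y i₀)
        + (n - 2) / 4 * confLogDeriv (y i₀) ^ 2)) := by
    -- The jet of `e^ψ η` is `e^ψ` times the normalized one, with `u = ψ'` and `w = ψ'' + ψ'²`. The
    -- formula at a zero of `ψ` is carried to all points by `scalarOfJet_smul`.
    have h3 := scalarOfJet_conformal i₀ (confLogDeriv (y i₀))
      (confLogDeriv₂ (y i₀) + confLogDeriv (y i₀) ^ 2) hη2
    rw [add_sub_cancel_right] at h3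
    rw [← h3, ← scalarOfJet_smul hpos.ne', ← hG]
    refine congrArg₂ (scalarOfJet (gramMatrix (torusMetric hrs p i₀).toTensor (torusChart c) y))
      ?_ ?_
    · funext k i j
      refine (h1 k i j).trans ?_
      rw [hF, pd_comp_coord hasDerivAt_confFactor]
      simp only [confD]
      ring
    · funext k l i j
      refine (h2 k l i j).trans ?_
      rw [hF, pd_comp_coord hasDerivAt_confFactor, pd_comp_coord hasDerivAt_confFactor_mul]
      simp only [confDD]
      ring
  -- The density is `e^(n ψ / 2)` because `|det η| = 1`, and the curvature carries `e^(-ψ)`.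
  have hD : density (torusMetric hrs p i₀).toTensor (torusChart c) y * (confFactor (y i₀))⁻¹
      = Real.exp ((n - 2) / 2 * Real.sin (2 * Real.pi * y i₀)) := by
    have h4 : |(Matrix.diagonal η).det| = 1 := by
      rw [Matrix.det_diagonal, Finset.abs_prod]
      refine Finset.prod_eq_one fun i _ => ?_
      have := hη2 i
      rw [← abs_mul_abs_self] at this
      nlinarith [abs_nonneg (η i)]
    have h5 : density (torusMetric hrs p i₀).toTensor (torusChart c) y
        = √|(confFactor (y i₀) • Matrix.diagonal η).det| := by
      rw [← hG]
      rfl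
    rw [h5, Matrix.det_smul, abs_mul, h4, mul_one, Fintype.card_fin,
      abs_of_pos (pow_pos hpos n), confFactor, ← Real.exp_nat_mul, ← Real.exp_half, ← Real.exp_neg,
      ← Real.exp_add]
    congr 1
    ring
  rw [hS, ← mul_assoc, hD]
  ring

/-- With `a` instead of `a / 2` the integrand would be the derivative of the periodic function `E
ψ'` and integrate to zero. What is left is `-a / 2` times the integral of `E ψ'²`, which is positive
since `ψ'` is not zero at `0`. -/
lemma integral_torus_neg {a : ℝ} (ha : 0 < a) : ∫ t in (0 : ℝ)..1,
    Real.exp (a * Real.sin (2 * Real.pi * t)) * (confLogDeriv₂ t + a / 2 * confLogDeriv t ^ 2) < 0 := by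
  set E : ℝ → ℝ := fun t => Real.exp (a * Real.sin (2 * Real.pi * t)) with hE
  have hEd : ∀ t, HasDerivAt E (E t * (a * confLogDeriv t)) t := fun t =>
    ((hasDerivAt_sin_two_pi t).const_mul a).exp
  have hd : ∀ t, HasDerivAt (fun t => E t * confLogDeriv t)
      (E t * (confLogDeriv₂ t + a * confLogDeriv t ^ 2)) t := fun t =>
    ((hEd t).mul (hasDerivAt_confLogDeriv t)).congr_deriv (by ring)
  have c1 : Continuous E := by fun_prop
  have c2 : Continuous confLogDeriv := by unfold confLogDeriv; fun_prop
  have c3 : Continuous confLogDeriv₂ := by unfold confLogDeriv₂; fun_prop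
  have h1 : ∫ t in (0 : ℝ)..1, E t * (confLogDeriv₂ t + a * confLogDeriv t ^ 2) = 0 := by
    rw [intervalIntegral.integral_eq_sub_of_hasDerivAt (fun t _ => hd t)
      (Continuous.intervalIntegrable (by fun_prop) _ _)]
    simp [hE, confLogDeriv]
  have h2 : 0 < ∫ t in (0 : ℝ)..1, a / 2 * (E t * confLogDeriv t ^ 2) := by
    refine intervalIntegral.integral_pos zero_lt_one (by fun_prop) (fun t _ => ?_)
      ⟨0, by simp, ?_⟩
    · have := Real.exp_pos (a * Real.sin (2 * Real.pi * t))
      positivity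
    · simp only [hE, confLogDeriv]
      have := Real.pi_pos
      simp
      positivity
  have h3 : ∫ t in (0 : ℝ)..1, E t * (confLogDeriv₂ t + a / 2 * confLogDeriv t ^ 2)
      = (∫ t in (0 : ℝ)..1, E t * (confLogDeriv₂ t + a * confLogDeriv t ^ 2))
        - ∫ t in (0 : ℝ)..1, a / 2 * (E t * confLogDeriv t ^ 2) := by
    rw [← intervalIntegral.integral_sub (Continuous.intervalIntegrable (by fun_prop) _ _)
      (Continuous.intervalIntegrable (by fun_prop) _ _)]
    refine intervalIntegral.integral_congr fun t _ => ?_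
    ring
  rw [h3, h1]
  linarith

/-- Integration over a cube of a function of one coordinate. -/
lemma integral_torusChart_target (i₀ : Fin n) {H : ℝ → ℝ} (hH : Continuous H) :
    ∫ y in (torusChart (0 : Fin n → ℝ)).target, H (y i₀) = ∫ t in (0 : ℝ)..1, H t := by
  have h1 : (torusChart (0 : Fin n → ℝ)).target
      = WithLp.ofLp ⁻¹' (univ.pi fun _ : Fin n => Ioo (0 : ℝ) 1) := by
    ext y
    rw [mem_torusChart_target]
    simp
  have hme : MeasurableEmbedding (WithLp.ofLp : EuclideanSpace ℝ (Fin n) → Fin n → ℝ) :=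
    (MeasurableEquiv.toLp 2 (Fin n → ℝ)).symm.measurableEmbedding
  rw [h1, (PiLp.volume_preserving_ofLp (Fin n)).setIntegral_preimage_emb hme
    (fun y : Fin n → ℝ => H (y i₀)), volume_pi, Measure.restrict_pi_pi]
  -- Each coordinate runs through an interval of length one, so the coordinates other than `i₀`
  -- integrate to `1`.
  have hν : IsProbabilityMeasure ((volume : Measure ℝ).restrict (Ioo 0 1)) := ⟨by simp⟩
  have hmp := measurePreserving_eval
    (fun _ : Fin n => (volume : Measure ℝ).restrict (Ioo (0 : ℝ) 1)) i₀
  have h2 := integral_map (φ := Function.eval i₀)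
    (μ := Measure.pi fun _ : Fin n => (volume : Measure ℝ).restrict (Ioo (0 : ℝ) 1)) (f := H) hmp.measurable.aemeasurable
    hH.aestronglyMeasurable
  rw [hmp.map_eq] at h2
  rw [intervalIntegral.integral_of_le zero_le_one, integral_Ioc_eq_integral_Ioo, h2]

/-- A property holds almost everywhere if it does so in all charts. -/
lemma ae_volumeMeasure {M : Mfld n} (g : Tensor2 M) {P : M → Prop}
    (h : ∀ e ∈ M.charts, ∀ᵐ y ∂volume.restrict e.target, P (e.symm y)) :
    ∀ᵐ x ∂volumeMeasure g, P x := by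
  rcases isEmpty_or_nonempty M with hM | hM
  · exact Filter.Eventually.of_forall fun x => hM.elim x
  obtain ⟨E, hE, hEU⟩ := exists_countable_charts M
  rw [← Measure.restrict_univ (μ := volumeMeasure g), ← hEU, ae_restrict_iUnion_iff]
  intro k
  rw [isVolumeMeasure_iff.1 (isVolumeMeasure_volumeMeasure g) _ (hE k)]
  exact ae_chartMeasure g (E k) (h _ (hE k))

/-- Almost every point of the torus lies in the domain of a given chart. -/
lemma ae_mem_torusChart_source (g : Tensor2 (torus n)) {e : (torus n).Chart} {c : Fin n → ℝ}
    (he : e = torusChart c) : ∀ᵐ x ∂volumeMeasure g, x ∈ e.source := by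
  refine ae_volumeMeasure g ?_
  rintro _ ⟨b, rfl⟩
  refine ae_restrict_of_ae ?_
  -- In coordinates the complement of the chart domain lies in countably many hyperplanes `y i = c i
  -- + m`.
  have h1 : ∀ (i : Fin n) (m : ℤ), ∀ᵐ y : EuclideanSpace ℝ (Fin n), y i ≠ c i + m := fun i m => by
    have h2 : volume {y : Fin n → ℝ | y i = c i + m} = 0 := by
      rw [volume_pi]
      exact Measure.pi_hyperplane _ i _
    simp only [ae_iff, not_not]
    exact (PiLp.volume_preserving_ofLp (Fin n)).quasiMeasurePreserving.preimage_null h2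
  filter_upwards [ae_all_iff.2 fun i => ae_all_iff.2 fun m => h1 i m] with y hy
  rw [he]
  refine mem_torusChart_source.2 fun i h => ?_
  obtain ⟨m, hm⟩ := exists_int_of_coe_eq h
  exact hy i m hm

/-- There are closed manifolds with non-zero total scalar curvature. -/
theorem lagrangianIntegral_torus_ne_zero (hrs : r + s = n) (hn : 2 < n) (p : ℝ≥0∞) (i₀ : Fin n) :
    lagrangianIntegral (torusMetric hrs p i₀).toTensor univ ≠ 0 := by
  set g := torusMetric hrs p i₀ with hg
  set e : (torus n).Chart := torusChart 0 with he
  have hee : e ∈ (torus n).charts := torusChart_mem_charts 0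
  -- A single chart covers the torus up to a null set, so the action is one integral over a cube.
  have h1 : lagrangianIntegral g.toTensor univ = lagrangianIntegral g.toTensor e.source := by
    have h0 : (volumeMeasure g.toTensor).restrict e.source = volumeMeasure g.toTensor :=
      Measure.restrict_eq_self_of_ae_mem (ae_mem_torusChart_source g.toTensor he)
    rw [lagrangianIntegral, lagrangianIntegral, Measure.restrict_univ, h0]
  have h2 : e.target ∩ e.symm ⁻¹' e.source = e.target :=
    inter_eq_left.2 fun y hy => e.map_target hy
  rw [h1, g.lagrangianIntegral_chart hee e.open_source.measurableSet subset_rfl, h2,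
    integral_congr_ae (lagrangian_torus hrs p i₀ 0)]
  have hc : Continuous fun t => Real.exp ((n - 2) / 2 * Real.sin (2 * Real.pi * t))
        * (confLogDeriv₂ t + (n - 2) / 4 * confLogDeriv t ^ 2) := by
    unfold confLogDeriv confLogDeriv₂
    fun_prop
  have hn' : (2 : ℝ) < n := by exact_mod_cast hn
  have h3 := integral_torus_neg (a := ((n : ℝ) - 2) / 2) (by linarith)
  rw [integral_const_mul, integral_torusChart_target i₀ hc]
  refine mul_ne_zero (neg_ne_zero.2 (mul_ne_zero ?_ (by linarith))) ?_
  · intro h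
    have := signs_mul_self hrs i₀
    rw [h] at this
    simp at this
  · refine ne_of_lt (lt_of_eq_of_lt ?_ h3)
    congr 1
    funext t
    ring

end torusMetric

end EH

end

/-! ### The three cases. -/

theorem mainTheorem1 (n r s : ℕ) (hrs : r + s = n) (hn : 2 < n) (p : ℝ≥0∞)
    (hp : (n : ℝ≥0∞) / 2 < p) :
    @Continuous (EH.Config n r s p) ℝ EH.tau1 inferInstance EH.action ∧
    (n < 4 →
      ¬ EH.TopologicallyDifferentiable (EH.action (n := n) (r := r) (s := s) (p := p)) ∧
      (∀ (c : EH.Config n r s p) (M' : EH.Mfld n) (_ : CompactSpace M')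
        (g' : EH.EHMetric M' r s p), EH.meanScalarCurvature g'.toTensor ≠ 0 →
          ¬ ∃ L, EH.HasTopologicalDeriv EH.action c M' g' L) ∧
      (∀ c : EH.Config n r s p, ∃ (M' : EH.Mfld n) (_ : CompactSpace M')
        (g' : EH.EHMetric M' r s p), ¬ ∃ L, EH.HasTopologicalDeriv EH.action c M' g' L)) ∧
    (n = 4 →
      EH.TopologicallyDifferentiable (EH.action (n := n) (r := r) (s := s) (p := p)) ∧
      (∀ (c : EH.Config n r s p) (M' : EH.Mfld n) (_ : CompactSpace M')
        (g' : EH.EHMetric M' r s p),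
          EH.HasTopologicalDeriv EH.action c M' g'
            (EH.lagrangianIntegral g'.toTensor Set.univ)) ∧
      (∀ c : EH.Config n r s p, ∃ (M' : EH.Mfld n) (_ : CompactSpace M')
        (g' : EH.EHMetric M' r s p) (L : ℝ),
          EH.HasTopologicalDeriv EH.action c M' g' L ∧ L ≠ 0) ∧
      (∀ (c : EH.Config n r s p) (M' : EH.Mfld n) (_ : CompactSpace M')
        (g' : EH.EHMetric M' r s p) (L : ℝ), EH.HasTopologicalDeriv EH.action c M' g' L →
          (L = 0 ↔ EH.meanScalarCurvature g'.toTensor = 0))) ∧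
    (4 < n →
      EH.TopologicallyDifferentiable (EH.action (n := n) (r := r) (s := s) (p := p)) ∧
      (∀ (c : EH.Config n r s p) (M' : EH.Mfld n) (_ : CompactSpace M')
        (g' : EH.EHMetric M' r s p), EH.HasTopologicalDeriv EH.action c M' g' 0)) := by
  have hderiv : ∀ (c : EH.Config n r s p) (M' : EH.Mfld n) (_ : CompactSpace M')
      (g' : EH.EHMetric M' r s p) (L : ℝ), EH.HasTopologicalDeriv EH.action c M' g' L ↔
        HasDerivWithinAt (fun ε : ℝ => √(ε ^ (n - 2)) * EH.lagrangianIntegral g'.toTensor Set.univ)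
          L (Set.Ici 0) 0 :=
    fun c M' _ g' L => EH.hasTopologicalDeriv_action_iff hn hp c M' g' L
  -- This metric is the witness both for the failure of differentiability when `n < 4` and for the
  -- non-zero derivative when `n = 4`.
  let T : EH.EHMetric (EH.torus n) r s p := EH.torusMetric hrs p ⟨0, by omega⟩
  have hT : EH.lagrangianIntegral T.toTensor Set.univ ≠ 0 :=
    EH.lagrangianIntegral_torus_ne_zero hrs hn p _
  refine ⟨EH.continuous_action hn hp, fun h => ?_, fun h => ?_, fun h => ?_⟩
  · have hn3 : n - 2 = 1 := by omega
    rw [hn3] at hderiv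
    have key : ∀ (c : EH.Config n r s p) (M' : EH.Mfld n) (_ : CompactSpace M')
        (g' : EH.EHMetric M' r s p), EH.lagrangianIntegral g'.toTensor Set.univ ≠ 0 →
          ¬ ∃ L, EH.HasTopologicalDeriv EH.action c M' g' L := fun c M' hM' g' hg' ⟨L, hL⟩ =>
      hg' (EH.eq_zero_of_hasDerivWithinAt_sqrt ((hderiv c M' hM' g' L).1 hL))
    -- Refuting differentiability takes one configuration. The empty set serves as `Ω`, since the
    -- action of the base configuration plays no part.
    let c₀ : EH.Config n r s p := ⟨EH.torus n, T, ∅, isOpen_empty, by simp⟩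
    exact ⟨fun hd => key c₀ _ inferInstance T hT (hd c₀ _ inferInstance T),
      fun c M' hM' g' hg' => key c M' hM' g'
        fun h0 => hg' ((EH.EHMetric.meanScalarCurvature_eq_zero_iff hn hp g').2 h0),
      fun c => ⟨_, inferInstance, T, key c _ inferInstance T hT⟩⟩
  · have hn4 : n - 2 = 2 := by omega
    rw [hn4] at hderiv
    have key : ∀ (c : EH.Config n r s p) (M' : EH.Mfld n) (_ : CompactSpace M')
        (g' : EH.EHMetric M' r s p),
          EH.HasTopologicalDeriv EH.action c M' g' (EH.lagrangianIntegral g'.toTensor Set.univ) :=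
      fun c M' hM' g' => (hderiv c M' hM' g' _).2 (EH.hasDerivWithinAt_sqrt_pow_four _)
    refine ⟨fun c M' hM' g' => ⟨_, key c M' hM' g'⟩, key,
      fun c => ⟨_, inferInstance, T, _, key c _ inferInstance T, hT⟩,
      fun c M' hM' g' L hL => ?_⟩
    -- One-sided derivatives on `[0, ∞)` are unique, so `L` is the total scalar curvature of `g'`.
    rw [EH.EHMetric.meanScalarCurvature_eq_zero_iff hn hp g',
      (uniqueDiffWithinAt_Ici (0 : ℝ)).eq_deriv _ hL (key c M' hM' g')]
  · have key : ∀ (c : EH.Config n r s p) (M' : EH.Mfld n) (_ : CompactSpace M')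
        (g' : EH.EHMetric M' r s p), EH.HasTopologicalDeriv EH.action c M' g' 0 :=
      fun c M' hM' g' => (hderiv c M' hM' g' _).2
        (EH.hasDerivWithinAt_sqrt_pow_of_lt (by omega) _)
    exact ⟨fun c M' hM' g' => ⟨0, key c M' hM' g'⟩, key⟩
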